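/- Let $T$ and $\mathscr X$ be smooth irreducible complex algebraic varieties and let $\pi\colon\mathscr X\to T$ be a proper submersion (a proper smooth morphism of relative dimension $2$) all of whose closed fibres $\mathscr X_t=\pi^{-1}(t)$ are irreducible smooth projective surfaces. Let $\mathscr F$ be an algebraic foliation of dimension one on $\mathscr X$ (a saturated coherent subsheaf of rank one of the tangent sheaf $T_{\mathscr X}$) which is everywhere tangent to the fibres of $\pi$. The singular set $\operatorname{Sing}(\mathscr F)$ is the set of points at which all local vector fields tangent to $\mathscr F$ vanish. For a closed point $t\in T$ with $\mathscr X_t\not\subset\operatorname{Sing}(\mathscr F)$, let $\mathscr F_t$ be the foliation on the surface $\mathscr X_t$ obtained by restricting $\mathscr F$; we then say that the member $\mathscr F_t$ is defined. A foliation $\mathcal F$ on a projective surface is called transversely affine if for every non-zero rational $1$-form $\omega_0$ defining $\mathcal F$ there exists a rational $1$-form $\omega_1$ such that $$d\omega_0=\omega_0\wedge\omega_1,\qquad d\omega_1=0,$$ and transversely projective if for every non-zero rational $1$-form $\omega_0$ defining $\mathcal F$ there exist rational $1$-forms $\omega_1,\omega_2$ such that $$d\omega_0=\omega_0\wedge\omega_1,\qquad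 d\omega_1=2\,\omega_0\wedge\omega_2,\qquad d\omega_2=\omega_1\wedge\omega_2 .$$ A property holds for a very general closed point of $T$ if it holds for all closed points outside a countable union of proper Zariski closed subsets of $T$. (1) If for a very general closed point $t_0\in T$ (among those at which the member is defined) the foliation $\mathscr F_{t_0}$ is transversely projective, then for every closed point $t\in T$ at which $\mathscr F_t$ is defined the foliation $\mathscr F_t$ is transversely projective. (2) If for a very general closed point $t_0\in T$ (among those at which the member is defined) the foliation $\mathscr F_{t_0}$ is transversely affine, then for every closed point $t\in T$ at which $\mathscr F_t$ is defined the foliation $\mathscr F_t$ is transversely affine. -/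

import Mathlib

open CategoryTheory AlgebraicGeometry TopologicalSpace

noncomputable section

namespace FoliatedFamily

/-! ### Differential forms: wedge product and exterior derivative of `1`-forms -/

section Forms

variable (k K : Type*) [CommRing k] [CommRing K] [Algebra k K]

/-- The differential `1`-forms of `K` over `k`. -/
abbrev OneForm := KaehlerDifferential k K

/-- The exterior algebra of the module of `1`-forms, where `2`-forms live. -/
abbrev Forms := ExteriorAlgebra K (OneForm k K)

variable {k K}

/-- The `2`-form `ω ∧ η`. -/
def wedge (ω η : OneForm k K) : Forms k K :=
  ExteriorAlgebra.ι K ω * ExteriorAlgebra.ι K η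

theorem wedge_add_left (ω ω' η : OneForm k K) :
    wedge (ω + ω') η = wedge ω η + wedge ω' η := by
  simp [wedge, add_mul]

theorem wedge_add_right (ω η η' : OneForm k K) :
    wedge ω (η + η') = wedge ω η + wedge ω η' := by
  simp [wedge, mul_add]

theorem wedge_smul_left (a : K) (ω η : OneForm k K) :
    wedge (a • ω) η = a • wedge ω η := by
  simp [wedge]

theorem wedge_smul_right (a : K) (ω η : OneForm k K) :
    wedge ω (a • η) = a • wedge ω η := by
  simp [wedge]

theorem wedge_zero_right (ω : OneForm k K) : wedge ω 0 = 0 := by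
  simp [wedge]

theorem wedge_swap (ω η : OneForm k K) : wedge ω η + wedge η ω = 0 :=
  ExteriorAlgebra.ι_add_mul_swap ω η

/-- On the free module with basis `[g]`, `g ∈ K`, the additive map `f • [g] ↦ df ∧ dg`. -/
def preD : (K →₀ K) →+ Forms k K :=
  Finsupp.liftAddHom fun g =>
    { toFun := fun f => wedge (KaehlerDifferential.D k K f) (KaehlerDifferential.D k K g)
      map_zero' := by simp [wedge]
      map_add' := fun f f' => by rw [map_add, wedge_add_left] }

theorem preD_single (g f : K) :
    preD (k := k) (Finsupp.single g f) =
      wedge (KaehlerDifferential.D k K f) (KaehlerDifferential.D k K g) := by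
  simp only [preD]
  rw [Finsupp.liftAddHom_apply_single]
  rfl

theorem preD_eq_zero (x : K →₀ K) (hx : x ∈ KaehlerDifferential.kerTotal k K) :
    preD (k := k) x = 0 := by
  have key : ∀ r ∈ KaehlerDifferential.kerTotal k K, ∀ s : K, preD (k := k) (s • r) = 0 := by
    intro r hr
    unfold KaehlerDifferential.kerTotal at hr
    refine Submodule.span_induction ?_ ?_ ?_ ?_ hr
    · rintro _ ((⟨⟨x, y⟩, rfl⟩ | ⟨⟨x, y⟩, rfl⟩) | ⟨c, rfl⟩) s
      · simp [smul_sub, smul_add, preD_single, wedge_add_right]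
      · simp only [smul_sub, smul_add, Finsupp.smul_single, map_sub, map_add, preD_single,
          smul_eq_mul, mul_one, Derivation.leibniz, wedge_add_left, wedge_add_right,
          wedge_smul_left, wedge_smul_right]
        have h := wedge_swap (KaehlerDifferential.D k K x) (KaehlerDifferential.D k K y)
        have h' := congrArg (fun z => s • z) h
        simp only [smul_add, smul_zero] at h'
        rw [← h']
        abel
      · simp [preD_single, wedge_zero_right]
    · intro s; simp
    · intro a b _ _ ha hb s
      rw [smul_add, map_add, ha, hb, add_zero]
    · intro c a _ ha s
      rw [smul_smul, ha]
  simpa using key x hx 1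

/-- The exterior derivative of `1`-forms; it is characterised by `d_smul_D`. -/
def d : OneForm k K →+ Forms k K :=
  (QuotientAddGroup.lift (KaehlerDifferential.kerTotal k K).toAddSubgroup preD
    (fun x hx => preD_eq_zero x hx)).comp
    (KaehlerDifferential.quotKerTotalEquiv k K).symm.toLinearMap.toAddMonoidHom

/-- `d (f dg) = df ∧ dg`. -/
theorem d_smul_D (f g : K) :
    d (f • KaehlerDifferential.D k K g) =
      wedge (KaehlerDifferential.D k K f) (KaehlerDifferential.D k K g) := by
  have h : (KaehlerDifferential.quotKerTotalEquiv k K).symm (f • KaehlerDifferential.D k K g) =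
      Submodule.Quotient.mk (Finsupp.single g f) := by
    rw [LinearEquiv.symm_apply_eq]
    simp [KaehlerDifferential.quotKerTotalEquiv]
  rw [← preD_single]
  change (QuotientAddGroup.lift (KaehlerDifferential.kerTotal k K).toAddSubgroup preD
    (fun x hx => preD_eq_zero x hx)) ((KaehlerDifferential.quotKerTotalEquiv k K).symm
      (f • KaehlerDifferential.D k K g)) = _
  rw [h]
  rfl

end Forms

/-! ### Transverse structures

Here `K` is the field of rational functions of a surface and `L` is a `K`-linear subspace of its
rational vector fields: the rational vector fields tangent to a foliation. -/

section Transverse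

variable {k K : Type*} [Field k] [Field K] [Algebra k K]

/-- The rational `1`-form `ω` defines the foliation whose rational tangent fields are `L`. -/
def Defines (L : Submodule K (Derivation k K K)) (ω : OneForm k K) : Prop :=
  ω ≠ 0 ∧ ∀ v ∈ L, v.liftKaehlerDifferential ω = 0

def TransverselyAffine (L : Submodule K (Derivation k K K)) : Prop :=
  ∀ ω₀ : OneForm k K, Defines L ω₀ → ∃ ω₁ : OneForm k K,
    d ω₀ = wedge ω₀ ω₁ ∧ d ω₁ = 0

def TransverselyProjective (L : Submodule K (Derivation k K K)) : Prop :=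
  ∀ ω₀ : OneForm k K, Defines L ω₀ → ∃ ω₁ ω₂ : OneForm k K,
    d ω₀ = wedge ω₀ ω₁ ∧ d ω₁ = 2 * wedge ω₀ ω₂ ∧ d ω₂ = wedge ω₁ ω₂

end Transverse

/-! ### Complex schemes, vector fields -/

/-- `Spec ℂ`. -/
abbrev SpecC : Scheme.{0} := Spec (.of ℂ)

/-- The constants inside the ring of functions on an open set of a complex scheme. -/
def constants (X : Scheme.{0}) [X.Over SpecC] (U : X.Opens) : ℂ →+* Γ(X, U) :=
  ((Scheme.ΓSpecIso (.of ℂ)).inv ≫ (X ↘ SpecC).appLE ⊤ U le_top).hom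

instance sectionsAlgebra (X : Scheme.{0}) [X.Over SpecC] (U : X.Opens) : Algebra ℂ Γ(X, U) :=
  (constants X U).toAlgebra

instance functionFieldAlgebra (X : Scheme.{0}) [X.Over SpecC] [IsIntegral X] :
    Algebra ℂ X.functionField :=
  ((X.presheaf.germ ⊤ (genericPoint X) trivial).hom.comp (constants X ⊤)).toAlgebra

/-- The sections of the tangent sheaf over an affine open set. -/
abbrev VectorField (X : Scheme.{0}) [X.Over SpecC] (U : X.affineOpens) :=
  Derivation ℂ Γ(X, U.1) Γ(X, U.1)

/-- The vector field `D'` on `U` is the restriction of the vector field `D` on `V ⊇ U`. -/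
def IsRestriction {X : Scheme.{0}} [X.Over SpecC] {U V : X.affineOpens} (h : U.1 ≤ V.1)
    (D : VectorField X V) (D' : VectorField X U) : Prop :=
  ∀ a : Γ(X, V.1), D' (X.presheaf.map (homOfLE h).op a) = X.presheaf.map (homOfLE h).op (D a)

/-! ### Foliations of dimension one -/

/-- A (singular) foliation of dimension one on an integral complex scheme `X`: a quasi-coherent
subsheaf of rank one of the tangent sheaf with torsion-free quotient, given by its sections over
affine open sets. (Involutivity is automatic in rank one. By `saturated`, the field `D` on `V` is
a section as soon as its restriction to some non-empty `U` is; this says at once that the quotient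
is torsion-free, that sections glue, and that the subsheaf is quasi-coherent.) -/
structure Foliation (X : Scheme.{0}) [X.Over SpecC] where
  fields (U : X.affineOpens) : Submodule Γ(X, U.1) (VectorField X U)
  restrict {U V : X.affineOpens} (h : U.1 ≤ V.1) (D : VectorField X V) (D' : VectorField X U) :
    IsRestriction h D D' → D ∈ fields V → D' ∈ fields U
  saturated {U V : X.affineOpens} (h : U.1 ≤ V.1) (D : VectorField X V) (D' : VectorField X U) :
    (U.1 : Set X).Nonempty → IsRestriction h D D' → D' ∈ fields U → D ∈ fields V
  rank_eq_one (U : X.affineOpens) : (U.1 : Set X).Nonempty →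
    Module.rank Γ(X, U.1) (fields U) = 1

namespace Foliation

variable {X : Scheme.{0}} [X.Over SpecC]

/-- `F` is everywhere tangent to the fibres of `π`: its local vector fields kill the functions
that are pulled back by `π`. -/
def TangentTo (F : Foliation X) {T : Scheme.{0}} (π : X ⟶ T) : Prop :=
  ∀ (U : X.affineOpens) (V : T.Opens) (h : U.1 ≤ π ⁻¹ᵁ V), ∀ D ∈ F.fields U,
    ∀ b : Γ(T, V), D (π.appLE V U.1 h b) = 0

/-- The singular set of `F`: the points `x` at which all local vector fields tangent to `F`
vanish, that is, send every function to a function vanishing at `x`. -/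
def singularSet (F : Foliation X) : Set X :=
  {x | ∀ U : X.affineOpens, x ∈ U.1 → ∀ D ∈ F.fields U, ∀ a : Γ(X, U.1),
    x ∉ X.basicOpen (D a)}

/-- For `i : Y ⟶ X`, the rational vector field `v` on `Y` is induced along `i` by the vector field
`D` on the affine open set `U` of `X`, which meets `Y`: `v (i^* a) = i^* (D a)`. -/
def Induces {Y : Scheme.{0}} [Y.Over SpecC] [IsIntegral Y] (i : Y ⟶ X) (U : X.affineOpens)
    [Nonempty (i ⁻¹ᵁ U.1)] (D : VectorField X U)
    (v : Derivation ℂ Y.functionField Y.functionField) : Prop :=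
  ∀ a : Γ(X, U.1), v (Y.germToFunctionField (i ⁻¹ᵁ U.1) (i.app U.1 a)) =
    Y.germToFunctionField (i ⁻¹ᵁ U.1) (i.app U.1 (D a))

/-- The rational vector fields on `Y` tangent to the restriction of `F` to `Y`. -/
def tangentAlong (F : Foliation X) {Y : Scheme.{0}} [Y.Over SpecC] [IsIntegral Y] (i : Y ⟶ X) :
    Submodule Y.functionField (Derivation ℂ Y.functionField Y.functionField) :=
  Submodule.span _ {v | ∃ (U : X.affineOpens) (_ : Nonempty (i ⁻¹ᵁ U.1)) (D : VectorField X U),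
    D ∈ F.fields U ∧ Induces i U D v}

end Foliation

/-! ### Families -/

section Projective

attribute [local instance] MvPolynomial.gradedAlgebra

/-- The complex projective space of dimension `n`. -/
abbrev ProjSpace (n : ℕ) : Scheme.{0} :=
  Proj (MvPolynomial.homogeneousSubmodule (Fin (n + 1)) ℂ)

/-- The structure morphism of projective space. -/
def projSpaceToSpecC (n : ℕ) : ProjSpace n ⟶ SpecC :=
  Proj.toSpecZero (MvPolynomial.homogeneousSubmodule (Fin (n + 1)) ℂ) ≫
    Spec.map (CommRingCat.ofHom
      (algebraMap ℂ (MvPolynomial.homogeneousSubmodule (Fin (n + 1)) ℂ 0)))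

end Projective

/-- A complex scheme is projective if it is a closed subscheme of some `ℙⁿ`. -/
def IsProjective (Y : Scheme.{0}) [Y.Over SpecC] : Prop :=
  ∃ (n : ℕ) (i : Y ⟶ ProjSpace n), IsClosedImmersion i ∧ i ≫ projSpaceToSpecC n = Y ↘ SpecC

/-- `π : X ⟶ T` is an algebraic family of smooth projective surfaces: `X` and `T` are smooth
irreducible complex algebraic varieties and `π` is a proper submersion whose fibres are
(irreducible) projective surfaces. -/
class IsSurfaceFamily {X T : Scheme.{0}} [X.Over SpecC] [T.Over SpecC] (π : X ⟶ T) : Prop where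
  isOver : π.IsOver SpecC
  integral_base : IsIntegral T
  smooth_base : Smooth (T ↘ SpecC)
  separated_base : IsSeparated (T ↘ SpecC)
  quasiCompact_base : QuasiCompact (T ↘ SpecC)
  integral_total : IsIntegral X
  proper : IsProper π
  submersion : SmoothOfRelativeDimension 2 π
  integral_fiber (t : closedPoints T) : IsIntegral (π.fiber t.1)
  projective_fiber (t : closedPoints T) : IsProjective (π.fiber t.1)

instance isIntegral_fiber {X T : Scheme.{0}} [X.Over SpecC] [T.Over SpecC] (π : X ⟶ T)
    [IsSurfaceFamily π] (t : closedPoints T) : IsIntegral (π.fiber t.1) :=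
  IsSurfaceFamily.integral_fiber t

/-- The restriction of `F` to the fibre over `t` is a foliation, that is, the fibre is not
contained in the singular set of `F`. -/
def Foliation.HasMember {X T : Scheme.{0}} [X.Over SpecC] (F : Foliation X) (π : X ⟶ T)
    (t : closedPoints T) : Prop :=
  ¬ π ⁻¹' {t.1} ⊆ F.singularSet

/-- The member of the family over `t`: the foliation on the surface `π.fiber t` that `F` induces
there, given by the rational vector fields tangent to it. -/
def Foliation.member {X T : Scheme.{0}} [X.Over SpecC] [T.Over SpecC] (F : Foliation X)
    (π : X ⟶ T) [IsSurfaceFamily π] (t : closedPoints T) :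
    Submodule (π.fiber t.1).functionField
      (Derivation ℂ (π.fiber t.1).functionField (π.fiber t.1).functionField) :=
  F.tangentAlong (π.fiberι t.1)

/-- `P` holds at every closed point outside a countable union of proper Zariski closed subsets. -/
def ForVeryGeneral (T : Scheme.{0}) (P : closedPoints T → Prop) : Prop :=
  ∃ Z : ℕ → Set T, (∀ n, IsClosed (Z n) ∧ Z n ≠ Set.univ) ∧
    ∀ t : closedPoints T, (∀ n, t.1 ∉ Z n) → P t

end FoliatedFamily

end

open CategoryTheory AlgebraicGeometry TopologicalSpace

noncomputable section

namespace FoliatedFamily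

/-! At a point of the fibre over `t` where the foliation is regular, take relative coordinates `x,
y` and a tangent field `D` with `D x` a unit, and rescale so that `D x = 1`. Then `D = ∂x + q ∂y`
with `q = D y`, and each member is defined by `dy - q dx` up to a factor. Eliminating unknowns, a
transversely affine or projective structure on a member amounts to a solution of `δ g + a g = c b`
with `c` a constant and `(g, c)` nontrivial (`transverselyAffine_iff`,
`transverselyProjective_iff`). Here `a` and `b` are restrictions of functions on the total space.
The problem is linear in `(g, c)`, and both halves of the proof depend on this.

Specialization (`HasSolutionMod.specialize`): a solution over the whole chart is restricted to a
given fibre by cutting with one parameter `t` of the base at a time. Since `D t = 0`, powers of `t`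
can be divided out of numerator, denominator and constant; by homogeneity a nontrivial solution
survives modulo `t`. The parameters are étale coordinates of the smooth base, and their flat
pullbacks generate the maximal ideal of the local ring at the generic point of the fibre.

Spreading out (`exists_countable_forall_hasSolutionMod`): the chart, `D`, `a` and `b` are defined
over a countable subring `B₀` of the base ring. A closed point at which no nonzero element of `B₀`
vanishes has as its fibre the extension of constants of a model over `k = Frac B₀`. The fibre's
solution involves finitely many constants. These are specialized to a finite extension of `k` and
then pushed down by a `k`-linear functional, which is allowed by linearity. A solution over `k`
gives one over the whole chart once denominators are cleared.

The uncountability of `ℂ` gives a closed point `s` avoiding both the exceptional sets of the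
hypothesis and the countably many functions of `B₀` (`exists_algHom_forall_ne_zero`). The structure
on the member over `s` spreads to the chart and then specializes to `t`. -/

open KaehlerDifferential in
/-- A derivation with values in a localization extends to the localization. -/
theorem exists_derivation_extending {k A S : Type*} [CommRing k] [CommRing A] [CommRing S]
    [Algebra k A] [Algebra A S] [Algebra k S] [IsScalarTower k A S] (M : Submonoid A)
    [IsLocalization M S] (E : Derivation k A S) :
    ∃ E' : Derivation k S S, ∀ a, E' (algebraMap A S a) = E a := by
  have hu : ∀ x : M, IsUnit (algebraMap A (Module.End A S) x) := fun x =>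
    (IsLocalizedModule.map_units (S := M) (Algebra.linearMap A S) x)
  -- Differentials commute with localization, so the linear map attached to `E` extends uniquely
  -- from `Ω[A⁄k]` to `Ω[S⁄k]`.
  let g : Ω[S⁄k] →ₗ[A] S := IsLocalizedModule.lift M (map k k A S) E.liftKaehlerDifferential hu
  let g' : Ω[S⁄k] →ₗ[S] S := LinearMap.extendScalarsOfIsLocalization M S g
  refine ⟨g'.compDer (D k S), fun a => ?_⟩
  change g (D k S (algebraMap A S a)) = E a
  have h1 : map k k A S (D k A a) = D k S (algebraMap A S a) := by simp
  rw [← h1]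
  change IsLocalizedModule.lift M (map k k A S) E.liftKaehlerDifferential hu _ = _
  rw [IsLocalizedModule.lift_apply]
  simp

theorem derivation_eq_of_smul {k A : Type*} [CommRing k] [CommRing A] [Algebra k A]
    {D : Derivation k A A} {a s : A} (hs : IsUnit s) (h1 : D s = 0) (h2 : D (s * a) = 0) :
    D a = 0 := by
  rw [Derivation.leibniz, h1, smul_zero, add_zero, smul_eq_mul] at h2
  exact (hs.mul_right_eq_zero).1 h2

/-! ### Linear first order differential equations -/

/-- The equation `δ g + a g = b` or the associated homogeneous equation has a non-trivial
solution. -/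
def SolvableODE {k K : Type*} [Field k] [Field K] [Algebra k K] (δ : Derivation k K K)
    (a b : K) : Prop :=
  (∃ g, δ g + a * g = b) ∨ ∃ g, g ≠ 0 ∧ δ g + a * g = 0

/-- The equation `D g + a g = c b` has a non-trivial solution `(g, c)` modulo `I`, where `g = u / r`
is a fraction and `c` is a constant. -/
def HasSolutionMod {k R : Type*} [CommRing k] [CommRing R] [Algebra k R] (D : Derivation k R R)
    (a b : R) (I : Ideal R) : Prop :=
  ∃ u r c : R, D c ∈ I ∧ r ∉ I ∧ (u ∉ I ∨ c ∉ I) ∧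
    r * D u - u * D r + a * u * r - c * b * r ^ 2 ∈ I

/-- If `c` dies in `K`, then `u / r` solves the homogeneous equation. Otherwise `c` is killed by
`δ`, so dividing by it gives a solution of the full equation. -/
theorem HasSolutionMod.solvableODE {k l R K : Type*} [CommRing k] [CommRing R] [Algebra k R]
    [Field l] [Field K] [Algebra l K] {D : Derivation k R R} {a b : R} {δ : Derivation l K K}
    (ψ : R →+* K) (hδ : ∀ x, δ (ψ x) = ψ (D x))
    (h : HasSolutionMod D a b (RingHom.ker ψ)) : SolvableODE δ (ψ a) (ψ b) := by
  obtain ⟨u, r, c, hc, hr, huc, hE⟩ := h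
  simp only [RingHom.mem_ker] at hc hr huc hE
  simp only [map_sub, map_add, map_mul, map_pow] at hE
  have hd : δ (ψ u / ψ r) = (ψ r * ψ (D u) - ψ u * ψ (D r)) / ψ r ^ 2 := by
    rw [Derivation.leibniz_div, hδ, hδ]
    simp only [smul_eq_mul]
    field_simp
  have key : δ (ψ u / ψ r) + ψ a * (ψ u / ψ r) = ψ c * ψ b := by
    rw [hd]
    field_simp
    linear_combination hE
  by_cases h0 : ψ c = 0
  · refine Or.inr ⟨ψ u / ψ r, ?_, by rw [key, h0, zero_mul]⟩
    exact div_ne_zero (huc.resolve_right (by simpa using h0)) hr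
  · refine Or.inl ⟨ψ u / ψ r / ψ c, ?_⟩
    rw [Derivation.leibniz_div, hδ c, hc]
    simp only [smul_eq_mul, mul_zero, sub_zero]
    field_simp
    field_simp at key
    linear_combination key

/-! ### Specialization of a solution modulo one parameter -/

section Specialization

variable {R : Type*} [CommRing R]

theorem pow_mul_mem_of_regular {I : Ideal R} {t : R} (hreg : ∀ x, t * x ∈ I → x ∈ I) (n : ℕ) {x : R}
    (hx : t ^ n * x ∈ I) : x ∈ I := by
  induction n with
  | zero => simpa using hx
  | succ n ih => exact ih (hreg _ (by rwa [pow_succ', mul_assoc] at hx))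

variable [IsNoetherianRing R] [IsLocalRing R]

/-- Krull's intersection theorem in `R ⧸ I`: a nonzero class is divisible by only finitely many
powers of `t`, so it has a `t`-adic order `n`. -/
theorem exists_eq_pow_mul_add {I : Ideal R} {t : R} (hI : I ≠ ⊤)
    (ht : t ∈ IsLocalRing.maximalIdeal R) {x : R} (hx : x ∉ I) :
    ∃ (n : ℕ) (y z : R), x = t ^ n * y + z ∧ z ∈ I ∧ y ∉ I ⊔ Ideal.span {t} := by
  classical
  have hex : ∃ n : ℕ, x ∉ I ⊔ Ideal.span {t ^ n} := by
    by_contra! hcon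
    have : Nontrivial (R ⧸ I) := Ideal.Quotient.nontrivial_iff.2 hI
    have : IsLocalRing (R ⧸ I) := .of_surjective' _ Ideal.Quotient.mk_surjective
    have hne : Ideal.span {Ideal.Quotient.mk I t} ≠ ⊤ := by
      rw [Ne, Ideal.span_singleton_eq_top]
      intro hu
      obtain ⟨y, hy⟩ := hu.exists_right_inv
      obtain ⟨y, rfl⟩ := Ideal.Quotient.mk_surjective y
      rw [← map_mul, ← map_one (Ideal.Quotient.mk I), Ideal.Quotient.eq] at hy
      have h1 := (IsLocalRing.maximalIdeal R).sub_mem (Ideal.mul_mem_right y _ ht)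
        (IsLocalRing.le_maximalIdeal hI hy)
      rw [sub_sub_cancel] at h1
      exact (Ideal.ne_top_iff_one _).1 (IsLocalRing.maximalIdeal.isMaximal R).ne_top h1
    have hk := Ideal.iInf_pow_eq_bot_of_isLocalRing _ hne
    apply hx
    rw [← Ideal.Quotient.eq_zero_iff_mem, ← Ideal.mem_bot, ← hk, Ideal.mem_iInf]
    intro n
    obtain ⟨y, hy, z, hz, hyz⟩ := Submodule.mem_sup.1 (hcon n)
    obtain ⟨w, rfl⟩ := Ideal.mem_span_singleton'.1 hz
    rw [← hyz, map_add, Ideal.Quotient.eq_zero_iff_mem.2 hy, zero_add, map_mul, map_pow,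
      Ideal.span_singleton_pow]
    exact Ideal.mul_mem_left _ _ (Ideal.mem_span_singleton_self _)
  -- At exponent `0` the ideal is everything, so the first exponent that fails is a successor `n +
  -- 1`, and `n` is the order of `x`.
  obtain ⟨n, hn⟩ : ∃ n, Nat.find hex = n + 1 := by
    refine Nat.exists_eq_succ_of_ne_zero fun h0 => ?_
    have := Nat.find_spec hex
    rw [h0] at this
    simp at this
  have hmem : x ∈ I ⊔ Ideal.span {t ^ n} := by
    have := Nat.find_min hex (m := n) (by omega)
    simpa using this
  obtain ⟨z, hz, w, hw, rfl⟩ := Submodule.mem_sup.1 hmem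
  obtain ⟨y, rfl⟩ := Ideal.mem_span_singleton'.1 hw
  refine ⟨n, y, z, by ring, hz, fun hy => ?_⟩
  have hspec := Nat.find_spec hex
  rw [hn] at hspec
  apply hspec
  obtain ⟨z', hz', w', hw', rfl⟩ := Submodule.mem_sup.1 hy
  obtain ⟨y', rfl⟩ := Ideal.mem_span_singleton'.1 hw'
  have : z + (z' + y' * t) * t ^ n = (z + z' * t ^ n) + y' * t ^ (n + 1) := by ring
  rw [this]
  exact Ideal.add_mem _ (Ideal.mem_sup_left (I.add_mem hz (I.mul_mem_right _ hz')))
    (Ideal.mem_sup_right (Ideal.mul_mem_left _ _ (Ideal.mem_span_singleton_self _)))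

/-- Strip the powers of `t` from two factors outside `I`. Regularity puts the product of what
remains in `I`, contradicting primality of `I ⊔ (t)`. -/
theorem isPrime_of_isPrime_sup {I : Ideal R} {t : R} (ht : t ∈ IsLocalRing.maximalIdeal R)
    (hreg : ∀ x, t * x ∈ I → x ∈ I) (hJ : (I ⊔ Ideal.span {t}).IsPrime) : I.IsPrime := by
  have hI : I ≠ ⊤ := fun h => hJ.ne_top (by rw [h, top_sup_eq])
  refine ⟨hI, fun {a b} hab => ?_⟩
  by_contra! hcon
  obtain ⟨i, a', e, rfl, he, ha'⟩ := exists_eq_pow_mul_add hI ht hcon.1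
  obtain ⟨j, b', f, rfl, hf, hb'⟩ := exists_eq_pow_mul_add hI ht hcon.2
  have h1 : t ^ (i + j) * (a' * b') ∈ I := by
    have : t ^ (i + j) * (a' * b') = (t ^ i * a' + e) * (t ^ j * b' + f)
        - e * (t ^ j * b' + f) - (t ^ i * a') * f := by ring
    rw [this]
    exact I.sub_mem (I.sub_mem hab (I.mul_mem_right _ he)) (I.mul_mem_left _ hf)
  exact (hJ.mem_or_mem (Ideal.mem_sup_left (pow_mul_mem_of_regular hreg _ h1))).elim ha' hb'

/-- Let `u, r, c` have `t`-adic orders `j, i, l` modulo `I`. As `D t ∈ I`, the terms containing `u`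
have order at least `i + j` and the term containing `c` at least `l + 2 i`. Dividing by the smaller
power of `t` leaves a solution whose surviving part is nontrivial modulo `t`. -/
theorem HasSolutionMod.sup_span_singleton {k : Type*} [CommRing k] [Algebra k R]
    {D : Derivation k R R} {a b : R} {I : Ideal R} {t : R} (hI : I.IsPrime)
    (ht : t ∈ IsLocalRing.maximalIdeal R) (htI : t ∉ I) (hDI : ∀ x ∈ I, D x ∈ I) (hDt : D t ∈ I)
    (h : HasSolutionMod D a b I) : HasSolutionMod D a b (I ⊔ Ideal.span {t}) := by
  obtain ⟨u, r, c, hc, hr, huc, hE⟩ := h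
  set φ := Ideal.Quotient.mk I with hφ
  have h0 : ∀ x, x ∈ I ↔ φ x = 0 := fun x => Ideal.Quotient.eq_zero_iff_mem.symm
  have hJ : ∀ x, φ t ∣ φ x → x ∈ I ⊔ Ideal.span {t} := by
    rintro x ⟨y, hy⟩
    obtain ⟨y, rfl⟩ := Ideal.Quotient.mk_surjective y
    rw [← map_mul, Ideal.Quotient.eq] at hy
    have := Ideal.add_mem _ (Ideal.mem_sup_left (T := Ideal.span {t}) hy)
      (Ideal.mem_sup_right (S := I) (Ideal.mul_mem_right y _ (Ideal.mem_span_singleton_self t)))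
    simpa using this
  have hDpow : ∀ n : ℕ, φ (D (t ^ n)) = 0 := by
    intro n
    rw [Derivation.leibniz_pow]
    simp [(h0 _).1 hDt]
  have hDφ : ∀ (n : ℕ) (y z : R), z ∈ I → φ (D (t ^ n * y + z)) = φ t ^ n * φ (D y) := by
    intro n y z hz
    rw [map_add, map_add, Derivation.leibniz, (h0 _).1 (hDI z hz)]
    simp only [smul_eq_mul, map_add, map_mul, hDpow, map_pow]
    ring
  have hT : φ t ≠ 0 := fun hh => htI ((h0 _).2 hh)
  obtain ⟨i, r', e, hre, he, hr'⟩ := exists_eq_pow_mul_add hI.ne_top ht hr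
  have hφr : φ r = φ t ^ i * φ r' := by rw [hre]; simp [(h0 _).1 he]
  have hφDr : φ (D r) = φ t ^ i * φ (D r') := by rw [hre, hDφ _ _ _ he]
  have hE' : φ r * φ (D u) - φ u * φ (D r) + φ a * φ u * φ r = φ c * φ b * φ r ^ 2 := by
    have := (h0 _).1 hE
    simp only [map_sub, map_add, map_mul, map_pow] at this
    exact sub_eq_zero.1 this
  rw [hφr, hφDr] at hE'
  -- The cases `c ∈ I` and, further on, `u ∈ I` are those of infinite order: only the other unknown
  -- remains.
  by_cases hcI : c ∈ I
  · have huI := huc.resolve_right (not_not.2 hcI)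
    obtain ⟨j, u', f, hue, hf, hu'⟩ := exists_eq_pow_mul_add hI.ne_top ht huI
    have hφu : φ u = φ t ^ j * φ u' := by rw [hue]; simp [(h0 _).1 hf]
    have hφDu : φ (D u) = φ t ^ j * φ (D u') := by rw [hue, hDφ _ _ _ hf]
    rw [hφu, hφDu, (h0 _).1 hcI] at hE'
    refine ⟨u', r', 0, by simp, hr', Or.inl hu', Ideal.mem_sup_left ((h0 _).2 ?_)⟩
    apply mul_left_cancel₀ (pow_ne_zero (i + j) hT)
    simp only [map_sub, map_add, map_mul, map_pow, map_zero]
    linear_combination hE'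
  obtain ⟨l, c', γ, hce, hγ, hc'⟩ := exists_eq_pow_mul_add hI.ne_top ht hcI
  have hφc : φ c = φ t ^ l * φ c' := by rw [hce]; simp [(h0 _).1 hγ]
  have hDc' : D c' ∈ I := by
    rw [h0]
    apply mul_left_cancel₀ (pow_ne_zero l hT)
    rw [mul_zero, ← hDφ l c' γ hγ, ← hce, (h0 _).1 hc]
  rw [hφc] at hE'
  by_cases huI : u ∈ I
  · rw [(h0 _).1 huI, (h0 _).1 (hDI u huI)] at hE'
    refine ⟨0, r', c', Ideal.mem_sup_left hDc', hr', Or.inr hc', Ideal.mem_sup_left ((h0 _).2 ?_)⟩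
    apply mul_left_cancel₀ (pow_ne_zero (l + 2 * i) hT)
    simp only [map_sub, map_add, map_mul, map_pow, map_zero]
    linear_combination hE'
  obtain ⟨j, u', f, hue, hf, hu'⟩ := exists_eq_pow_mul_add hI.ne_top ht huI
  have hφu : φ u = φ t ^ j * φ u' := by rw [hue]; simp [(h0 _).1 hf]
  have hφDu : φ (D u) = φ t ^ j * φ (D u') := by rw [hue, hDφ _ _ _ hf]
  rw [hφu, hφDu] at hE'
  -- For `j < l + i` the constant dies modulo `t`; for `j > l + i` the numerator dies; in case of
  -- equality both survive.
  rcases lt_trichotomy j (l + i) with hlt | heq | hgt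
  · obtain ⟨d, hd⟩ := Nat.exists_eq_add_of_lt hlt
    refine ⟨u', r', 0, by simp, hr', Or.inl hu', hJ _ ⟨φ t ^ d * φ c' * φ b * φ r' ^ 2, ?_⟩⟩
    apply mul_left_cancel₀ (pow_ne_zero (i + j) hT)
    simp only [map_sub, map_add, map_mul, map_pow, map_zero]
    have h2 : φ t ^ l * φ t ^ i = φ t ^ j * φ t ^ d * φ t := by
      rw [← pow_add, hd]; ring
    linear_combination hE' + φ c' * φ b * φ r' ^ 2 * φ t ^ i * h2
  · refine ⟨u', r', c', Ideal.mem_sup_left hDc', hr', Or.inl hu', Ideal.mem_sup_left ((h0 _).2 ?_)⟩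
    apply mul_left_cancel₀ (pow_ne_zero (i + j) hT)
    simp only [map_sub, map_add, map_mul, map_pow]
    subst heq
    linear_combination hE'
  · obtain ⟨d, hd⟩ := Nat.exists_eq_add_of_lt hgt
    refine ⟨0, r', c', Ideal.mem_sup_left hDc', hr', Or.inr hc', hJ _ ⟨- φ t ^ d *
      (φ r' * φ (D u') - φ u' * φ (D r') + φ a * φ u' * φ r'), ?_⟩⟩
    apply mul_left_cancel₀ (pow_ne_zero (l + 2 * i) hT)
    simp only [map_sub, map_add, map_mul, map_pow, map_zero]
    subst hd
    linear_combination hE'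

end Specialization

/-! ### Centered coordinates as a regular sequence -/

section RegularParameters

variable {k : Type*} [Field k] {n : ℕ}

/-- The coordinates of affine space centered at `a`. -/
def centeredCoordinates (a : Fin n → k) : List (MvPolynomial (Fin n) k) :=
  List.ofFn fun i => MvPolynomial.X i - MvPolynomial.C (a i)

/-- The substitution of `a j` for the variables `X j` with `j < i`. -/
def partialEval (a : Fin n → k) (i : ℕ) : MvPolynomial (Fin n) k →ₐ[k] MvPolynomial (Fin n) k :=
  MvPolynomial.aeval fun j => if j.1 < i then MvPolynomial.C (a j) else MvPolynomial.X j

theorem sub_mem_ofList_take (a : Fin n → k) {i : ℕ} {j : Fin n} (hj : j.1 < i) :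
    MvPolynomial.X j - MvPolynomial.C (a j) ∈
      Ideal.ofList ((centeredCoordinates a).take i) := by
  refine Ideal.subset_span ?_
  change _ ∈ (centeredCoordinates a).take i
  rw [List.mem_take_iff_getElem]
  refine ⟨j.1, by simp [centeredCoordinates, hj], by simp [centeredCoordinates]⟩

/-- The substitution is the identity modulo the first `i` centered coordinates, so its kernel lies
in the ideal they generate; conversely it kills each of them. -/
theorem ker_partialEval (a : Fin n → k) (i : ℕ) :
    RingHom.ker (partialEval a i) = Ideal.ofList ((centeredCoordinates a).take i) := by
  apply le_antisymm
  · intro f hf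
    have h1 : (Ideal.Quotient.mkₐ k (Ideal.ofList ((centeredCoordinates a).take i))).comp
        (partialEval a i) = Ideal.Quotient.mkₐ k _ := by
      ext j
      simp only [partialEval, AlgHom.comp_apply, MvPolynomial.aeval_X]
      split_ifs with h
      · refine ((Ideal.Quotient.eq).2 (sub_mem_ofList_take a h)).symm
      · rfl
    have h2 := DFunLike.congr_fun h1 f
    rw [AlgHom.comp_apply, (RingHom.mem_ker).1 hf, map_zero] at h2
    exact Ideal.Quotient.eq_zero_iff_mem.1 h2.symm
  · refine Ideal.span_le.2 fun f hf => ?_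
    change f ∈ (centeredCoordinates a).take i at hf
    rw [List.mem_take_iff_getElem] at hf
    obtain ⟨j, hj, rfl⟩ := hf
    simp only [centeredCoordinates, List.length_ofFn, lt_min_iff] at hj
    simp [centeredCoordinates, partialEval, hj.1, RingHom.mem_ker, MvPolynomial.algebraMap_eq]

theorem ker_aeval_eq_ofList (a : Fin n → k) :
    RingHom.ker (MvPolynomial.aeval a : MvPolynomial (Fin n) k →ₐ[k] k) =
      Ideal.ofList (centeredCoordinates a) := by
  have h : (partialEval a n) = (Algebra.ofId k _).comp (MvPolynomial.aeval a) := by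
    ext1 j
    simp [partialEval, MvPolynomial.algebraMap_eq, Algebra.ofId_apply]
  have h2 := ker_partialEval a n
  rw [List.take_of_length_le (by simp [centeredCoordinates]), h] at h2
  rw [← h2]
  ext f
  simp [RingHom.mem_ker, Algebra.ofId_apply, MvPolynomial.algebraMap_eq]

/-- The quotient by the first `i` coordinates embeds through `partialEval` in a polynomial ring,
which is a domain, and the next coordinate has nonzero image there. -/
theorem isWeaklyRegular_centeredCoordinates (a : Fin n → k) :
    RingTheory.Sequence.IsWeaklyRegular (MvPolynomial (Fin n) k) (centeredCoordinates a) := by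
  refine ⟨fun i hi => ?_⟩
  rw [isSMulRegular_quotient_iff_mem_of_smul_mem]
  intro f hf
  simp only [smul_eq_mul, Ideal.mul_top] at hf ⊢
  rw [← ker_partialEval, RingHom.mem_ker, map_mul] at hf
  rw [← ker_partialEval, RingHom.mem_ker]
  refine (mul_eq_zero.1 hf).resolve_left ?_
  have hin : i < n := by simpa [centeredCoordinates] using hi
  have : (MvPolynomial.X ⟨i, hin⟩ : MvPolynomial (Fin n) k) - MvPolynomial.C (a ⟨i, hin⟩) ≠ 0 := by
    intro h0
    -- At the point `a + 1` every centered coordinate takes the value `1`.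
    have h1 := congrArg (MvPolynomial.aeval fun j => a j + 1) h0
    simp at h1
  simpa [centeredCoordinates, partialEval, MvPolynomial.algebraMap_eq] using this

open Algebra in
/-- An étale algebra over affine space has the centered coordinates as local parameters. -/
theorem exists_mul_mem_map_of_etale {S : Type*} [CommRing S] [Algebra k S]
    [Algebra (MvPolynomial (Fin n) k) S] [IsScalarTower k (MvPolynomial (Fin n) k) S]
    [Algebra.Etale (MvPolynomial (Fin n) k) S] (χ : S →ₐ[k] k) {x : S} (hx : χ x = 0) :
    ∃ s, χ s ≠ 0 ∧ s * x ∈ (Ideal.ofList (centeredCoordinates fun i : Fin n =>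
      χ (algebraMap (MvPolynomial (Fin n) k) S (MvPolynomial.X i)))).map (algebraMap _ S) := by
  set a : Fin n → k := fun i => χ (algebraMap (MvPolynomial (Fin n) k) S (MvPolynomial.X i))
  set q : Ideal S := RingHom.ker χ with hq
  have hqp : q.IsPrime := RingHom.ker_isPrime _
  set p : Ideal (MvPolynomial (Fin n) k) := q.under (MvPolynomial (Fin n) k) with hp
  have hpa : p = Ideal.ofList (centeredCoordinates a) := by
    rw [← ker_aeval_eq_ofList]
    have : (χ.comp (IsScalarTower.toAlgHom k (MvPolynomial (Fin n) k) S)) =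
        MvPolynomial.aeval a := by
      ext i; simp [a]
    rw [← this]
    rfl
  have : q.LiesOver p := ⟨rfl⟩
  let _ := Localization.AtPrime.algebraOfLiesOver p q
  -- Unramifiedness: `p` generates the maximal ideal of the local ring at `q`. The multiplier `s` is
  -- what remains of the denominators.
  have h := ((Algebra.isUnramifiedAt_iff_map_eq (MvPolynomial (Fin n) k) p q).1 inferInstance).2
  rw [← hpa]
  have hx' : algebraMap S (Localization.AtPrime q) x ∈
      (p.map (algebraMap _ S)).map (algebraMap S (Localization.AtPrime q)) := by
    rw [Ideal.map_map, ← IsScalarTower.algebraMap_eq, h]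
    rw [IsLocalization.AtPrime.to_map_mem_maximal_iff (Localization.AtPrime q) q]
    exact hx
  rw [IsLocalization.mem_map_algebraMap_iff q.primeCompl] at hx'
  obtain ⟨⟨y, s⟩, hys⟩ := hx'
  rw [← map_mul, IsLocalization.eq_iff_exists q.primeCompl] at hys
  obtain ⟨c, hc⟩ := hys
  refine ⟨c * s, fun h0 => (c * s).2 h0, ?_⟩
  have : (c * s : S) * x = c * y := by rw [← hc]; ring
  rw [this]
  exact Ideal.mul_mem_left _ _ y.2

end RegularParameters

/-! ### Specialization to a fibre of a smooth family -/

/-- Iterate `HasSolutionMod.sup_span_singleton` along the ideals of initial segments of `ts`. They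
are stable under `D` because `D` kills their generators. -/
theorem HasSolutionMod.ofList {k R : Type*} [CommRing k] [CommRing R] [IsNoetherianRing R]
    [IsLocalRing R] [Algebra k R] {D : Derivation k R R} {a b : R} (ts : List R)
    (hts : Ideal.ofList ts = IsLocalRing.maximalIdeal R)
    (hreg : RingTheory.Sequence.IsWeaklyRegular R ts) (hD : ∀ t ∈ ts, D t = 0)
    (h : HasSolutionMod D a b ⊥) : HasSolutionMod D a b (IsLocalRing.maximalIdeal R) := by
  let I : ℕ → Ideal R := fun i => Ideal.ofList (ts.take i)
  have hsucc : ∀ i (hi : i < ts.length), I (i + 1) = I i ⊔ Ideal.span {ts[i]} := by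
    intro i hi
    simp only [I]
    rw [List.take_succ_eq_append_getElem hi, Ideal.ofList_append, Ideal.ofList_singleton]
  have hmem : ∀ i (hi : i < ts.length), ts[i] ∈ IsLocalRing.maximalIdeal R := by
    intro i hi
    rw [← hts]
    exact Ideal.subset_span (List.getElem_mem hi)
  have hreg' : ∀ i (hi : i < ts.length) x, ts[i] * x ∈ I i → x ∈ I i := by
    intro i hi x hx
    have := (isSMulRegular_quotient_iff_mem_of_smul_mem _ _).1 (hreg.1 i hi) x
    simp only [smul_eq_mul, Ideal.mul_top] at this
    exact this hx
  -- Primality goes downwards: the full list generates the maximal ideal, and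
  -- `isPrime_of_isPrime_sup` removes one generator at a time.
  have hprime : ∀ d i, i + d = ts.length → (I i).IsPrime := by
    intro d
    induction d with
    | zero =>
      intro i hi
      have : I i = IsLocalRing.maximalIdeal R := by
        simp only [I]
        rw [List.take_of_length_le (by omega), hts]
      rw [this]
      exact (IsLocalRing.maximalIdeal.isMaximal R).isPrime
    | succ d ih =>
      intro i hi
      have hi' : i < ts.length := by omega
      exact isPrime_of_isPrime_sup (hmem i hi') (hreg' i hi')
        (hsucc i hi' ▸ ih (i + 1) (by omega))
  have hDI : ∀ i, ∀ x ∈ I i, D x ∈ I i := by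
    intro i x hx
    refine Submodule.span_induction ?_ ?_ ?_ ?_ hx
    · intro t ht
      rw [hD t (List.mem_of_mem_take ht)]
      exact zero_mem _
    · rw [map_zero]; exact zero_mem _
    · intro y z _ _ hy hz
      rw [map_add]; exact add_mem hy hz
    · intro c y hy hy'
      rw [smul_eq_mul, Derivation.leibniz]
      exact add_mem (Ideal.mul_mem_left _ _ hy') (Ideal.mul_mem_right _ _ hy)
  have hI : ∀ i, i ≤ ts.length → HasSolutionMod D a b (I i) := by
    intro i
    induction i with
    | zero => intro _; simpa [I] using h
    | succ i ih =>
      intro hi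
      have hi' : i < ts.length := by omega
      have hp : (I i).IsPrime := hprime (ts.length - i) i (by omega)
      rw [hsucc i hi']
      refine (ih hi'.le).sup_span_singleton hp (hmem i hi') (fun hmemI => ?_) (hDI i)
        (by rw [hD _ (List.getElem_mem hi')]; exact zero_mem _)
      -- If the next parameter were already in the prime ideal `I i`, regularity would put `1`
      -- there.
      exact hp.ne_top ((Ideal.eq_top_iff_one _).2 (hreg' i hi' 1 (by simpa using hmemI)))
  have := hI ts.length le_rfl
  simpa [I, hts] using this

/-- Specialization of solutions to a fibre of a smooth family. -/
theorem HasSolutionMod.specialize {k B A K : Type*} [Field k] [CommRing B] [Algebra k B]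
    [Algebra.Smooth k B] [CommRing A] [Algebra B A] [Module.Flat B A] [IsNoetherianRing A]
    [IsDomain A] [Field K] [Algebra k K] (χ : B →ₐ[k] k) (ψ : A →+* K)
    (hψ : RingHom.ker ψ = (RingHom.ker χ).map (algebraMap B A))
    {D : Derivation B A A} {δ : Derivation k K K} (hδ : ∀ x, δ (ψ x) = ψ (D x)) {a b : A}
    (h : HasSolutionMod D a b ⊥) : SolvableODE δ (ψ a) (ψ b) := by
  have hm : (RingHom.ker χ).IsPrime := RingHom.ker_isPrime _
  -- Near the point `χ`, on the locus where `f` is invertible, the smooth base is étale over affine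
  -- space; its coordinates provide the parameters.
  obtain ⟨f, hf, n, _, _, _⟩ :=
    Algebra.IsSmoothAt.exists_isStandardEtale_mvPolynomial (R := k) (p := RingHom.ker χ)
  have hp : (RingHom.ker ψ).IsPrime := RingHom.ker_isPrime _
  -- The local ring of the total space at the generic point of the fibre.
  let R := Localization.AtPrime (RingHom.ker ψ)
  let B' := Localization.Away f
  -- Such a `b` differs from the nonzero constant `χ b` by an element of `ker χ`, which maps into
  -- the maximal ideal of `R`.
  have hcomap : ∀ b : B, χ b ≠ 0 → IsUnit (algebraMap B R b) := by
    intro b hb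
    rw [IsScalarTower.algebraMap_apply B A R]
    refine IsLocalization.map_units R (⟨algebraMap B A b, fun hmem => ?_⟩ :
      (RingHom.ker ψ).primeCompl)
    have hχψ : ∀ c, χ c = 0 → ψ (algebraMap B A c) = 0 := fun c hc => by
      have : algebraMap B A c ∈ RingHom.ker ψ := by
        rw [hψ]; exact Ideal.mem_map_of_mem _ hc
      exact this
    have h1 : χ (b - algebraMap k B (χ b)) = 0 := by simp
    have h2 := hχψ _ h1
    have h3 : ψ (algebraMap B A b) = 0 := hmem
    rw [map_sub, map_sub, h3, zero_sub, neg_eq_zero] at h2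
    have hu : IsUnit (ψ (algebraMap B A (algebraMap k B (χ b)))) :=
      ((((isUnit_iff_ne_zero.2 hb).map (algebraMap k B)).map (algebraMap B A)).map ψ)
    exact hu.ne_zero h2
  have hfu : IsUnit (algebraMap B R f) := hcomap f hf
  let _ : Algebra B' R := (IsLocalization.Away.lift f hfu).toAlgebra
  have : IsScalarTower B B' R := .of_algebraMap_eq fun b =>
    (IsLocalization.Away.lift_eq f hfu b).symm
  let _ : Algebra (MvPolynomial (Fin n) k) R :=
    ((algebraMap B' R).comp (algebraMap (MvPolynomial (Fin n) k) B')).toAlgebra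
  have : IsScalarTower (MvPolynomial (Fin n) k) B' R := .of_algebraMap_eq fun _ => rfl
  let χ' : B' →ₐ[k] k :=
    { IsLocalization.Away.lift (g := (χ : B →+* k)) f (isUnit_iff_ne_zero.2 hf) with
      commutes' := fun c => by
        have : algebraMap k B' c = algebraMap B B' (algebraMap k B c) :=
          IsScalarTower.algebraMap_apply _ _ _ _
        rw [this]
        simp [IsLocalization.Away.lift_eq] }
  have hχ' : ∀ b, χ' (algebraMap B B' b) = χ b := fun b =>
    IsLocalization.Away.lift_eq (g := (χ : B →+* k)) f (isUnit_iff_ne_zero.2 hf) b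
  have : Module.Flat A R := IsLocalization.flat R (RingHom.ker ψ).primeCompl
  have : Module.Flat B R := .trans B A R
  have : Module.Flat B' R := (Module.flat_iff_of_isLocalization B' (.powers f) R).2 this
  have : Algebra.Etale (MvPolynomial (Fin n) k) B' := inferInstance
  have : Module.Flat (MvPolynomial (Fin n) k) B' := inferInstance
  have : Module.Flat (MvPolynomial (Fin n) k) R := .trans _ B' R
  set a₀ : Fin n → k := fun i => χ' (algebraMap (MvPolynomial (Fin n) k) B' (MvPolynomial.X i))
  let ts : List R := (centeredCoordinates a₀).map (algebraMap _ R)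
  have hsurj : ∀ z : B', ∃ (b : B) (j : ℕ), algebraMap B R b = algebraMap B R f ^ j *
      algebraMap B' R z ∧ χ b = χ f ^ j * χ' z := by
    intro z
    obtain ⟨⟨b, ⟨_, j, rfl⟩⟩, hb⟩ := IsLocalization.surj (Submonoid.powers f) z
    refine ⟨b, j, ?_, ?_⟩
    · rw [IsScalarTower.algebraMap_apply B B' R b, ← hb, map_mul, map_pow, map_pow,
        ← IsScalarTower.algebraMap_apply, mul_comm]
    · rw [← hχ' b, ← hb, map_mul, hχ', map_pow, mul_comm]
  obtain ⟨DR, hDR⟩ := exists_derivation_extending (S := R) (RingHom.ker ψ).primeCompl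
    ((Algebra.linearMap A R).compDer D)
  replace hDR : ∀ x : A, DR (algebraMap A R x) = algebraMap A R (D x) := hDR
  have hDB : ∀ z : B', DR (algebraMap B' R z) = 0 := by
    intro z
    obtain ⟨b, j, hb, -⟩ := hsurj z
    refine derivation_eq_of_smul (s := algebraMap B R f ^ j) (hfu.pow j) ?_ ?_
    · rw [← map_pow, DR.map_algebraMap]
    · rw [← hb, DR.map_algebraMap]
  have hunit : ∀ y : (RingHom.ker ψ).primeCompl, IsUnit (ψ y) := fun y =>
    isUnit_iff_ne_zero.2 fun h0 => y.2 h0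
  let ψR : R →+* K := IsLocalization.lift hunit
  have hψR : ∀ x, ψR (algebraMap A R x) = ψ x := fun x => IsLocalization.lift_eq hunit x
  have hker : RingHom.ker ψR = IsLocalRing.maximalIdeal R := by
    ext x
    obtain ⟨x, s, rfl⟩ := IsLocalization.exists_mk'_eq (RingHom.ker ψ).primeCompl x
    rw [IsLocalization.AtPrime.mk'_mem_maximal_iff R (RingHom.ker ψ), RingHom.mem_ker,
      RingHom.mem_ker, IsLocalization.lift_mk'_spec, mul_zero]
  -- The maximal ideal of `R` is generated by `ker χ`, and near `χ` the étale coordinates generate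
  -- `ker χ` up to functions that are units in `R`.
  have hts : Ideal.ofList ts = IsLocalRing.maximalIdeal R := by
    apply le_antisymm
    · refine Ideal.span_le.2 fun t ht => ?_
      change t ∈ ts at ht
      simp only [ts, List.mem_map, centeredCoordinates, List.mem_ofFn] at ht
      obtain ⟨_, ⟨i, rfl⟩, rfl⟩ := ht
      rw [IsScalarTower.algebraMap_apply (MvPolynomial (Fin n) k) B' R]
      obtain ⟨b, j, hb, hχb⟩ := hsurj (algebraMap (MvPolynomial (Fin n) k) B'
        (MvPolynomial.X i - MvPolynomial.C (a₀ i)))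
      have h0 : χ b = 0 := by
        rw [hχb, map_sub, map_sub, ← MvPolynomial.algebraMap_eq, ← IsScalarTower.algebraMap_apply]
        simp [a₀]
      have h1 : algebraMap B R b ∈ IsLocalRing.maximalIdeal R := by
        rw [IsScalarTower.algebraMap_apply B A R,
          IsLocalization.AtPrime.to_map_mem_maximal_iff R (RingHom.ker ψ), hψ]
        exact Ideal.mem_map_of_mem _ h0
      rw [hb] at h1
      exact ((Ideal.unit_mul_mem_iff_mem _ (hfu.pow j)).1 h1)
    · have hmax : IsLocalRing.maximalIdeal R = (RingHom.ker χ).map (algebraMap B R) := by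
        rw [← IsLocalization.AtPrime.map_eq_maximalIdeal (RingHom.ker ψ) R,
          congrArg (Ideal.map (algebraMap A R)) hψ, Ideal.map_map, ← IsScalarTower.algebraMap_eq]
      rw [hmax, Ideal.map_le_iff_le_comap]
      intro x hx
      obtain ⟨s, hs, hsx⟩ := exists_mul_mem_map_of_etale (n := n) χ' (x := algebraMap B B' x)
        (by rw [hχ']; exact hx)
      have h1 := Ideal.mem_map_of_mem (algebraMap B' R) hsx
      rw [Ideal.map_map, ← IsScalarTower.algebraMap_eq, map_mul, Ideal.map_ofList] at h1
      have hsu : IsUnit (algebraMap B' R s) := by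
        obtain ⟨b, j, hb, hχb⟩ := hsurj s
        have := hcomap b (by rw [hχb]; exact mul_ne_zero (pow_ne_zero _ hf) hs)
        rw [hb] at this
        exact isUnit_of_mul_isUnit_right this
      rw [Ideal.unit_mul_mem_iff_mem _ hsu, ← IsScalarTower.algebraMap_apply] at h1
      exact h1
  have hinj : Function.Injective (algebraMap A R) :=
    IsLocalization.injective R (RingHom.ker ψ).primeCompl_le_nonZeroDivisors
  have hR : HasSolutionMod DR (algebraMap A R a) (algebraMap A R b) ⊥ := by
    obtain ⟨u, r, c, hc, hr, huc, hE⟩ := h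
    simp only [Ideal.mem_bot] at hc hr huc hE
    refine ⟨algebraMap A R u, algebraMap A R r, algebraMap A R c, ?_, ?_, ?_, ?_⟩ <;>
      simp only [Ideal.mem_bot, hDR, map_eq_zero_iff _ hinj]
    · exact hc
    · exact hr
    · exact huc
    · rw [← map_zero (algebraMap A R), ← hE]
      simp
  -- Regularity of the coordinates passes to `R` because `R` is flat over the polynomial ring.
  have := hR.ofList ts hts
    ((isWeaklyRegular_centeredCoordinates a₀).of_flat) (fun t ht => by
      simp only [ts, List.mem_map] at ht
      obtain ⟨y, -, rfl⟩ := ht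
      rw [IsScalarTower.algebraMap_apply (MvPolynomial (Fin n) k) B' R]
      exact hDB _)
  rw [← hker] at this
  rw [← hψR a, ← hψR b]
  refine this.solvableODE ψR fun x => ?_
  obtain ⟨x, s, rfl⟩ := IsLocalization.exists_mk'_eq (RingHom.ker ψ).primeCompl x
  have hxs : algebraMap A R s * IsLocalization.mk' R x s = algebraMap A R x :=
    IsLocalization.mk'_spec' R x s
  have e1 := congrArg (fun y => ψR (DR y)) hxs
  have e2 := congrArg (fun y => δ (ψR y)) hxs
  simp only [map_mul, Derivation.leibniz, hDR, hψR, hδ, map_add, smul_eq_mul] at e1 e2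
  rw [← e1] at e2
  exact mul_left_cancel₀ (hunit s).ne_zero (by linear_combination e2)

/-- A countable union of proper closed subsets does not cover a complex affine variety. -/
theorem exists_algHom_forall_ne_zero {B : Type} [CommRing B] [IsDomain B] [Algebra ℂ B]
    [Algebra.FiniteType ℂ B] (S : Set B) (hS : S.Countable) (h0 : (0 : B) ∉ S) :
    ∃ χ : B →ₐ[ℂ] ℂ, ∀ s ∈ S, χ s ≠ 0 := by
  -- Invert `S` and take a residue field `F`. It has countable dimension over `ℂ`, being spanned by
  -- monomials over denominators from the countable monoid `M`.
  let M := Submonoid.closure S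
  have hM : Countable M := by
    have : Countable S := hS.to_subtype
    have h1 : (M : Set B) = Set.range (FreeMonoid.lift ((↑) : S → B)) := by
      simp only [M]
      rw [Submonoid.closure_eq_mrange]
      rfl
    have : Countable (FreeMonoid S) := inferInstanceAs (Countable (List S))
    have h2 : (M : Set B).Countable := h1 ▸ Set.countable_range _
    exact h2.to_subtype
  have hM0 : M ≤ nonZeroDivisors B := by
    refine Submonoid.closure_le.2 fun s hs => ?_
    exact mem_nonZeroDivisors_of_ne_zero fun h => h0 (h ▸ hs)
  let L := Localization M
  have hinj : Function.Injective (algebraMap B L) := IsLocalization.injective L hM0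
  have : Nontrivial L := hinj.nontrivial
  obtain ⟨m, hm⟩ := Ideal.exists_maximal L
  let F := L ⧸ m
  let _ : Field F := Ideal.Quotient.field m
  obtain ⟨n, f, hf⟩ := Algebra.FiniteType.iff_quotient_mvPolynomial''.1
    (inferInstance : Algebra.FiniteType ℂ B)
  let g : B →ₐ[ℂ] F := (Ideal.Quotient.mkₐ ℂ m).comp (IsScalarTower.toAlgHom ℂ B L)
  have hgu : ∀ s : M, g s ≠ 0 := fun s =>
    (((IsLocalization.map_units L s).map (Ideal.Quotient.mk m))).ne_zero
  let v : (Fin n →₀ ℕ) × M → F := fun p => g (f (MvPolynomial.monomial p.1 1)) * (g p.2)⁻¹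
  have hspan : Submodule.span ℂ (Set.range v) = ⊤ := by
    rw [eq_top_iff]
    rintro x -
    obtain ⟨x, rfl⟩ := Ideal.Quotient.mk_surjective x
    obtain ⟨b, s, rfl⟩ := IsLocalization.exists_mk'_eq M x
    obtain ⟨p, rfl⟩ := hf b
    have hx : Ideal.Quotient.mk m (IsLocalization.mk' L (f p) s) = g (f p) * (g s)⁻¹ := by
      rw [eq_mul_inv_iff_mul_eq₀ (hgu s)]
      change Ideal.Quotient.mk m _ * Ideal.Quotient.mk m (algebraMap B L s) =
        Ideal.Quotient.mk m (algebraMap B L (f p))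
      rw [← map_mul, IsLocalization.mk'_spec]
    rw [hx, p.as_sum, map_sum, map_sum, Finset.sum_mul]
    refine Submodule.sum_mem _ fun d _ => ?_
    have : (MvPolynomial.monomial d (p.coeff d) : MvPolynomial (Fin n) ℂ) =
        (p.coeff d) • (MvPolynomial.monomial d 1 : MvPolynomial (Fin n) ℂ) := by
      rw [MvPolynomial.smul_monomial, smul_eq_mul, mul_one]
    rw [this, map_smul, map_smul, smul_mul_assoc]
    exact Submodule.smul_mem _ _ (Submodule.subset_span ⟨(d, s), rfl⟩)
  have hrank : Module.rank ℂ F ≤ Cardinal.aleph0 := by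
    rw [← rank_top, ← hspan]
    exact (rank_span_le _).trans (Cardinal.mk_le_aleph0_iff.2 (Set.countable_range v).to_subtype)
  have halg : Algebra.IsAlgebraic ℂ F := by
    by_contra hcon
    rw [← Algebra.transcendental_iff_not_isAlgebraic] at hcon
    obtain ⟨x, hx⟩ := hcon.transcendental
    -- For a transcendental `x` the elements `1 / (x - z)`, with `z` in `ℂ`, would be uncountably
    -- many independent vectors. Hence `F = ℂ`.
    have h1 := hx.linearIndependent_sub_inv.cardinal_le_rank.trans hrank
    exact (Cardinal.aleph0_lt_continuum.trans_eq Cardinal.mk_complex.symm).not_ge h1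
  have hbij := IsAlgClosed.algebraMap_bijective_of_isIntegral (k := ℂ) (K := F)
  let e : ℂ ≃ₐ[ℂ] F := AlgEquiv.ofBijective (Algebra.ofId ℂ F) hbij
  refine ⟨(e.symm : F →ₐ[ℂ] ℂ).comp g, fun s hs => ?_⟩
  change e.symm (g s) ≠ 0
  simpa using hgu ⟨s, Submonoid.subset_closure hs⟩

/-! ### Descent of solutions along extensions of the constants -/

section ConstantExtension

universe u

open TensorProduct

theorem exists_functional_ne_zero {k V W : Type*} [Field k] [AddCommGroup V] [Module k V]
    [AddCommGroup W] [Module k W] {x : V ⊗[k] W} (hx : x ≠ 0) :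
    ∃ l : V →ₗ[k] k, TensorProduct.lid k W (l.rTensor W x) ≠ 0 := by
  classical
  by_contra! hcon
  apply hx
  let b := Module.Basis.ofVectorSpace k V
  apply (TensorProduct.equivFinsuppOfBasisLeft (N := W) b).injective
  have key : ∀ (x : V ⊗[k] W) i, TensorProduct.equivFinsuppOfBasisLeft (N := W) b x i =
      TensorProduct.lid k W ((b.coord i).rTensor W x) := by
    intro x i
    induction x using TensorProduct.induction_on with
    | zero => simp
    | tmul v w => simp 
    | add x y hx hy => simp only [map_add, Finsupp.add_apply, hx, hy]
  ext i
  rw [key, hcon, map_zero, Finsupp.zero_apply]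

variable {k A : Type*} [Field k] [CommRing A] [Algebra k A]

/-- A tensor is a finite sum, so it is defined over every subalgebra containing the finitely many
second factors. -/
theorem exists_finite_forall_mem_range {M : Type*} [CommRing M] [Algebra k M] (x : A ⊗[k] M) :
    ∃ G : Set M, G.Finite ∧ ∀ R : Subalgebra k M, G ⊆ R →
      x ∈ Set.range (Algebra.TensorProduct.map (AlgHom.id k A) R.val) := by
  induction x using TensorProduct.induction_on with
  | zero => exact ⟨∅, Set.finite_empty, fun R _ => ⟨0, map_zero _⟩⟩
  | tmul a m =>
    exact ⟨{m}, Set.finite_singleton m, fun R hR => ⟨a ⊗ₜ ⟨m, hR rfl⟩, by simp⟩⟩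
  | add x y hx hy =>
    obtain ⟨G, hG, h⟩ := hx
    obtain ⟨G', hG', h'⟩ := hy
    refine ⟨G ∪ G', hG.union hG', fun R hR => ?_⟩
    obtain ⟨a, ha⟩ := h R (Set.subset_union_left.trans hR)
    obtain ⟨b, hb⟩ := h' R (Set.subset_union_right.trans hR)
    exact ⟨a + b, by rw [map_add, ha, hb]⟩

/-- The extension of a derivation along an extension of constants. -/
def extendConstants (D : Derivation k A A) (M : Type*) [CommRing M] [Algebra k M] :
    A ⊗[k] M →ₗ[k] A ⊗[k] M := D.toLinearMap.rTensor M

@[simp]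
theorem extendConstants_tmul (D : Derivation k A A) {M : Type*} [CommRing M] [Algebra k M] (a : A)
    (m : M) : extendConstants D M (a ⊗ₜ m) = D a ⊗ₜ m := rfl

theorem extendConstants_mul (D : Derivation k A A) {M : Type*} [CommRing M] [Algebra k M]
    (x y : A ⊗[k] M) :
    extendConstants D M (x * y) = x * extendConstants D M y + y * extendConstants D M x := by
  induction x using TensorProduct.induction_on with
  | zero => simp
  | add x x' hx hx' => rw [add_mul, map_add, map_add, hx, hx']; ring
  | tmul a m =>
    induction y using TensorProduct.induction_on with
    | zero => simp
    | add y y' hy hy' => rw [mul_add, map_add, map_add, hy, hy']; ring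
    | tmul b n =>
      simp [TensorProduct.add_tmul, mul_comm n m]

theorem extendConstants_map (D : Derivation k A A) {M N : Type*} [CommRing M] [Algebra k M]
    [CommRing N] [Algebra k N] (f : M →ₐ[k] N) (x : A ⊗[k] M) :
    extendConstants D N (Algebra.TensorProduct.map (AlgHom.id k A) f x) =
      Algebra.TensorProduct.map (AlgHom.id k A) f (extendConstants D M x) := by
  induction x using TensorProduct.induction_on with
  | zero => simp
  | add x x' hx hx' => simp only [map_add, hx, hx']
  | tmul a m => simp

/-- The expression whose vanishing says that `(u / r, c)` solves `D g + a g = c b`. -/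
def odeExpr (D : Derivation k A A) (a b : A) {M : Type*} [CommRing M] [Algebra k M]
    (u r : A ⊗[k] M) (c : M) : A ⊗[k] M :=
  r * extendConstants D M u - u * extendConstants D M r + (a ⊗ₜ 1) * u * r - (b ⊗ₜ c) * r ^ 2

theorem odeExpr_map (D : Derivation k A A) (a b : A) {M N : Type*} [CommRing M] [Algebra k M]
    [CommRing N] [Algebra k N] (f : M →ₐ[k] N) (u r : A ⊗[k] M) (c : M) :
    odeExpr D a b (Algebra.TensorProduct.map (AlgHom.id k A) f u)
      (Algebra.TensorProduct.map (AlgHom.id k A) f r) (f c) =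
      Algebra.TensorProduct.map (AlgHom.id k A) f (odeExpr D a b u r c) := by
  simp only [odeExpr, extendConstants_map, map_sub, map_add, map_mul, map_pow]
  simp

/-- Naturality of contraction: to keep a tensor nonzero under a specialization `f` of the constants,
it suffices that `f` does not kill one scalar. -/
theorem lid_rTensor_map {M N : Type*} [CommRing M] [Algebra k M] [CommRing N] [Algebra k N]
    (f : M →ₐ[k] N) (l : A →ₗ[k] k) (x : A ⊗[k] M) :
    TensorProduct.lid k N (l.rTensor N (Algebra.TensorProduct.map (AlgHom.id k A) f x)) =
      f (TensorProduct.lid k M (l.rTensor M x)) := by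
  induction x using TensorProduct.induction_on with
  | zero => simp
  | add x x' hx hx' => simp only [map_add, hx, hx']
  | tmul a m => simp

theorem map_injective_of_injective {M N : Type*} [CommRing M] [Algebra k M] [CommRing N]
    [Algebra k N] (f : M →ₐ[k] N) (hf : Function.Injective f) :
    Function.Injective (Algebra.TensorProduct.map (AlgHom.id k A) f) :=
  Module.Flat.lTensor_preserves_injective_linearMap (M := A) f.toLinearMap hf

/-- A solution over an algebraic extension of the constants gives a solution. -/
theorem exists_solution_of_algebraic {L : Type*} [Field L] [Algebra k L] [Algebra.IsAlgebraic k L]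
    [IsDomain (A ⊗[k] L)] (D : Derivation k A A) (a b : A) (u r : A ⊗[k] L) (c : L) (hr : r ≠ 0)
    (huc : u ≠ 0 ∨ c ≠ 0) (h : odeExpr D a b u r c = 0) :
    ∃ (u r : A) (c : k), r ≠ 0 ∧ (u ≠ 0 ∨ c ≠ 0) ∧
      r * D u - u * D r + a * u * r - algebraMap k A c * b * r ^ 2 = 0 := by
  have hinj : Function.Injective (algebraMap A (A ⊗[k] L)) :=
    Algebra.TensorProduct.includeLeft_injective (S := A) (algebraMap k L).injective
  have : Nontrivial A := (RingHom.domain_nontrivial (algebraMap A (A ⊗[k] L)))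
  have hint : IsIntegral A r := Algebra.IsIntegral.isIntegral r
  -- By integrality over `A`, the element `r` has a nonzero multiple `ρ = s r` in `A`. Multiplying
  -- `u` and `r` by `s` multiplies the expression by `s ^ 2`, so the denominator may be taken in
  -- `A`.
  obtain ⟨ρ, hρ, hρ0⟩ := (Submodule.ne_bot_iff _).1 (Ideal.comap_ne_bot_of_integral_mem hr
    (Ideal.mem_span_singleton_self r) hint)
  obtain ⟨s, hs⟩ := Ideal.mem_span_singleton'.1 (Ideal.mem_comap.1 hρ)
  have hs0 : s ≠ 0 := by
    rintro rfl
    rw [zero_mul] at hs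
    exact hρ0 (hinj (by rw [← hs, map_zero]))
  have hρe : algebraMap A (A ⊗[k] L) ρ = ρ ⊗ₜ 1 := rfl
  have h1 : odeExpr D a b (s * u) (ρ ⊗ₜ 1) c = 0 := by
    rw [← hρe, ← hs]
    have : odeExpr D a b (s * u) (s * r) c = s ^ 2 * odeExpr D a b u r c := by
      simp only [odeExpr, extendConstants_mul]
      ring
    rw [this, h, mul_zero]
  set w := s * u with hw
  have hwc : w ≠ 0 ∨ c ≠ 0 := huc.imp_left fun h => mul_ne_zero hs0 h
  -- With the denominator in `A` the equation is linear in `(w, c)`. A functional `l` on `L` induces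
  -- an `A`-linear map commuting with the derivation, hence carries the solution down to `k`.
  let Λ : (L →ₗ[k] k) → (A ⊗[k] L →ₗ[k] A) := fun l =>
    (TensorProduct.rid k A).toLinearMap ∘ₗ l.lTensor A
  have hΛ : ∀ l a m, Λ l (a ⊗ₜ m) = l m • a := fun l a m => by simp [Λ]
  have hΛD : ∀ l x, Λ l (extendConstants D L x) = D (Λ l x) := by
    intro l x
    induction x using TensorProduct.induction_on with
    | zero => simp
    | add x x' hx hx' => simp only [map_add, hx, hx']
    | tmul a m => simp [hΛ]
  have hΛm : ∀ l (y : A) x, Λ l ((y ⊗ₜ 1) * x) = y * Λ l x := by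
    intro l y x
    induction x using TensorProduct.induction_on with
    | zero => simp
    | add x x' hx hx' => simp only [map_add, mul_add, hx, hx']
    | tmul a m => simp [hΛ]
  obtain ⟨l, hl⟩ : ∃ l : L →ₗ[k] k, Λ l w ≠ 0 ∨ l c ≠ 0 := by
    rcases hwc with hw0 | hc0
    · have : TensorProduct.comm k A L w ≠ 0 := by simpa using hw0
      obtain ⟨l, hl⟩ := exists_functional_ne_zero this
      refine ⟨l, Or.inl ?_⟩
      have key : ∀ x, TensorProduct.lid k A (l.rTensor A (TensorProduct.comm k A L x)) = Λ l x := by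
        intro x
        induction x using TensorProduct.induction_on with
        | zero => simp
        | add x x' hx hx' => simp only [map_add, hx, hx']
        | tmul a m => simp [hΛ]
      rwa [← key]
    · by_contra! hcon
      exact hc0 ((Module.forall_dual_apply_eq_zero_iff k c).1 fun l => (hcon l).2)
  refine ⟨Λ l w, ρ, l c, hρ0, hl, ?_⟩
  have h2 := congrArg (Λ l) h1
  rw [map_zero] at h2
  have e1 : odeExpr D a b w (ρ ⊗ₜ 1) c = (ρ ⊗ₜ 1) * extendConstants D L w - (D ρ ⊗ₜ 1) * w +
      ((a * ρ) ⊗ₜ 1) * w - (b * ρ ^ 2) ⊗ₜ c := by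
    simp only [odeExpr, extendConstants_tmul]
    have e2 : ((a * ρ) ⊗ₜ[k] (1 : L)) = (a ⊗ₜ 1) * (ρ ⊗ₜ 1) := by simp
    have e3 : ((b * ρ ^ 2) ⊗ₜ[k] c) = (b ⊗ₜ c) * (ρ ⊗ₜ 1) ^ 2 := by
      simp [Algebra.TensorProduct.tmul_pow]
    rw [e2, e3]
    ring
  rw [e1, map_sub, map_add, map_sub, hΛm, hΛm, hΛm, hΛD, hΛ, Algebra.smul_def] at h2
  linear_combination h2

/-- The Nullstellensatz applied to `R[1/σ]`. -/
theorem exists_algHom_finite_ne_zero (k : Type*) {R : Type u} [Field k] [CommRing R] [IsDomain R]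
    [Algebra k R] [Algebra.FiniteType k R] {σ : R} (hσ : σ ≠ 0) :
    ∃ (L : Type u) (_ : Field L) (_ : Algebra k L) (f : R →ₐ[k] L), Module.Finite k L ∧
      f σ ≠ 0 := by
  let S := Localization.Away σ
  have : Nontrivial S := (IsLocalization.injective S
    (powers_le_nonZeroDivisors_of_noZeroDivisors hσ)).nontrivial
  obtain ⟨m, hm⟩ := Ideal.exists_maximal S
  have : Algebra.FiniteType R S := IsLocalization.finiteType_of_monoid_fg (.powers σ) S
  have : Algebra.FiniteType k S := .trans inferInstance this
  let f : R →ₐ[k] S ⧸ m := (Ideal.Quotient.mkₐ k m).comp (IsScalarTower.toAlgHom k R S)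
  have hfσ : f σ ≠ 0 :=
    ((IsLocalization.Away.algebraMap_isUnit (S := S) σ).map (Ideal.Quotient.mk m)).ne_zero
  let _ : Field (S ⧸ m) := Ideal.Quotient.field m
  exact ⟨S ⧸ m, inferInstance, inferInstance, f, finite_of_finite_type_of_isJacobsonRing k _, hfσ⟩

/-- Descent of solutions along an extension of the constants. -/
theorem exists_solution_of_extendConstants {M : Type u} [Field M] [IsAlgClosed M] [Algebra k M]
    [IsDomain (A ⊗[k] M)] (D : Derivation k A A) (a b : A) (u r : A ⊗[k] M) (c : M) (hr : r ≠ 0)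
    (huc : u ≠ 0 ∨ c ≠ 0) (h : odeExpr D a b u r c = 0) :
    ∃ (u r : A) (c : k), r ≠ 0 ∧ (u ≠ 0 ∨ c ≠ 0) ∧
      r * D u - u * D r + a * u * r - algebraMap k A c * b * r ^ 2 = 0 := by
  obtain ⟨G₁, hG₁, hu⟩ := exists_finite_forall_mem_range u
  obtain ⟨G₂, hG₂, hr'⟩ := exists_finite_forall_mem_range r
  obtain ⟨R, hfg, hGR⟩ : ∃ R : Subalgebra k M, Algebra.FiniteType k R ∧
      G₁ ∪ G₂ ∪ {c} ⊆ (R : Set M) :=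
    ⟨Algebra.adjoin k (G₁ ∪ G₂ ∪ {c}), (Subalgebra.fg_iff_finiteType _).1
      ⟨((hG₁.union hG₂).union (Set.finite_singleton c)).toFinset, by simp⟩,
      Algebra.subset_adjoin⟩
  obtain ⟨uR, rfl⟩ := hu R ((Set.subset_union_left.trans Set.subset_union_left).trans hGR)
  obtain ⟨rR, rfl⟩ := hr' R ((Set.subset_union_right.trans Set.subset_union_left).trans hGR)
  obtain ⟨cR, rfl⟩ : ∃ cR : R, R.val cR = c := ⟨⟨c, hGR (Or.inr rfl)⟩, rfl⟩
  have hinj := map_injective_of_injective (A := A) R.val Subtype.val_injective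
  rw [odeExpr_map, map_eq_zero_iff _ hinj] at h
  rw [Ne, map_eq_zero_iff _ hinj] at hr
  have huc' : uR ≠ 0 ∨ cR ≠ 0 := huc.imp (fun h h0 => h (by rw [h0, map_zero]))
    (fun h h0 => h (by rw [h0, map_zero]))
  obtain ⟨l, hl⟩ := exists_functional_ne_zero hr
  obtain ⟨ρ, hρ0, hρ⟩ : ∃ ρ : R, ρ ≠ 0 ∧ ∀ {L : Type u} [Field L] [Algebra k L] (f : R →ₐ[k] L),
      f ρ ≠ 0 → Algebra.TensorProduct.map (AlgHom.id k A) f uR ≠ 0 ∨ f cR ≠ 0 := by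
    rcases huc' with h0 | h0
    · obtain ⟨l, hl⟩ := exists_functional_ne_zero h0
      refine ⟨_, hl, fun f hf => Or.inl fun h0 => hf ?_⟩
      rw [← lid_rTensor_map, h0, map_zero, map_zero]
    · exact ⟨cR, h0, fun f hf => Or.inr hf⟩
  -- If `f σ ≠ 0`, both the denominator and the pair (numerator, constant) stay nonzero under `f`.
  let σ := TensorProduct.lid k R (l.rTensor R rR) * ρ
  have hσ0 : σ ≠ 0 := mul_ne_zero hl hρ0
  obtain ⟨L, _, _, f, _, hfσ⟩ := exists_algHom_finite_ne_zero k hσ0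
  replace hfσ : f (TensorProduct.lid k R (l.rTensor R rR)) * f ρ ≠ 0 := by
    rwa [← map_mul]
  -- The finite extension `L` embeds in the algebraically closed field `M`, so `A ⊗ L` is a subring
  -- of the domain `A ⊗ M`.
  let e : L →ₐ[k] M := IsAlgClosed.lift
  have : IsDomain (A ⊗[k] L) :=
    (map_injective_of_injective (A := A) e e.injective).isDomain
      (Algebra.TensorProduct.map (AlgHom.id k A) e).toRingHom
  refine exists_solution_of_algebraic D a b (Algebra.TensorProduct.map (AlgHom.id k A) f uR)
    (Algebra.TensorProduct.map (AlgHom.id k A) f rR) (f cR) (fun h0 => ?_)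
    (hρ f (right_ne_zero_of_mul hfσ)) (by rw [odeExpr_map, h, map_zero])
  apply left_ne_zero_of_mul hfσ
  rw [← lid_rTensor_map, h0, map_zero, map_zero]

end ConstantExtension

/-! ### Models of a fibre over its field of definition -/

section Model

open TensorProduct

variable {σ : Type*}

/-- Both sides obey the Leibniz rule along `Θ`, so agreement on constants and variables suffices. -/
theorem derivation_comp_eq {R S : Type*} [CommRing R] [CommRing S] (Θ : MvPolynomial σ R →+* S)
    (T : S →+ S) (hT : ∀ x y, T (x * y) = x * T y + y * T x)
    (hC : ∀ c, T (Θ (MvPolynomial.C c)) = 0)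
    (Δ : Derivation R (MvPolynomial σ R) (MvPolynomial σ R))
    (hX : ∀ i, T (Θ (MvPolynomial.X i)) = Θ (Δ (MvPolynomial.X i))) (f : MvPolynomial σ R) :
    T (Θ f) = Θ (Δ f) := by
  induction f using MvPolynomial.induction_on with
  | C c => rw [hC, MvPolynomial.derivation_C, map_zero]
  | add p q hp hq => simp only [map_add, hp, hq]
  | mul_X p i hp =>
    rw [map_mul, hT, hp, hX, Derivation.leibniz, map_add, smul_eq_mul, smul_eq_mul, map_mul,
      map_mul]

theorem map_mkDerivation {R S : Type*} [CommRing R] [CommRing S] (φ : R →+* S)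
    (d₀ : σ → MvPolynomial σ R) (f : MvPolynomial σ R) :
    MvPolynomial.mkDerivation S (fun i => MvPolynomial.map φ (d₀ i)) (MvPolynomial.map φ f) =
      MvPolynomial.map φ (MvPolynomial.mkDerivation R d₀ f) :=
  derivation_comp_eq (MvPolynomial.map φ)
    (MvPolynomial.mkDerivation S fun i => MvPolynomial.map φ (d₀ i) : _ →+ MvPolynomial σ S)
    (fun x y => by simp) (fun c => by simp) _ (fun i => by simp) f

theorem mem_of_derivation_span {k R : Type*} [CommRing k] [CommRing R] [Algebra k R]
    (D : Derivation k R R) (S : Set R) (h : ∀ x ∈ S, D x ∈ Ideal.span S) {x : R}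
    (hx : x ∈ Ideal.span S) : D x ∈ Ideal.span S := by
  refine Submodule.span_induction h (by simp) ?_ ?_ hx
  · intro y z _ _ hy hz
    rw [map_add]; exact add_mem hy hz
  · intro c y hy hy'
    rw [smul_eq_mul, Derivation.leibniz]
    exact add_mem (Ideal.mul_mem_left _ _ hy') (Ideal.mul_mem_right _ _ hy)

section ModelMap

variable {k Q : Type*} [Field k] [CommRing Q] [Algebra k Q] (mk : MvPolynomial σ k →ₐ[k] Q)
  (N : Type*) [CommRing N] [Algebra k N]

/-- The presentation of the extension of constants of a presented algebra. -/
def modelMap : MvPolynomial σ N →+* Q ⊗[k] N :=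
  MvPolynomial.eval₂Hom
    (Algebra.TensorProduct.includeRight : N →ₐ[k] Q ⊗[k] N).toRingHom
    fun i => mk (MvPolynomial.X i) ⊗ₜ[k] (1 : N)

@[simp]
theorem modelMap_C (n : N) : modelMap mk N (MvPolynomial.C n) = 1 ⊗ₜ n := by
  simp [modelMap]

@[simp]
theorem modelMap_X (i : σ) :
    modelMap mk N (MvPolynomial.X i) = mk (MvPolynomial.X i) ⊗ₜ 1 := by
  simp [modelMap]

theorem modelMap_map (f : MvPolynomial σ k) :
    modelMap mk N (MvPolynomial.map (algebraMap k N) f) = mk f ⊗ₜ 1 := by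
  induction f using MvPolynomial.induction_on with
  | C c =>
    rw [MvPolynomial.map_C, modelMap_C, ← MvPolynomial.algebraMap_eq, AlgHom.commutes,
      Algebra.algebraMap_eq_smul_one, Algebra.algebraMap_eq_smul_one,
      TensorProduct.tmul_smul, TensorProduct.smul_tmul']
  | add p q hp hq => simp only [map_add, hp, hq, TensorProduct.add_tmul]
  | mul_X p i hp => simp [hp]

theorem modelMap_surjective (hmk : Function.Surjective mk) :
    Function.Surjective (modelMap mk N) := by
  intro x
  induction x using TensorProduct.induction_on with
  | zero => exact ⟨0, map_zero _⟩
  | add x y hx hy =>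
    obtain ⟨f, rfl⟩ := hx
    obtain ⟨g, rfl⟩ := hy
    exact ⟨f + g, map_add _ _ _⟩
  | tmul a n =>
    obtain ⟨f, rfl⟩ := hmk a
    refine ⟨MvPolynomial.C n * MvPolynomial.map (algebraMap k N) f, ?_⟩
    rw [map_mul, modelMap_C, modelMap_map]
    simp

theorem modelMap_mkDerivation (dk : σ → MvPolynomial σ k)
    (D : Derivation k Q Q)
    (hD : ∀ f, D (mk f) = mk (MvPolynomial.mkDerivation k dk f))
    (f : MvPolynomial σ N) :
    extendConstants D N (modelMap mk N f) = modelMap mk N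
      (MvPolynomial.mkDerivation N (fun i => MvPolynomial.map (algebraMap k N) (dk i)) f) := by
  refine derivation_comp_eq (modelMap mk N) (extendConstants D N).toAddMonoidHom
    (extendConstants_mul D) (fun c => ?_) _ (fun i => ?_) f
  · simp
  · simp [modelMap_map, hD]

end ModelMap

theorem isDomain_tensorProduct_of_injective {k Q M K : Type*} [Field k] [CommRing Q] [Field M]
    [Field K] [Algebra k Q] [Algebra k M] (Ω : Q ⊗[k] M →+* K) (h : Function.Injective Ω) :
    IsDomain (Q ⊗[k] M) :=
  Function.Injective.isDomain Ω h

set_option maxHeartbeats 400000 in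
/-- A solution over a fibre of a family gives a solution over the field of definition `k` of the
fibre. -/
theorem exists_model_solution {k B₀ B A M K : Type*} [Field k] [CommRing B₀] [CommRing B]
    [CommRing A] [Algebra B A] (ι : B₀ →+* B) (α : B₀ →+* k) (D : Derivation B A A) (a b : A)
    (π : MvPolynomial σ B →ₐ[B] A) (hπ : Function.Surjective π) (S₀ : Set (MvPolynomial σ B₀))
    (hS₀ : RingHom.ker π = Ideal.span (MvPolynomial.map ι '' S₀)) (d₀ : σ → MvPolynomial σ B₀)
    (hd₀ : ∀ i, π (MvPolynomial.map ι (d₀ i)) = D (π (MvPolynomial.X i)))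
    (hdS : ∀ F ∈ S₀, MvPolynomial.mkDerivation B₀ d₀ F ∈ Ideal.span S₀)
    (a₀ b₀ : MvPolynomial σ B₀) (ha₀ : π (MvPolynomial.map ι a₀) = a)
    (hb₀ : π (MvPolynomial.map ι b₀) = b)
    [Field M] [IsAlgClosed M] [Algebra k M] (χ : B →+* M) (hχ : Function.Surjective χ)
    (hkM : ∀ x, algebraMap k M (α x) = χ (ι x)) [Field K] [Algebra M K] (ψ : A →+* K)
    (hψχ : ∀ β, ψ (algebraMap B A β) = algebraMap M K (χ β))
    (hψ : RingHom.ker ψ = (RingHom.ker χ).map (algebraMap B A)) (u r : A) (c : B)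
    (hr : ψ r ≠ 0) (huc : ψ u ≠ 0 ∨ χ c ≠ 0)
    (h : ψ (r * D u - u * D r + a * u * r - algebraMap B A c * b * r ^ 2) = 0)
    {I : Ideal (MvPolynomial σ k)} (hI : I = Ideal.span (MvPolynomial.map α '' S₀))
    {Q : Type*} [CommRing Q] [Algebra k Q] (mk : MvPolynomial σ k →ₐ[k] Q)
    (hmk : Function.Surjective mk) (hmk0 : ∀ f, mk f = 0 ↔ f ∈ I)
    {dk : σ → MvPolynomial σ k} (hdk : dk = fun i => MvPolynomial.map α (d₀ i)) :
    ∃ (v s : MvPolynomial σ k) (e : k), s ∉ I ∧ (v ∉ I ∨ e ≠ 0) ∧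
      s * MvPolynomial.mkDerivation k dk v - v * MvPolynomial.mkDerivation k dk s +
        MvPolynomial.map α a₀ * v * s -
        MvPolynomial.C e * MvPolynomial.map α b₀ * s ^ 2 ∈ I := by
  let _ : Algebra k K := ((algebraMap M K).comp (algebraMap k M)).toAlgebra
  have : IsScalarTower k M K := .of_algebraMap_eq fun _ => rfl
  -- The ideal of relations is stable under the lifted derivation, which therefore descends to the
  -- model `Q`.
  have hDI : ∀ f, mk f = 0 → mk (MvPolynomial.mkDerivation k dk f) = 0 := by
    intro f hf
    rw [hmk0, hI] at hf ⊢
    refine mem_of_derivation_span _ _ ?_ hf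
    rintro _ ⟨F, hF, rfl⟩
    rw [hdk, map_mkDerivation, ← Ideal.map_span]
    exact Ideal.mem_map_of_mem _ (hdS F hF)
  let Dk : Derivation k Q Q := Derivation.liftOfSurjective hmk hDI
  have hDk : ∀ f, Dk (mk f) = mk (MvPolynomial.mkDerivation k dk f) := fun f =>
    Derivation.liftOfSurjective_apply hmk hDI f
  have hmkI : ∀ F ∈ S₀, mk (MvPolynomial.map α F) = 0 := fun F hF =>
    (hmk0 _).2 (hI ▸ Ideal.subset_span ⟨F, hF, rfl⟩)
  have hπD : ∀ f, D (π f) = π (MvPolynomial.mkDerivation B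
      (fun i => MvPolynomial.map ι (d₀ i)) f) :=
    derivation_comp_eq π.toRingHom (D : A →+ A) (fun x y => by simp)
      (fun c => by
        have : π (MvPolynomial.C c) = algebraMap B A c := π.commutes c
        simp [this]) _ (fun i => by simp [hd₀])
  obtain ⟨u, rfl⟩ := hπ u
  obtain ⟨r, rfl⟩ := hπ r
  have hmapM : ∀ f : MvPolynomial σ B₀, MvPolynomial.map χ (MvPolynomial.map ι f) =
      MvPolynomial.map (algebraMap k M) (MvPolynomial.map α f) := by
    intro f
    rw [MvPolynomial.map_map, MvPolynomial.map_map]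
    have : χ.comp ι = (algebraMap k M).comp α := RingHom.ext fun x => (hkM x).symm
    rw [this]
  let Ψ : MvPolynomial σ M →+* K :=
    MvPolynomial.eval₂Hom (algebraMap M K) fun i => ψ (π (MvPolynomial.X i))
  have hΨ : ∀ f, Ψ (MvPolynomial.map χ f) = ψ (π f) := by
    intro f
    have : Ψ.comp (MvPolynomial.map χ) = ψ.comp π.toRingHom := by
      apply MvPolynomial.ringHom_ext
      · intro i
        have : π (MvPolynomial.C i) = algebraMap B A i := π.commutes i
        simp [Ψ, this, hψχ]
      · intro i; simp [Ψ]
    exact DFunLike.congr_fun this f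
  -- The kernel of `ψ ∘ π` is generated by `ker χ` and the relations of `A`, and both vanish in `Q ⊗
  -- M`.
  have hkerΨ : ∀ f, Ψ f = 0 → modelMap mk M f = 0 := by
    intro f hf
    obtain ⟨f, rfl⟩ := MvPolynomial.map_surjective χ hχ f
    rw [hΨ, ← RingHom.mem_ker, hψ] at hf
    have h1 : (RingHom.ker χ).map (algebraMap B A) =
        ((RingHom.ker χ).map (MvPolynomial.C (σ := σ))).map π := by
      change _ = Ideal.map π.toRingHom _
      rw [Ideal.map_map]
      congr 1
      ext x
      exact (π.commutes x).symm
    rw [h1, ← Ideal.mem_comap, Ideal.comap_map_of_surjective _ hπ] at hf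
    obtain ⟨j, hj, s, hs, rfl⟩ := Submodule.mem_sup.1 hf
    have hj' : (RingHom.ker χ).map (MvPolynomial.C (σ := σ)) ≤
        RingHom.ker ((modelMap mk M).comp (MvPolynomial.map χ)) := by
      rw [Ideal.map_le_iff_le_comap]
      intro x hx
      simp [RingHom.mem_ker, (RingHom.mem_ker).1 hx]
    have hs' : RingHom.ker π ≤ RingHom.ker ((modelMap mk M).comp (MvPolynomial.map χ)) := by
      rw [hS₀, Ideal.span_le]
      rintro _ ⟨F, hF, rfl⟩
      change modelMap mk M (MvPolynomial.map χ (MvPolynomial.map ι F)) = 0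
      rw [hmapM, modelMap_map]
      rw [hmkI F hF, TensorProduct.zero_tmul]
    rw [map_add, map_add]
    have e1 : modelMap mk M (MvPolynomial.map χ j) = 0 := hj' hj
    have e2 : modelMap mk M (MvPolynomial.map χ s) = 0 := hs' hs
    rw [e1, e2, add_zero]
  let ev : MvPolynomial σ k →ₐ[k] K := MvPolynomial.aeval fun i => ψ (π (MvPolynomial.X i))
  have hev : ∀ f ∈ I, ev f = 0 := by
    change I ≤ RingHom.ker _
    rw [hI, Ideal.span_le]
    rintro _ ⟨F, hF, rfl⟩
    have h1 : MvPolynomial.aeval (fun i => ψ (π (MvPolynomial.X i))) (MvPolynomial.map α F) =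
        Ψ (MvPolynomial.map (algebraMap k M) (MvPolynomial.map α F)) := by
      simp only [Ψ, MvPolynomial.coe_eval₂Hom, MvPolynomial.eval₂_map, MvPolynomial.aeval_def]
      rfl
    change MvPolynomial.aeval (fun i => ψ (π (MvPolynomial.X i))) (MvPolynomial.map α F) = 0
    rw [h1, ← hmapM, hΨ]
    have : MvPolynomial.map ι F ∈ RingHom.ker π := by
      rw [hS₀]; exact Ideal.subset_span ⟨F, hF, rfl⟩
    rw [(RingHom.mem_ker).1 this, map_zero]
  let κ : Q →ₐ[k] K := (Ideal.Quotient.liftₐ (RingHom.ker mk) ev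
    fun f hf => hev f ((hmk0 f).1 hf)).comp
      (Ideal.quotientKerAlgEquivOfSurjective hmk).symm.toAlgHom
  have hκ : ∀ f, κ (mk f) = ev f := by
    intro f
    have : (Ideal.quotientKerAlgEquivOfSurjective hmk).symm (mk f) =
        Ideal.Quotient.mk (RingHom.ker mk) f := by
      rw [AlgEquiv.symm_apply_eq]; rfl
    simp only [κ, AlgHom.comp_apply]
    erw [this]
    rfl
  obtain ⟨Ω, hΩ⟩ : ∃ Ω : Q ⊗[k] M →+* K, ∀ f, Ω (modelMap mk M f) = Ψ f := by
    let Ω : Q ⊗[k] M →ₐ[k] K :=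
      Algebra.TensorProduct.lift κ (IsScalarTower.toAlgHom k M K) fun _ _ => Commute.all _ _
    refine ⟨Ω.toRingHom, fun f => ?_⟩
    have : Ω.toRingHom.comp (modelMap mk M) = Ψ := by
      apply MvPolynomial.ringHom_ext
      · intro i; simp [Ω, Ψ]
      · intro i; simp [Ω, Ψ, hκ, ev]
    exact DFunLike.congr_fun this f
  -- Thus `Q ⊗ M` is identified with the coordinate ring of the fibre inside its field `K`; in
  -- particular it is a domain.
  have hΩinj : Function.Injective Ω := by
    rw [injective_iff_map_eq_zero]
    intro x hx
    obtain ⟨f, rfl⟩ := modelMap_surjective mk M hmk x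
    rw [hΩ] at hx
    exact hkerΨ f hx
  have : IsDomain (Q ⊗[k] M) := isDomain_tensorProduct_of_injective Ω hΩinj
  have hDM : ∀ f, extendConstants Dk M (modelMap mk M (MvPolynomial.map χ f)) =
      modelMap mk M (MvPolynomial.map χ
        (MvPolynomial.mkDerivation B (fun i => MvPolynomial.map ι (d₀ i)) f)) := by
    intro f
    rw [modelMap_mkDerivation mk M dk Dk hDk, ← map_mkDerivation]
    simp only [hmapM, hdk]
  have hmkM : ∀ f, mk (MvPolynomial.map α f) ⊗ₜ[k] (1 : M) =
      modelMap mk M (MvPolynomial.map χ (MvPolynomial.map ι f)) := by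
    intro f
    rw [hmapM, modelMap_map]
  obtain ⟨v, s, e, hs, hve, hE⟩ := exists_solution_of_extendConstants Dk (mk (MvPolynomial.map α a₀))
    (mk (MvPolynomial.map α b₀)) (modelMap mk M (MvPolynomial.map χ u))
    (modelMap mk M (MvPolynomial.map χ r)) (χ c)
    (fun h0 => hr (by rw [← hΨ, ← hΩ, h0, map_zero]))
    (huc.imp_left fun hu h0 => hu (by rw [← hΨ, ← hΩ, h0, map_zero])) (by
      have e1 : mk (MvPolynomial.map α b₀) ⊗ₜ[k] (χ c) =
          modelMap mk M (MvPolynomial.map χ (MvPolynomial.C c)) *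
            modelMap mk M (MvPolynomial.map χ (MvPolynomial.map ι b₀)) := by
        rw [← hmkM, MvPolynomial.map_C, modelMap_C]
        simp
      rw [odeExpr, hDM, hDM, hmkM, e1]
      simp only [← map_mul, ← map_sub, ← map_add, ← map_pow]
      apply hkerΨ
      rw [hΨ, ← h, ← ha₀, ← hb₀, hπD, hπD]
      have : π (MvPolynomial.C c) = algebraMap B A c := π.commutes c
      simp only [map_mul, map_sub, map_add, map_pow, this])
  obtain ⟨v, rfl⟩ := hmk v
  obtain ⟨s, rfl⟩ := hmk s
  refine ⟨v, s, e, fun h0 => hs ((hmk0 _).2 h0), hve.imp_left fun h1 h0 => h1 ((hmk0 _).2 h0), ?_⟩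
  rw [← hmk0, ← hE, hDk, hDk]
  have : mk (MvPolynomial.C e) = algebraMap k Q e := mk.commutes e
  simp only [map_mul, map_sub, map_add, map_pow, this]

end Model

/-! ### From a solution on the model to one on the chart -/

section Descent

open TensorProduct

variable {σ : Type*}

/-- The relations of a presented domain can be tested over the fraction field of a ring of
definition. -/
theorem presentation_eq_zero_iff {k B₀ B A : Type*} [Field k] [CommRing B₀] [CommRing B]
    [CommRing A] [IsDomain A] [Algebra B A] [Algebra B₀ k] [IsFractionRing B₀ k] (ι : B₀ →+* B)
    (hι : Function.Injective ((algebraMap B A).comp ι))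
    (π : MvPolynomial σ B →ₐ[B] A) (S₀ : Set (MvPolynomial σ B₀))
    (hS₀ : RingHom.ker π = Ideal.span (MvPolynomial.map ι '' S₀))
    {I : Ideal (MvPolynomial σ k)} (hI : I = Ideal.span (MvPolynomial.map (algebraMap B₀ k) '' S₀))
    {Q : Type*} [CommRing Q] [Algebra k Q] (mk : MvPolynomial σ k →ₐ[k] Q)
    (hmk0 : ∀ f, mk f = 0 ↔ f ∈ I) (f : MvPolynomial σ B₀) :
    π (MvPolynomial.map ι f) = 0 ↔ MvPolynomial.map (algebraMap B₀ k) f ∈ I := by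
  -- A field containing `A` and, since `B₀` embeds in `A`, also `k`; the two sets of relations are
  -- compared over it.
  let L := FractionRing A
  have hL : Function.Injective (algebraMap A L) := IsFractionRing.injective A L
  let j : B →+* L := (algebraMap A L).comp (algebraMap B A)
  have hj : Function.Injective (j.comp ι) := by
    rw [RingHom.comp_assoc]; exact hL.comp hι
  let _ : Algebra k L := (IsFractionRing.lift (K := k) hj).toAlgebra
  have hkL : ∀ x, algebraMap k L (algebraMap B₀ k x) = j (ι x) := fun x =>
    IsFractionRing.lift_algebraMap hj x
  have hmap : ∀ f : MvPolynomial σ B₀, MvPolynomial.map j (MvPolynomial.map ι f) =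
      MvPolynomial.map (algebraMap k L) (MvPolynomial.map (algebraMap B₀ k) f) := by
    intro f
    rw [MvPolynomial.map_map, MvPolynomial.map_map]
    congr 1
    have : j.comp ι = (algebraMap k L).comp (algebraMap B₀ k) := RingHom.ext fun x => (hkL x).symm
    rw [this]
  constructor
  · intro h
    have h1 : RingHom.ker π ≤ RingHom.ker ((modelMap mk L).comp (MvPolynomial.map j)) := by
      rw [hS₀, Ideal.span_le]
      rintro _ ⟨F, hF, rfl⟩
      change modelMap mk L (MvPolynomial.map j (MvPolynomial.map ι F)) = 0
      rw [hmap, modelMap_map, (hmk0 _).2 (hI ▸ Ideal.subset_span ⟨F, hF, rfl⟩),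
        TensorProduct.zero_tmul]
    have h2 : modelMap mk L (MvPolynomial.map j (MvPolynomial.map ι f)) = 0 := h1 h
    rw [hmap, modelMap_map] at h2
    rw [← hmk0]
    exact Algebra.TensorProduct.includeLeft_injective (S := k) (algebraMap k L).injective
      (h2.trans (map_zero _).symm)
  · intro h
    let ev : MvPolynomial σ k →ₐ[k] L :=
      MvPolynomial.aeval fun i => algebraMap A L (π (MvPolynomial.X i))
    have hev : ∀ g : MvPolynomial σ B₀, ev (MvPolynomial.map (algebraMap B₀ k) g) =
        algebraMap A L (π (MvPolynomial.map ι g)) := by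
      intro g
      induction g using MvPolynomial.induction_on with
      | C c =>
        have : π (MvPolynomial.C (ι c)) = algebraMap B A (ι c) := π.commutes _
        simp only [MvPolynomial.map_C, this, ev, MvPolynomial.aeval_C, hkL]
        rfl
      | add p q hp hq => simp only [map_add, hp, hq]
      | mul_X p i hp => simp only [map_mul, hp, MvPolynomial.map_X, ev, MvPolynomial.aeval_X]
    have hI' : I ≤ RingHom.ker ev := by
      rw [hI, Ideal.span_le]
      rintro _ ⟨F, hF, rfl⟩
      change ev _ = 0
      have : MvPolynomial.map ι F ∈ RingHom.ker π := by
        rw [hS₀]; exact Ideal.subset_span ⟨F, hF, rfl⟩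
      rw [hev, (RingHom.mem_ker).1 this, map_zero]
    have h1 : ev (MvPolynomial.map (algebraMap B₀ k) f) = 0 := hI' h
    rw [hev] at h1
    exact hL (h1.trans (map_zero _).symm)

/-- A polynomial over the fraction field becomes integral after multiplication by a nonzero
constant. -/
theorem exists_map_eq_C_mul {B₀ k : Type*} [CommRing B₀] [IsDomain B₀] [Field k] [Algebra B₀ k]
    [IsFractionRing B₀ k] (f : MvPolynomial σ k) :
    ∃ m : B₀, m ≠ 0 ∧ ∃ f₀ : MvPolynomial σ B₀, MvPolynomial.map (algebraMap B₀ k) f₀ =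
      MvPolynomial.C (algebraMap B₀ k m) * f := by
  let _ := MvPolynomial.algebraMvPolynomial (R := B₀) (S := k) (σ := σ)
  have := MvPolynomial.isLocalization (σ := σ) (nonZeroDivisors B₀) k
  obtain ⟨⟨f₀, ⟨_, m, hm, rfl⟩⟩, h⟩ := IsLocalization.surj
    ((nonZeroDivisors B₀).map (MvPolynomial.C (σ := σ))) f
  refine ⟨m, nonZeroDivisors.ne_zero hm, f₀, ?_⟩
  rw [MvPolynomial.algebraMap_def] at h
  rw [mul_comm]
  simpa using h.symm

/-- The equation is weighted homogeneous: replacing `(u, r, c)` by `(m ^ 2 u, m r, m c)` multiplies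
it by `m ^ 3` for a constant `m`. This leaves room to clear all denominators. -/
theorem hasSolutionMod_of_model_solution {k B₀ B A : Type*} [Field k] [CommRing B₀] [IsDomain B₀]
    [CommRing B] [CommRing A] [IsDomain A] [Algebra B A] [Algebra B₀ k] [IsFractionRing B₀ k]
    (ι : B₀ →+* B) (D : Derivation B A A) (a b : A)
    (π : MvPolynomial σ B →ₐ[B] A)
    (d₀ : σ → MvPolynomial σ B₀)
    (hd₀ : ∀ i, π (MvPolynomial.map ι (d₀ i)) = D (π (MvPolynomial.X i)))
    (a₀ b₀ : MvPolynomial σ B₀) (ha₀ : π (MvPolynomial.map ι a₀) = a)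
    (hb₀ : π (MvPolynomial.map ι b₀) = b)
    (hι : Function.Injective ((algebraMap B A).comp ι))
    {I : Ideal (MvPolynomial σ k)}
    (h0 : ∀ f, π (MvPolynomial.map ι f) = 0 ↔ MvPolynomial.map (algebraMap B₀ k) f ∈ I)
    (v s : MvPolynomial σ k) (e : k) (hs : s ∉ I) (hve : v ∉ I ∨ e ≠ 0)
    (h : s * MvPolynomial.mkDerivation k (fun i => MvPolynomial.map (algebraMap B₀ k) (d₀ i)) v -
        v * MvPolynomial.mkDerivation k (fun i => MvPolynomial.map (algebraMap B₀ k) (d₀ i)) s +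
        MvPolynomial.map (algebraMap B₀ k) a₀ * v * s -
        MvPolynomial.C e * MvPolynomial.map (algebraMap B₀ k) b₀ * s ^ 2 ∈ I) :
    HasSolutionMod D a b ⊥ := by
  set α := algebraMap B₀ k with hα
  obtain ⟨m₁, hm₁, v₀, hv₀⟩ := exists_map_eq_C_mul (B₀ := B₀) v
  obtain ⟨m₂, hm₂, s₀, hs₀⟩ := exists_map_eq_C_mul (B₀ := B₀) s
  obtain ⟨⟨e₀, m₃, hm₃⟩, he₀⟩ := IsLocalization.surj (nonZeroDivisors B₀) e
  replace hm₃ := nonZeroDivisors.ne_zero hm₃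
  simp only [← hα] at he₀ hv₀ hs₀
  have hαi : Function.Injective α := IsFractionRing.injective B₀ k
  have hα0 : ∀ m : B₀, m ≠ 0 → α m ≠ 0 := fun m hm h0 => hm (hαi (h0.trans (map_zero _).symm))
  have hC : ∀ (m : k) (f : MvPolynomial σ k), m ≠ 0 → MvPolynomial.C m * f ∈ I → f ∈ I := by
    intro m f hm hf
    have := I.mul_mem_left (MvPolynomial.C m⁻¹) hf
    rwa [← mul_assoc, ← map_mul, inv_mul_cancel₀ hm, map_one, one_mul] at this
  have hπD : ∀ f, D (π (MvPolynomial.map ι f)) =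
      π (MvPolynomial.map ι (MvPolynomial.mkDerivation B₀ d₀ f)) := by
    intro f
    rw [← map_mkDerivation]
    exact derivation_comp_eq π.toRingHom (D : A →+ A) (fun x y => by simp)
      (fun c => by
        have : π (MvPolynomial.C c) = algebraMap B A c := π.commutes c
        simp [this]) _ (fun i => by simp [hd₀]) _
  -- The extra factors make the images exactly `m ^ 2 v`, `m s` and `m e` with `m = m₁ m₂ m₃`.
  let V : MvPolynomial σ B₀ := MvPolynomial.C (m₁ * m₂ ^ 2 * m₃ ^ 2) * v₀
  let W : MvPolynomial σ B₀ := MvPolynomial.C (m₁ * m₃) * s₀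
  let E : B₀ := m₁ * m₂ * e₀
  have hV : MvPolynomial.map α V = MvPolynomial.C (α (m₁ * m₂ * m₃) ^ 2) * v := by
    simp only [V, map_mul, MvPolynomial.map_C, hv₀, map_pow]; ring
  have hW : MvPolynomial.map α W = MvPolynomial.C (α (m₁ * m₂ * m₃)) * s := by
    simp only [W, map_mul, MvPolynomial.map_C, hs₀]; ring
  have hE : α E = α (m₁ * m₂ * m₃) * e := by
    simp only [E, map_mul, ← he₀]; ring
  have hm : α (m₁ * m₂ * m₃) ≠ 0 := hα0 _ (mul_ne_zero (mul_ne_zero hm₁ hm₂) hm₃)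
  refine ⟨π (MvPolynomial.map ι V), π (MvPolynomial.map ι W), algebraMap B A (ι E),
    by simp, fun h1 => ?_, ?_, ?_⟩
  · rw [Ideal.mem_bot, h0, hW] at h1
    exact hs (hC _ _ hm h1)
  · refine hve.imp (fun hv h1 => ?_) fun he h1 => ?_
    · rw [Ideal.mem_bot, h0, hV] at h1
      exact hv (hC _ _ (pow_ne_zero 2 hm) h1)
    · have h2 : E = 0 := hι (h1.trans (map_zero _).symm)
      rw [h2, map_zero] at hE
      exact (mul_ne_zero hm he) hE.symm
  · have hπC : π (MvPolynomial.map ι (MvPolynomial.C E)) = algebraMap B A (ι E) := by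
      rw [MvPolynomial.map_C]; exact π.commutes _
    rw [Ideal.mem_bot, hπD, hπD, ← ha₀, ← hb₀, ← hπC]
    simp only [← map_mul, ← map_sub, ← map_add, ← map_pow]
    rw [h0]
    simp only [map_mul, map_sub, map_add, map_pow, ← map_mkDerivation, MvPolynomial.map_C]
    rw [hV, hW, hE]
    simp only [← MvPolynomial.smul_eq_C_mul, Derivation.map_smul]
    have := I.mul_mem_left (MvPolynomial.C (α (m₁ * m₂ * m₃)) ^ 3) h
    convert this using 1
    simp only [MvPolynomial.smul_eq_C_mul, map_mul, map_pow]
    ring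

end Descent

/-! ### Spreading out from a very general fibre -/

section DescentMain

variable {σ : Type*}

theorem exists_countable_subring_of_finite {B : Type} [CommRing B] {P : Set (MvPolynomial σ B)}
    (hP : P.Finite) : ∃ B₀ : Subalgebra ℤ B, Countable B₀ ∧
      ∀ f ∈ P, ∃ f₀, MvPolynomial.map (algebraMap B₀ B) f₀ = f := by
  let G : Set B := ⋃ f ∈ P, (f.coeffs : Set B)
  have hG : G.Countable := (hP.biUnion fun f _ => f.coeffs.finite_toSet).countable
  refine ⟨Algebra.adjoin ℤ G, ?_, fun f hf => ?_⟩
  · rw [← Cardinal.mk_le_aleph0_iff]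
    exact (Algebra.cardinalMk_adjoin_le ℤ G).trans (by simp [hG])
  · refine MvPolynomial.mem_range_map_iff_coeffs_subset.2 fun x hx => ?_
    exact ⟨⟨x, Algebra.subset_adjoin (Set.mem_biUnion hf hx)⟩, rfl⟩

/-- A solution on one member of a family whose parameter avoids a countable set of functions
spreads out to the whole family. -/
theorem exists_countable_forall_hasSolutionMod {B A : Type} [CommRing B] [IsDomain B] [CommRing A]
    [IsDomain A] [Algebra B A] [Algebra.FinitePresentation B A]
    (hBA : Function.Injective (algebraMap B A)) (D : Derivation B A A) (a b : A) :
    ∃ S : Set B, S.Countable ∧ 0 ∉ S ∧ ∀ {M K : Type} [Field M] [IsAlgClosed M] [Field K]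
      [Algebra M K] (χ : B →+* M) (_ : Function.Surjective χ) (ψ : A →+* K)
      (_ : ∀ β, ψ (algebraMap B A β) = algebraMap M K (χ β))
      (_ : RingHom.ker ψ = (RingHom.ker χ).map (algebraMap B A)) (u r : A) (c : B),
      (∀ s ∈ S, χ s ≠ 0) → ψ r ≠ 0 → (ψ u ≠ 0 ∨ χ c ≠ 0) →
      ψ (r * D u - u * D r + a * u * r - algebraMap B A c * b * r ^ 2) = 0 →
      HasSolutionMod D a b ⊥ := by
  classical
  obtain ⟨n, π, hπ, Fs, hFs⟩ := Algebra.FinitePresentation.out (R := B) (A := A)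
  replace hFs : Ideal.span (Fs : Set (MvPolynomial (Fin n) B)) = RingHom.ker π := hFs
  choose d₁ hd₁ using fun i => hπ (D (π (MvPolynomial.X i)))
  obtain ⟨a₁, ha₁⟩ := hπ a
  obtain ⟨b₁, hb₁⟩ := hπ b
  have hπD : ∀ f, D (π f) = π (MvPolynomial.mkDerivation B d₁ f) :=
    derivation_comp_eq π.toRingHom (D : A →+ A) (fun x y => by simp)
      (fun c => by
        have : π (MvPolynomial.C c) = algebraMap B A c := π.commutes c
        simp [this]) _ (fun i => by simp [hd₁])
  -- The cofactors expressing stability of the relations under the derivation must also be defined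
  -- over `B₀`, so they are recorded and added to `P`.
  have hmem : ∀ F ∈ Fs, ∃ w : MvPolynomial (Fin n) B → MvPolynomial (Fin n) B,
      ∑ G ∈ Fs, w G * G = MvPolynomial.mkDerivation B d₁ F := by
    intro F hF
    have : MvPolynomial.mkDerivation B d₁ F ∈ Ideal.span (Fs : Set (MvPolynomial (Fin n) B)) := by
      rw [hFs, RingHom.mem_ker, ← hπD]
      have : F ∈ RingHom.ker π := hFs ▸ Ideal.subset_span hF
      rw [(RingHom.mem_ker).1 this, map_zero]
    obtain ⟨w, -, hw⟩ := Submodule.mem_span_finset.1 this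
    exact ⟨w, hw⟩
  choose! w hw using hmem
  let P : Set (MvPolynomial (Fin n) B) := ((Fs : Set (MvPolynomial (Fin n) B)) ∪ Set.range d₁ ∪
    ⋃ F ∈ Fs, w F '' Fs) ∪ {a₁, b₁}
  have hP : P.Finite := (((Fs.finite_toSet).union (Set.finite_range d₁)).union
    (Fs.finite_toSet.biUnion fun F _ => Fs.finite_toSet.image _)).union (Set.toFinite _)
  obtain ⟨B₀, hB₀, hlift⟩ := exists_countable_subring_of_finite hP
  set ι : B₀ →+* B := algebraMap B₀ B with hι
  have hιi : Function.Injective ι := Subtype.val_injective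
  have hmi := MvPolynomial.map_injective (σ := Fin n) ι hιi
  choose d₀ hd₀ using fun i => hlift (d₁ i) (Or.inl (Or.inl (Or.inr ⟨i, rfl⟩)))
  obtain ⟨a₀, ha₀⟩ := hlift a₁ (Or.inr (Or.inl rfl))
  obtain ⟨b₀, hb₀⟩ := hlift b₁ (Or.inr (Or.inr rfl))
  let S₀ : Set (MvPolynomial (Fin n) B₀) := MvPolynomial.map ι ⁻¹' Fs
  have hS₀ : MvPolynomial.map ι '' S₀ = Fs := Set.image_preimage_eq_iff.2 fun F hF =>
    hlift F (Or.inl (Or.inl (Or.inl hF)))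
  have hdS : ∀ F ∈ S₀, MvPolynomial.mkDerivation B₀ d₀ F ∈ Ideal.span S₀ := by
    intro F hF
    have h1 : ∀ G ∈ Fs, ∃ w₀ G₀ : MvPolynomial (Fin n) B₀, MvPolynomial.map ι w₀ =
        w (MvPolynomial.map ι F) G ∧ MvPolynomial.map ι G₀ = G := by
      intro G hG
      obtain ⟨w₀, hw₀⟩ := hlift (w (MvPolynomial.map ι F) G)
        (Or.inl (Or.inr (Set.mem_biUnion hF ⟨G, hG, rfl⟩)))
      obtain ⟨G₀, hG₀⟩ := hlift G (Or.inl (Or.inl (Or.inl hG)))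
      exact ⟨w₀, G₀, hw₀, hG₀⟩
    choose! w₀ G₀ hw₀ hG₀ using h1
    have h2 : MvPolynomial.mkDerivation B₀ d₀ F = ∑ G ∈ Fs, w₀ G * G₀ G := by
      apply hmi
      rw [map_sum, ← map_mkDerivation]
      simp only [hd₀]
      rw [← hw _ hF]
      refine Finset.sum_congr rfl fun G hG => ?_
      rw [map_mul, hw₀ G hG, hG₀ G hG]
    rw [h2]
    refine Ideal.sum_mem _ fun G hG => Ideal.mul_mem_left _ _ (Ideal.subset_span ?_)
    change MvPolynomial.map ι (G₀ G) ∈ (Fs : Set (MvPolynomial (Fin n) B))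
    rw [hG₀ G hG]
    exact hG
  -- Take for `S` all nonzero elements of `B₀`: avoiding them makes `χ` injective on `B₀`, so that
  -- `Frac B₀` embeds in `M`.
  refine ⟨ι '' {x | x ≠ 0}, (Set.to_countable _).image _, ?_, ?_⟩
  · rintro ⟨x, hx, hx0⟩
    exact hx (hιi (hx0.trans (map_zero _).symm))
  intro M K _ _ _ _ χ hχ ψ hψχ hψ u r c hS hr huc h
  let k := FractionRing B₀
  have hχι : Function.Injective (χ.comp ι) := by
    rw [injective_iff_map_eq_zero]
    intro x hx
    by_contra hx0
    exact hS _ ⟨x, hx0, rfl⟩ hx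
  let _ : Algebra k M := (IsFractionRing.lift (K := k) hχι).toAlgebra
  have hkM : ∀ x, algebraMap k M (algebraMap B₀ k x) = χ (ι x) := fun x =>
    IsFractionRing.lift_algebraMap hχι x
  let I : Ideal (MvPolynomial (Fin n) k) :=
    Ideal.span (MvPolynomial.map (algebraMap B₀ k) '' S₀)
  have hker : RingHom.ker π = Ideal.span (MvPolynomial.map ι '' S₀) := by rw [hS₀, hFs]
  have hd₀' : ∀ i, π (MvPolynomial.map ι (d₀ i)) = D (π (MvPolynomial.X i)) := fun i => by
    rw [hd₀, hd₁]
  obtain ⟨Q, _, _, mk, hmk, hmk0⟩ : ∃ (Q : Type) (_ : CommRing Q) (_ : Algebra k Q)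
      (mk : MvPolynomial (Fin n) k →ₐ[k] Q), Function.Surjective mk ∧ ∀ f, mk f = 0 ↔ f ∈ I :=
    ⟨MvPolynomial (Fin n) k ⧸ I, inferInstance, inferInstance, Ideal.Quotient.mkₐ k I,
      Ideal.Quotient.mkₐ_surjective k I, fun f => Ideal.Quotient.eq_zero_iff_mem⟩
  obtain ⟨v, s, e, hs, hve, hE⟩ := exists_model_solution ι (algebraMap B₀ k) D a b π hπ S₀ hker d₀
    hd₀' hdS a₀ b₀ (by rw [ha₀, ha₁]) (by rw [hb₀, hb₁]) χ hχ hkM ψ hψχ hψ u r c hr huc h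
    (I := I) rfl mk hmk hmk0 rfl
  exact hasSolutionMod_of_model_solution ι D a b π d₀ hd₀' a₀ b₀ (by rw [ha₀, ha₁])
    (by rw [hb₀, hb₁]) (hBA.comp hιi)
    (presentation_eq_zero_iff ι (hBA.comp hιi) π S₀ hker rfl mk hmk0) v s e hs hve hE

end DescentMain

/-! ### Coordinates and partial derivatives -/

section Coordinates

variable {k K : Type*} [CommRing k] [CommRing K] [Algebra k K] {x y : K} {P Q : Derivation k K K}

/-- `x, y` are coordinates of the algebra `K` over `k`, with partial derivatives `P, Q`. -/
structure IsCoordinates (x y : K) (P Q : Derivation k K K) : Prop where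
  px : P x = 1
  py : P y = 0
  qx : Q x = 0
  qy : Q y = 1
  d_eq : ∀ f, KaehlerDifferential.D k K f =
    P f • KaehlerDifferential.D k K x + Q f • KaehlerDifferential.D k K y

theorem IsCoordinates.derivation_apply (h : IsCoordinates x y P Q) (v : Derivation k K K) (f : K) :
    v f = P f * v x + Q f * v y := by
  have := congrArg v.liftKaehlerDifferential (h.d_eq f)
  simpa using this

theorem IsCoordinates.symm (h : IsCoordinates x y P Q) : IsCoordinates y x Q P :=
  ⟨h.qy, h.qx, h.py, h.px, fun f => by rw [h.d_eq, add_comm]⟩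

end Coordinates

/-! ### Transverse structures as linear differential equations -/

section SurfaceForms

variable {k K : Type*} [Field k] [Field K] [Algebra k K] {x y : K} {P Q : Derivation k K K}

local notation "𝐝" => KaehlerDifferential.D k K

namespace IsCoordinates

variable (h : IsCoordinates x y P Q)
include h

/-- The commutator is a derivation killing both coordinates, hence zero. -/
theorem comm (f : K) : P (Q f) = Q (P f) := by
  have := h.derivation_apply ⁅P, Q⁆ f
  simp only [Derivation.commutator_apply, h.px, h.py, h.qx, h.qy, map_zero,
    Derivation.map_one_eq_zero, sub_zero, mul_zero, add_zero] at this
  exact sub_eq_zero.1 this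

theorem exists_eq (ω : OneForm k K) : ∃ a b : K, ω = a • 𝐝 x + b • 𝐝 y := by
  have : ω ∈ Submodule.span K (Set.range 𝐝) := by
    rw [KaehlerDifferential.span_range_derivation]; trivial
  refine Submodule.span_induction ?_ ⟨0, 0, by simp⟩ ?_ ?_ this
  · rintro _ ⟨f, rfl⟩
    exact ⟨_, _, h.d_eq f⟩
  · rintro _ _ _ _ ⟨a, b, rfl⟩ ⟨a', b', rfl⟩
    exact ⟨a + a', b + b', by module⟩
  · rintro c _ _ ⟨a, b, rfl⟩
    exact ⟨c * a, c * b, by module⟩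

omit h in
theorem wedge_self (ω : OneForm k K) : wedge ω ω = 0 := by
  simp [wedge]

omit h in
theorem wedge_eq (a b a' b' : K) : wedge (a • 𝐝 x + b • 𝐝 y) (a' • 𝐝 x + b' • 𝐝 y) =
    (a * b' - b * a') • wedge (𝐝 x) (𝐝 y) := by
  have hyx : wedge (𝐝 y) (𝐝 x) = - wedge (𝐝 x) (𝐝 y) :=
    eq_neg_of_add_eq_zero_left (wedge_swap _ _)
  simp only [wedge_add_left, wedge_add_right, wedge_smul_left, wedge_smul_right, wedge_self, hyx]
  module

theorem d_eq_wedge (a b : K) : d (a • 𝐝 x + b • 𝐝 y) = (P b - Q a) • wedge (𝐝 x) (𝐝 y) := by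
  have e : ∀ f, 𝐝 f = P f • 𝐝 x + Q f • 𝐝 y := h.d_eq
  have e1 : wedge (𝐝 a) (𝐝 x) = - Q a • wedge (𝐝 x) (𝐝 y) := by
    have := wedge_eq (k := k) (x := x) (y := y) (P a) (Q a) 1 0
    simpa [← e] using this
  have e2 : wedge (𝐝 b) (𝐝 y) = P b • wedge (𝐝 x) (𝐝 y) := by
    have := wedge_eq (k := k) (x := x) (y := y) (P b) (Q b) 0 1
    simpa [← e] using this
  rw [map_add, d_smul_D, d_smul_D, e1, e2]
  module

/-- The determinant of the values of `P` and `Q` on two forms is alternating. Extended to the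
exterior algebra, it takes the value `1` on `dx ∧ dy`. -/
theorem smul_wedge_eq_zero {c : K} (hc : c • wedge (𝐝 x) (𝐝 y) = 0) : c = 0 := by
  let φ : OneForm k K →ₗ[K] (Fin 2 → K) :=
    LinearMap.pi ![P.liftKaehlerDifferential, Q.liftKaehlerDifferential]
  let det : OneForm k K [⋀^Fin 2]→ₗ[K] K :=
    (Matrix.detRowAlternating : (Fin 2 → K) [⋀^Fin 2]→ₗ[K] K).compLinearMap φ
  let T : Forms k K →ₗ[K] K := ExteriorAlgebra.liftAlternating (Pi.single 2 det)
  have hT : T (wedge (𝐝 x) (𝐝 y)) = 1 := by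
    have e : wedge (𝐝 x) (𝐝 y) = ExteriorAlgebra.ιMulti K 2 ![𝐝 x, 𝐝 y] := by
      simp [wedge, ExteriorAlgebra.ιMulti_apply]
    rw [e]
    simp only [T, ExteriorAlgebra.liftAlternating_apply_ιMulti, Pi.single_eq_same, det,
      AlternatingMap.compLinearMap_apply]
    change Matrix.det (Matrix.of fun i => φ (![𝐝 x, 𝐝 y] i)) = 1
    rw [Matrix.det_fin_two]
    simp [φ, h.px, h.py, h.qx, h.qy]
  have := congrArg T hc
  simpa [hT] using this

theorem smul_wedge_inj {c c' : K} :
    c • wedge (𝐝 x) (𝐝 y) = c' • wedge (𝐝 x) (𝐝 y) ↔ c = c' := by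
  refine ⟨fun e => sub_eq_zero.1 (h.smul_wedge_eq_zero ?_), fun e => by rw [e]⟩
  rw [sub_smul, e, sub_self]

theorem affine_system {a b m n : K} : (d (a • 𝐝 x + b • 𝐝 y) =
      wedge (a • 𝐝 x + b • 𝐝 y) (m • 𝐝 x + n • 𝐝 y) ∧ d (m • 𝐝 x + n • 𝐝 y) = 0) ↔
    P b - Q a = a * n - b * m ∧ P n = Q m := by
  rw [h.d_eq_wedge, h.d_eq_wedge, wedge_eq, h.smul_wedge_inj]
  refine and_congr_right fun _ => ⟨fun e => sub_eq_zero.1 (h.smul_wedge_eq_zero e), fun e => ?_⟩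
  rw [e, sub_self, zero_smul]

theorem projective_system {a b m n e f : K} : (d (a • 𝐝 x + b • 𝐝 y) =
      wedge (a • 𝐝 x + b • 𝐝 y) (m • 𝐝 x + n • 𝐝 y) ∧
      d (m • 𝐝 x + n • 𝐝 y) = 2 * wedge (a • 𝐝 x + b • 𝐝 y) (e • 𝐝 x + f • 𝐝 y) ∧
      d (e • 𝐝 x + f • 𝐝 y) = wedge (m • 𝐝 x + n • 𝐝 y) (e • 𝐝 x + f • 𝐝 y)) ↔
    P b - Q a = a * n - b * m ∧ P n - Q m = 2 * (a * f - b * e) ∧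
      P f - Q e = m * f - n * e := by
  have h2 : (2 : Forms k K) = algebraMap K _ 2 := (map_ofNat _ 2).symm
  rw [h.d_eq_wedge, h.d_eq_wedge, h.d_eq_wedge, wedge_eq, wedge_eq, wedge_eq, h2,
    ← Algebra.smul_def, smul_smul]
  simp only [h.smul_wedge_inj]

variable {L : Submodule K (Derivation k K K)} {q : K}

theorem defines_iff (hδ : P + q • Q ∈ L) (hL : ∀ v ∈ L, v y = q * v x) (ω : OneForm k K) :
    Defines L ω ↔ ∃ b : K, b ≠ 0 ∧ ω = (-(b * q)) • 𝐝 x + b • 𝐝 y := by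
  constructor
  · rintro ⟨h0, hv⟩
    obtain ⟨a, b, rfl⟩ := h.exists_eq ω
    have := hv _ hδ
    simp [h.px, h.py, h.qx, h.qy] at this
    obtain rfl : a = -(b * q) := by linear_combination this
    refine ⟨b, ?_, rfl⟩
    rintro rfl
    simp at h0
  · rintro ⟨b, hb, rfl⟩
    refine ⟨fun h0 => hb ?_, fun v hv => ?_⟩
    · have := congrArg Q.liftKaehlerDifferential h0
      simpa [h.qx, h.qy] using this
    · simp [hL v hv]
      ring

/-- For `ω₀ = dy - q dx` and `ω₁ = m dx + n dy`, the first equation gives `m = -Q q - q n`, and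
closedness of `ω₁` becomes the equation for `n`. A nonzero homogeneous solution `g` makes `g ω₀`
closed, so `ω₁ = dg / g` works. Passing from `ω₀` to `b ω₀` subtracts `db / b` from `ω₁`. -/
theorem transverselyAffine_iff (hδ : P + q • Q ∈ L) (hL : ∀ v ∈ L, v y = q * v x) :
    TransverselyAffine L ↔ SolvableODE (P + q • Q) (Q q) (-Q (Q q)) := by
  constructor
  · intro hT
    obtain ⟨ω₁, hω⟩ := hT _ ((h.defines_iff hδ hL _).2 ⟨1, one_ne_zero, rfl⟩)
    obtain ⟨m, n, rfl⟩ := h.exists_eq ω₁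
    rw [h.affine_system] at hω
    obtain ⟨e1, e2⟩ := hω
    simp only [one_mul, map_neg, Derivation.map_one_eq_zero] at e1
    obtain rfl : m = -Q q - q * n := by linear_combination e1
    refine Or.inl ⟨n, ?_⟩
    simp only [map_sub, map_neg, Derivation.leibniz, smul_eq_mul] at e2
    simp only [Derivation.add_apply, Derivation.smul_apply, smul_eq_mul]
    linear_combination e2
  · intro hS ω₀ hω₀
    obtain ⟨b, hb, rfl⟩ := (h.defines_iff hδ hL _).1 hω₀
    have hPQ := h.comm b
    rcases hS with ⟨g, hg⟩ | ⟨g, hg0, hg⟩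
    · refine ⟨(-Q q - q * g - P b / b) • 𝐝 x + (g - Q b / b) • 𝐝 y, h.affine_system.2 ⟨?_, ?_⟩⟩
      · simp only [map_neg, Derivation.leibniz, smul_eq_mul]
        field_simp
        ring
      · simp only [Derivation.add_apply, Derivation.smul_apply, smul_eq_mul] at hg
        simp only [map_sub, map_neg, Derivation.leibniz, smul_eq_mul, Derivation.leibniz_div, hPQ]
        linear_combination hg
    · have hPQg := h.comm g
      refine ⟨(P g / g - P b / b) • 𝐝 x + (Q g / g - Q b / b) • 𝐝 y,
        h.affine_system.2 ⟨?_, ?_⟩⟩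
      · simp only [Derivation.add_apply, Derivation.smul_apply, smul_eq_mul] at hg
        simp only [map_neg, Derivation.leibniz, smul_eq_mul]
        field_simp
        linear_combination b * hg
      · simp only [map_sub, Derivation.leibniz_div, hPQ, hPQg, smul_eq_mul]
        ring

/-- The first two equations determine the `dx`-coefficients of `ω₁` and `ω₂`, and the third becomes
the linear equation once the freedom in `n` is removed. A nonzero homogeneous solution `g` gives `ω₁
= dg / (2 g)` and `ω₂ = 0`. For `b ω₀`, subtract `db / b` from `ω₁` and divide `ω₂` by `b`. -/
theorem transverselyProjective_iff [CharZero K] (hδ : P + q • Q ∈ L)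
    (hL : ∀ v ∈ L, v y = q * v x) :
    TransverselyProjective L ↔
      SolvableODE (P + q • Q) (2 * Q q) (-(2⁻¹ * Q (Q (Q q)))) := by
  have hQ2 : Q 2 = 0 := by
    have : (2 : K) = algebraMap k K 2 := (map_ofNat _ 2).symm
    rw [this, Derivation.map_algebraMap]
  have hP2 : P 2 = 0 := by
    have : (2 : K) = algebraMap k K 2 := (map_ofNat _ 2).symm
    rw [this, Derivation.map_algebraMap]
  constructor
  · intro hT
    obtain ⟨ω₁, ω₂, hω⟩ := hT _ ((h.defines_iff hδ hL _).2 ⟨1, one_ne_zero, rfl⟩)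
    obtain ⟨m, n, rfl⟩ := h.exists_eq ω₁
    obtain ⟨e, f, rfl⟩ := h.exists_eq ω₂
    rw [h.projective_system] at hω
    obtain ⟨e1, e2, e3⟩ := hω
    simp only [one_mul, map_neg, Derivation.map_one_eq_zero] at e1 e2
    obtain rfl : m = -Q q - q * n := by linear_combination e1
    have hnc := h.comm n
    simp only [map_sub, map_neg, Derivation.leibniz, smul_eq_mul] at e2
    obtain rfl : e = -(q * f) - 2⁻¹ * (P n + q * Q n + Q (Q q) + Q q * n) := by
      field_simp
      linear_combination e2
    -- This is what `f` becomes when a multiple of `ω₀` is added to `ω₁` to make `n = 0`, with `ω₂`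
    -- changed accordingly; the nonlinear terms in `n` cancel.
    refine Or.inl ⟨f + 2⁻¹ * Q n - 2⁻¹ * 2⁻¹ * n ^ 2, ?_⟩
    simp only [map_sub, map_neg, map_add, Derivation.leibniz, smul_eq_mul,
      Derivation.leibniz_inv, hQ2] at e3
    simp only [Derivation.add_apply, Derivation.smul_apply, smul_eq_mul, map_sub, map_add,
      Derivation.leibniz, Derivation.leibniz_pow, Derivation.leibniz_inv, hQ2, hP2, hnc]
    field_simp at e3 ⊢
    simp only [nsmul_eq_mul, Nat.cast_ofNat] at e3 ⊢
    ring_nf at e3 ⊢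
    linear_combination 2 * e3
  · intro hS ω₀ hω₀
    obtain ⟨b, hb, rfl⟩ := (h.defines_iff hδ hL _).1 hω₀
    have hPQ := h.comm b
    rcases hS with ⟨g, hg⟩ | ⟨g, hg0, hg⟩
    · have hPQq := h.comm q
      -- For `b = 1` this is the structure normalized by `n = 0` and `f = g`.
      refine ⟨(-Q q - P b / b) • 𝐝 x + (-(Q b / b)) • 𝐝 y,
        ((-(q * g) - 2⁻¹ * Q (Q q)) / b) • 𝐝 x + (g / b) • 𝐝 y,
        h.projective_system.2 ⟨?_, ?_, ?_⟩⟩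
      · simp only [map_neg, Derivation.leibniz, smul_eq_mul]
        field_simp
        ring
      · simp only [map_sub, map_neg, smul_eq_mul, Derivation.leibniz_div, hPQ]
        field_simp
        ring
      · simp only [Derivation.add_apply, Derivation.smul_apply, smul_eq_mul] at hg
        simp only [map_sub, map_neg, Derivation.leibniz, smul_eq_mul, Derivation.leibniz_div,
          Derivation.leibniz_inv, hQ2]
        field_simp at hg ⊢
        linear_combination 2 * b * hg
    · have hPQg := h.comm g
      refine ⟨(P g / (2 * g) - P b / b) • 𝐝 x + (Q g / (2 * g) - Q b / b) • 𝐝 y,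
        (0 : K) • 𝐝 x + (0 : K) • 𝐝 y, h.projective_system.2 ⟨?_, ?_, ?_⟩⟩
      · simp only [Derivation.add_apply, Derivation.smul_apply, smul_eq_mul] at hg
        simp only [map_neg, Derivation.leibniz, smul_eq_mul]
        field_simp
        linear_combination b * hg
      · simp only [map_sub, Derivation.leibniz_div, Derivation.leibniz, hPQ, hPQg, smul_eq_mul,
          hP2, hQ2]
        ring
      · simp

end IsCoordinates

end SurfaceForms

/-! ### Restriction of coordinates and derivations to a member -/

section Members

/-- The expansion of `da` holds in the relative differentials of `A`, so it maps to one for `d (ψ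
a)`; Leibniz then extends it to fractions. -/
theorem IsCoordinates.map {B A k K : Type*} [CommRing B] [CommRing A] [CommRing k] [CommRing K]
    [Algebra B A] [Algebra k K] {x y : A} {P Q : Derivation B A A} (h : IsCoordinates x y P Q)
    (ρ : B →+* k) (ψ : A →+* K) (hψ : ∀ b, ψ (algebraMap B A b) = algebraMap k K (ρ b))
    (hfrac : ∀ z : K, ∃ a s, IsUnit (ψ s) ∧ z * ψ s = ψ a) {P' Q' : Derivation k K K}
    (hP : ∀ a, P' (ψ a) = ψ (P a)) (hQ : ∀ a, Q' (ψ a) = ψ (Q a)) :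
    IsCoordinates (ψ x) (ψ y) P' Q' := by
  refine ⟨by rw [hP, h.px, map_one], by rw [hP, h.py, map_zero], by rw [hQ, h.qx, map_zero],
    by rw [hQ, h.qy, map_one], ?_⟩
  have key : ∀ a : A, KaehlerDifferential.D k K (ψ a) =
      P' (ψ a) • KaehlerDifferential.D k K (ψ x) + Q' (ψ a) • KaehlerDifferential.D k K (ψ y) := by
    intro a
    let _ : Module A (KaehlerDifferential k K) := Module.compHom _ ψ
    let _ : Module B (KaehlerDifferential k K) := Module.compHom _ (algebraMap B A)
    have : IsScalarTower B A (KaehlerDifferential k K) := ⟨fun b a w => by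
      rw [Algebra.smul_def, mul_smul]; rfl⟩
    have hsm : ∀ (a : A) (w : KaehlerDifferential k K), a • w = ψ a • w := fun _ _ => rfl
    have hsmB : ∀ (b : B) (w : KaehlerDifferential k K), b • w = ρ b • w := fun b w => by
      rw [← algebraMap_smul K (ρ b) w, ← hψ]; rfl
    -- `B` acts through the constants `k`, so `a ↦ d (ψ a)` is `B`-linear and factors through the
    -- relative differentials.
    let E : Derivation B A (KaehlerDifferential k K) :=
      { toFun := fun a => KaehlerDifferential.D k K (ψ a)
        map_add' := fun a b => by simp
        map_smul' := fun b a => by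
          rw [RingHom.id_apply, hsmB, Algebra.smul_def, map_mul, hψ, ← Algebra.smul_def,
            Derivation.map_smul]
        map_one_eq_zero' := by simp
        leibniz' := fun a b => by simp [hsm] }
    have := congrArg E.liftKaehlerDifferential (h.d_eq a)
    simp only [Derivation.liftKaehlerDifferential_comp_D, map_add, map_smul] at this
    rw [hP, hQ]
    exact this
  intro z
  obtain ⟨a, s, hs, hz⟩ := hfrac z
  have e1 := key a
  rw [← hz] at e1
  simp only [Derivation.leibniz, smul_eq_mul, key s] at e1
  rw [← hs.smul_left_cancel]
  have e2 : ψ s • KaehlerDifferential.D k K z =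
      (z • (P' (ψ s) • KaehlerDifferential.D k K (ψ x) + Q' (ψ s) • KaehlerDifferential.D k K (ψ y))
        + ψ s • KaehlerDifferential.D k K z) -
      z • (P' (ψ s) • KaehlerDifferential.D k K (ψ x) +
        Q' (ψ s) • KaehlerDifferential.D k K (ψ y)) := by abel
  rw [e2, e1]
  module

variable {B A K : Type*} [CommRing B] [CommRing A] [Field K] [Algebra B A] [Algebra ℂ B]
  [Algebra ℂ K]

/-- `L` is the restriction of the foliation defined by `D` on the total space of a family, given by
its rational vector fields, to the fibre over `χ`, whose function field is `K`. -/
structure IsMember (χ : B →ₐ[ℂ] ℂ) (ψ : A →+* K) (D : Derivation B A A)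
    (L : Submodule K (Derivation ℂ K K)) : Prop where
  comm : ∀ β, ψ (algebraMap B A β) = algebraMap ℂ K (χ β)
  ker : RingHom.ker ψ = (RingHom.ker χ).map (algebraMap B A)
  frac : ∀ z : K, ∃ a s, ψ s ≠ 0 ∧ z * ψ s = ψ a
  mem : ∀ δ : Derivation ℂ K K, (∀ a, δ (ψ a) = ψ (D a)) → δ ∈ L
  tangent : ∀ v ∈ L, ∃ c, ∀ a, v (ψ a) = c * ψ (D a)

namespace IsMember

variable {χ : B →ₐ[ℂ] ℂ} {ψ : A →+* K} {D : Derivation B A A} {L : Submodule K (Derivation ℂ K K)}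

theorem unit_smul (h : IsMember χ ψ D L) {u : A} (hu : IsUnit u) : IsMember χ ψ (u • D) L where
  comm := h.comm
  ker := h.ker
  frac := h.frac
  mem δ hδ := by
    have hu' : ψ u ≠ 0 := (hu.map ψ).ne_zero
    have : (ψ u)⁻¹ • δ ∈ L := h.mem _ fun a => by
      rw [Derivation.smul_apply, hδ, Derivation.smul_apply, smul_eq_mul, smul_eq_mul, map_mul,
        inv_mul_cancel_left₀ hu']
    have := L.smul_mem (ψ u) this
    rwa [smul_smul, mul_inv_cancel₀ hu', one_smul] at this
  tangent v hv := by
    have hu' : ψ u ≠ 0 := (hu.map ψ).ne_zero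
    obtain ⟨c, hc⟩ := h.tangent v hv
    refine ⟨c * (ψ u)⁻¹, fun a => ?_⟩
    rw [hc, Derivation.smul_apply, smul_eq_mul, map_mul]
    field_simp

/-- The kernel of `ψ` is generated by elements of `B`, which `E` kills, so `E` descends to the image
of `ψ` and extends to its fraction field `K`. -/
theorem exists_derivation (h : IsMember χ ψ D L) (E : Derivation B A A) :
    ∃ E' : Derivation ℂ K K, ∀ a, E' (ψ a) = ψ (E a) := by
  let _ : Algebra ℂ A := ((algebraMap B A).comp (algebraMap ℂ B)).toAlgebra
  have : IsScalarTower ℂ B A := .of_algebraMap_eq fun _ => rfl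
  let ψ' : A →ₐ[ℂ] K := { ψ with
    commutes' := fun c => by
      change ψ (algebraMap B A (algebraMap ℂ B c)) = _
      rw [h.comm, AlgHom.commutes]; rfl }
  have hfr : IsFractionRing ψ'.range K := IsFractionRing.of_field _ _ fun z => by
    obtain ⟨a, s, hs, hz⟩ := h.frac z
    exact ⟨⟨ψ' a, a, rfl⟩, ⟨ψ' s, s, rfl⟩, (eq_div_iff hs).2 hz⟩
  have hker : ∀ a, ψ a = 0 → ψ (E a) = 0 := by
    intro a ha
    rw [← RingHom.mem_ker, h.ker] at ha
    refine Submodule.span_induction ?_ (by simp) ?_ ?_ ha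
    · rintro _ ⟨b, hb, rfl⟩
      simp
    · intro a b _ _ ha hb
      rw [map_add, map_add, ha, hb, add_zero]
    · intro c a ha ha'
      have ha0 : ψ a = 0 := by
        rw [← RingHom.mem_ker, h.ker]; exact ha
      rw [smul_eq_mul, Derivation.leibniz, smul_eq_mul, smul_eq_mul, map_add, map_mul, map_mul,
        ha', ha0]
      ring
  let E₁ : Derivation ℂ A A := E.restrictScalars ℂ
  have hsurj : Function.Surjective ψ'.rangeRestrict := ψ'.rangeRestrict_surjective
  have hker' : ∀ a, ψ'.rangeRestrict a = 0 → ψ'.rangeRestrict (E₁ a) = 0 := fun a ha =>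
    Subtype.ext (hker a (congrArg Subtype.val ha))
  let E₂ : Derivation ℂ ψ'.range ψ'.range := Derivation.liftOfSurjective hsurj hker'
  have hE₂ : ∀ a, E₂ (ψ'.rangeRestrict a) = ψ'.rangeRestrict (E₁ a) := fun a =>
    Derivation.liftOfSurjective_apply hsurj hker' a
  obtain ⟨E', hE'⟩ := exists_derivation_extending (nonZeroDivisors ψ'.range) (S := K)
    ((Algebra.linearMap ψ'.range K).compDer E₂)
  refine ⟨E', fun a => ?_⟩
  have := hE' (ψ'.rangeRestrict a)
  exact this.trans (congrArg Subtype.val (hE₂ a))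

end IsMember

end Members

/-! ### Transverse structures on a member in terms of the chart -/

section Spread

variable {B A K : Type*} [CommRing B] [CommRing A] [Field K] [Algebra B A] [Algebra ℂ B]
  [Algebra ℂ K] {χ : B →ₐ[ℂ] ℂ} {ψ : A →+* K} {D : Derivation B A A}
  {L : Submodule K (Derivation ℂ K K)}

/-- The coefficient of the equation for transversely affine structures is `Q (D y)`, the one for
transversely projective structures is its double. -/
theorem IsMember.transverse_iff [Algebra ℂ A] [IsScalarTower ℂ B A] (hm : IsMember χ ψ D L)
    {x y : A} {P Q : Derivation B A A} (h : IsCoordinates x y P Q) (hD : D x = 1) :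
    ∃ δ : Derivation ℂ K K, (∀ a, δ (ψ a) = ψ (D a)) ∧
      (TransverselyAffine L ↔ SolvableODE δ (ψ (Q (D y))) (ψ (-Q (Q (D y))))) ∧
      (TransverselyProjective L ↔ SolvableODE δ (ψ (2 * Q (D y)))
        (ψ (-(algebraMap ℂ A 2⁻¹ * Q (Q (Q (D y))))))) := by
  have : CharZero K := charZero_of_injective_algebraMap (algebraMap ℂ K).injective
  obtain ⟨P', hP⟩ := hm.exists_derivation P
  obtain ⟨Q', hQ⟩ := hm.exists_derivation Q
  have hc : IsCoordinates (ψ x) (ψ y) P' Q' := h.map χ.toRingHom ψ hm.comm (fun z => by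
    obtain ⟨a, s, hs, hz⟩ := hm.frac z
    exact ⟨a, s, hs.isUnit, hz⟩) hP hQ
  have hδ : ∀ a, (P' + ψ (D y) • Q') (ψ a) = ψ (D a) := fun a => by
    rw [h.derivation_apply D a, hD]
    simp only [Derivation.add_apply, Derivation.smul_apply, hP, hQ, smul_eq_mul, map_add, map_mul,
      map_one]
    ring
  have hL : ∀ v ∈ L, v (ψ y) = ψ (D y) * v (ψ x) := fun v hv => by
    obtain ⟨c, hc⟩ := hm.tangent v hv
    rw [hc, hc, hD, map_one]
    ring
  have h2 : ψ (algebraMap ℂ A 2⁻¹) = 2⁻¹ := by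
    rw [IsScalarTower.algebraMap_apply ℂ B A, hm.comm, AlgHom.commutes]
    simp only [Algebra.algebraMap_self, RingHom.id_apply, map_inv₀]
    exact congrArg _ (map_ofNat _ 2)
  refine ⟨P' + ψ (D y) • Q', hδ, ?_, ?_⟩
  · rw [hc.transverselyAffine_iff (hm.mem _ hδ) hL]
    simp only [hQ, map_neg]
  · rw [hc.transverselyProjective_iff (hm.mem _ hδ) hL]
    simp only [hQ, map_neg, map_mul, h2, map_ofNat]

/-- Write `g` as a quotient of restrictions of functions on the chart. The constant is `1` for the
full equation and `0` for the homogeneous one. -/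
theorem SolvableODE.exists_quotients {δ : Derivation ℂ K K} (hm : IsMember χ ψ D L)
    (hδ : ∀ a, δ (ψ a) = ψ (D a)) {a b : A} (h : SolvableODE δ (ψ a) (ψ b)) :
    ∃ (u r : A) (c : B), ψ r ≠ 0 ∧ (ψ u ≠ 0 ∨ χ c ≠ 0) ∧
      ψ (r * D u - u * D r + a * u * r - algebraMap B A c * b * r ^ 2) = 0 := by
  have key : ∀ g : K, ∃ u r : A, ψ r ≠ 0 ∧ g = ψ u / ψ r ∧
      ψ r ^ 2 * δ g = ψ (r * D u - u * D r) := by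
    intro g
    obtain ⟨u, r, hr, hg⟩ := hm.frac g
    refine ⟨u, r, hr, (eq_div_iff hr).2 hg, ?_⟩
    obtain rfl := (eq_div_iff hr).2 hg
    simp only [Derivation.leibniz_div, hδ, smul_eq_mul, map_sub, map_mul]
    field_simp
  rcases h with ⟨g, hg⟩ | ⟨g, hg0, hg⟩
  · obtain ⟨u, r, hr, hgu, hgr⟩ := key g
    refine ⟨u, r, 1, hr, Or.inr (by simp), ?_⟩
    rw [map_sub, map_add, ← hgr, map_one, one_mul, map_mul, map_mul, map_mul, map_pow, ← hg]
    have : ψ u = g * ψ r := by rw [hgu]; field_simp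
    rw [this]
    ring
  · obtain ⟨u, r, hr, hgu, hgr⟩ := key g
    have hu : ψ u = g * ψ r := by rw [hgu]; field_simp
    refine ⟨u, r, 0, hr, Or.inl (by rw [hu]; exact mul_ne_zero hg0 hr), ?_⟩
    rw [map_sub, map_add, ← hgr, map_zero, zero_mul, zero_mul, map_zero, sub_zero, map_mul, map_mul,
      hu]
    linear_combination ψ r ^ 2 * hg

end Spread

/-! ### Transfer of transverse structures between members -/

section SpreadMain

/-- In a local chart of a family of foliations, the existence of a transverse structure on one
sufficiently general member implies the existence on all members. -/
theorem exists_countable_forall_transverse {B A : Type} [CommRing B] [IsDomain B] [Algebra ℂ B]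
    [Algebra.Smooth ℂ B] [CommRing A] [IsDomain A] [Algebra B A]
    [Algebra.FinitePresentation B A] [Module.Flat B A]
    (hBA : Function.Injective (algebraMap B A)) {x y : A} {P Q : Derivation B A A}
    (h : IsCoordinates x y P Q) (D : Derivation B A A) (hD : IsUnit (D x)) :
    ∃ S : Set B, S.Countable ∧ 0 ∉ S ∧ ∀ {K₁ K₂ : Type} [Field K₁] [Algebra ℂ K₁] [Field K₂]
      [Algebra ℂ K₂] {χ₁ χ₂ : B →ₐ[ℂ] ℂ} {ψ₁ : A →+* K₁} {ψ₂ : A →+* K₂}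
      {L₁ : Submodule K₁ (Derivation ℂ K₁ K₁)} {L₂ : Submodule K₂ (Derivation ℂ K₂ K₂)}
      (_ : IsMember χ₁ ψ₁ D L₁) (_ : IsMember χ₂ ψ₂ D L₂), (∀ s ∈ S, χ₁ s ≠ 0) →
      (TransverselyAffine L₁ → TransverselyAffine L₂) ∧
      (TransverselyProjective L₁ → TransverselyProjective L₂) := by
  let _ : Algebra ℂ A := ((algebraMap B A).comp (algebraMap ℂ B)).toAlgebra
  have : IsScalarTower ℂ B A := .of_algebraMap_eq fun _ => rfl
  have : Algebra.FiniteType ℂ A := Algebra.FiniteType.trans (S := B) inferInstance inferInstance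
  have : IsNoetherianRing A := Algebra.FiniteType.isNoetherianRing ℂ A
  obtain ⟨u, hu⟩ := hD
  -- Normalize to `D' x = 1`; a unit factor does not change the members.
  let D' : Derivation B A A := (↑u⁻¹ : A) • D
  have hD' : D' x = 1 := by
    simp [D', ← hu]
  obtain ⟨S, hSc, hS0, hS⟩ := exists_countable_forall_hasSolutionMod hBA D' (Q (D' y))
    (-Q (Q (D' y)))
  obtain ⟨S', hSc', hS0', hS'⟩ := exists_countable_forall_hasSolutionMod hBA D' (2 * Q (D' y))
    (-(algebraMap ℂ A 2⁻¹ * Q (Q (Q (D' y)))))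
  refine ⟨S ∪ S', hSc.union hSc', fun h0 => h0.elim hS0 hS0', ?_⟩
  intro K₁ K₂ _ _ _ _ χ₁ χ₂ ψ₁ ψ₂ L₁ L₂ h₁ h₂ hχ
  replace h₁ : IsMember χ₁ ψ₁ D' L₁ := h₁.unit_smul u⁻¹.isUnit
  replace h₂ : IsMember χ₂ ψ₂ D' L₂ := h₂.unit_smul u⁻¹.isUnit
  obtain ⟨δ₁, hδ₁, ha₁, hp₁⟩ := h₁.transverse_iff h hD'
  obtain ⟨δ₂, hδ₂, ha₂, hp₂⟩ := h₂.transverse_iff h hD'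
  have hsurj : Function.Surjective χ₁.toRingHom := fun z => ⟨algebraMap ℂ B z, χ₁.commutes z⟩
  rw [ha₁, ha₂, hp₁, hp₂]
  constructor
  · intro hsol
    obtain ⟨u, r, c, hr, huc, hE⟩ := hsol.exists_quotients h₁ hδ₁
    -- Spread the solution from the fibre over `χ₁` to the chart, then specialize it to the fibre
    -- over `χ₂`.
    exact (hS χ₁.toRingHom hsurj ψ₁ h₁.comm h₁.ker u r c (fun s hs => hχ s (Or.inl hs)) hr huc
      hE).specialize χ₂ ψ₂ h₂.ker hδ₂
  · intro hsol
    obtain ⟨u, r, c, hr, huc, hE⟩ := hsol.exists_quotients h₁ hδ₁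
    exact (hS' χ₁.toRingHom hsurj ψ₁ h₁.comm h₁.ker u r c (fun s hs => hχ s (Or.inr hs)) hr huc
      hE).specialize χ₂ ψ₂ h₂.ker hδ₂

end SpreadMain

/-! ### Algebra of charts and closed fibres -/

section ChartAlgebra

theorem IsCoordinates.exists_localization {B A S : Type*} [CommRing B] [CommRing A] [CommRing S]
    [Algebra B A] [Algebra A S] [Algebra B S] [IsScalarTower B A S] (M : Submonoid A)
    [IsLocalization M S] {x y : A} {P Q : Derivation B A A} (h : IsCoordinates x y P Q) :
    ∃ P' Q' : Derivation B S S, IsCoordinates (algebraMap A S x) (algebraMap A S y) P' Q' := by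
  obtain ⟨P', hP⟩ := exists_derivation_extending M (S := S) ((Algebra.linearMap A S).compDer P)
  obtain ⟨Q', hQ⟩ := exists_derivation_extending M (S := S) ((Algebra.linearMap A S).compDer Q)
  refine ⟨P', Q', h.map (RingHom.id B) (algebraMap A S)
    (fun b => (IsScalarTower.algebraMap_apply B A S b).symm) (fun z => ?_) hP hQ⟩
  obtain ⟨⟨a, s⟩, hz⟩ := IsLocalization.surj M z
  exact ⟨a, s, IsLocalization.map_units S s, hz⟩

/-- Standard smoothness gives a basis of the differentials made of exact ones, with two elements by
the relative dimension; `P` and `Q` are the dual coordinates. -/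
theorem exists_isCoordinates {B A : Type*} [CommRing B] [CommRing A] [Nontrivial A] [Algebra B A]
    [Algebra.IsStandardSmoothOfRelativeDimension 2 B A] :
    ∃ (x y : A) (P Q : Derivation B A A), IsCoordinates x y P Q := by
  have : Algebra.IsStandardSmooth B A :=
    Algebra.IsStandardSmoothOfRelativeDimension.isStandardSmooth 2
  obtain ⟨-, J, b, hb⟩ := Algebra.IsStandardSmooth.iff_exists_basis_kaehlerDifferential.1 this
  have hrank := Algebra.IsStandardSmoothOfRelativeDimension.rank_kaehlerDifferential
    (R := B) (S := A) 2
  have hJ : Cardinal.mk J = 2 := by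
    have := b.mk_eq_rank
    rw [hrank] at this
    simpa using this
  obtain ⟨i, j, hij, huniv⟩ := Cardinal.mk_eq_two_iff.1 hJ
  obtain ⟨x, hx⟩ := hb ⟨i, rfl⟩
  obtain ⟨y, hy⟩ := hb ⟨j, rfl⟩
  refine ⟨x, y, (b.coord i).compDer (KaehlerDifferential.D B A),
    (b.coord j).compDer (KaehlerDifferential.D B A), ⟨?_, ?_, ?_, ?_, fun f => ?_⟩⟩
  · simp [hx]
  · simp [hy, hij.symm]
  · simp [hx, hij]
  · simp [hy]
  · classical
    have hfin : Fintype J := ⟨{i, j}, fun k => by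
      have : k ∈ ({i, j} : Set J) := huniv ▸ Set.mem_univ k
      simpa using this⟩
    have hu : (Finset.univ : Finset J) = {i, j} := by
      ext k
      have : k ∈ ({i, j} : Set J) := huniv ▸ Set.mem_univ k
      simpa using this
    have := b.sum_repr (KaehlerDifferential.D B A f)
    rw [hu, Finset.sum_pair hij] at this
    rw [hx, hy]
    exact this.symm

/-- With `k` a quotient of `B`, the pushout is the quotient of `A` by the extended ideal. -/
theorem ker_of_isPushout {B A k P : CommRingCat} {f : B ⟶ A} {g : B ⟶ k} {i : A ⟶ P} {j : k ⟶ P}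
    (h : IsPushout f g i j) (hg : Function.Surjective g.hom) :
    RingHom.ker i.hom = (RingHom.ker g.hom).map f.hom := by
  apply le_antisymm
  · let J := (RingHom.ker g.hom).map f.hom
    let q : A ⟶ CommRingCat.of (A ⧸ J) := CommRingCat.ofHom (Ideal.Quotient.mk J)
    have hq : RingHom.ker g.hom ≤ RingHom.ker (q.hom.comp f.hom) := by
      intro b hb
      exact Ideal.Quotient.eq_zero_iff_mem.2 (Ideal.mem_map_of_mem _ hb)
    let l : k ⟶ CommRingCat.of (A ⧸ J) :=
      CommRingCat.ofHom (RingHom.liftOfSurjective g.hom hg ⟨q.hom.comp f.hom, hq⟩)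
    have hl : f ≫ q = g ≫ l := by
      ext b
      exact (RingHom.liftOfSurjective_comp_apply g.hom hg ⟨q.hom.comp f.hom, hq⟩ b).symm
    intro a ha
    have h1 : i ≫ h.desc q l hl = q := h.inl_desc _ _ _
    have h2 : q.hom a = 0 := by
      rw [← h1]
      change (h.desc q l hl).hom (i.hom a) = 0
      rw [(RingHom.mem_ker).1 ha, map_zero]
    exact Ideal.Quotient.eq_zero_iff_mem.1 h2
  · rw [Ideal.map_le_iff_le_comap]
    intro b hb
    change i.hom (f.hom b) = 0
    have h1 : f ≫ i = g ≫ j := h.w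
    have h2 := congrArg (fun φ => φ.hom b) h1
    simp only [CommRingCat.hom_comp, RingHom.comp_apply] at h2
    rw [h2, (RingHom.mem_ker).1 hb, map_zero]

theorem exists_algHom_ker_eq {B : Type*} [CommRing B] [Algebra ℂ B] [Algebra.FiniteType ℂ B]
    (m : Ideal B) [m.IsMaximal] : ∃ χ : B →ₐ[ℂ] ℂ, RingHom.ker χ = m := by
  let _ : Field (B ⧸ m) := Ideal.Quotient.field m
  have : Module.Finite ℂ (B ⧸ m) := finite_of_finite_type_of_isJacobsonRing ℂ (B ⧸ m)
  have hbij := IsAlgClosed.algebraMap_bijective_of_isIntegral (k := ℂ) (K := B ⧸ m)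
  let e : ℂ ≃ₐ[ℂ] B ⧸ m := AlgEquiv.ofBijective (Algebra.ofId ℂ (B ⧸ m)) hbij
  refine ⟨(e.symm : (B ⧸ m) →ₐ[ℂ] ℂ).comp (Ideal.Quotient.mkₐ ℂ m), ?_⟩
  ext b
  rw [RingHom.mem_ker, ← Ideal.Quotient.eq_zero_iff_mem]
  change e.symm (Ideal.Quotient.mk m b) = 0 ↔ _
  simp

/-- Two vector fields in a module of rank one are proportional. -/
theorem derivation_mul_eq_of_rank_eq_one {k A : Type*} [CommRing k] [CommRing A] [IsDomain A]
    [Algebra k A] (N : Submodule A (Derivation k A A)) (hN : Module.rank A N = 1)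
    {D E : Derivation k A A} (hD : D ∈ N) (hE : E ∈ N) (a b : A) : D a * E b = D b * E a := by
  have hdep : ¬ LinearIndependent A ![(⟨D, hD⟩ : N), ⟨E, hE⟩] := by
    intro h
    have := h.cardinal_lift_le_rank
    rw [hN] at this
    simp at this
  rw [LinearIndependent.pair_iff] at hdep
  push Not at hdep
  obtain ⟨r, s, hrs, h0⟩ := hdep
  have key : ∀ c, r * D c + s * E c = 0 := fun c => by
    have := congrArg (fun w : N => (w : Derivation k A A) c) hrs
    simpa using this
  by_cases hr : r = 0
  · have hs := h0 hr
    apply mul_left_cancel₀ hs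
    linear_combination D a * key b - D b * key a
  · apply mul_left_cancel₀ hr
    linear_combination E b * key a - E a * key b

end ChartAlgebra

/-! ### Constants and restriction of vector fields -/

section Sections

variable {X : Scheme.{0}} [X.Over SpecC]

theorem algebraMap_constants {U : X.Opens} (e : U ≤ (X ↘ SpecC) ⁻¹ᵁ ⊤) (c : ℂ) :
    algebraMap ℂ Γ(X, U) c =
      ((Scheme.ΓSpecIso (.of ℂ)).inv ≫ (X ↘ SpecC).appLE ⊤ U e).hom c :=
  rfl

theorem map_algebraMap_constants {U V : X.Opens} (h : U ≤ V) (c : ℂ) :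
    X.presheaf.map (homOfLE h).op (algebraMap ℂ Γ(X, V) c) = algebraMap ℂ Γ(X, U) c := by
  have e : V ≤ (X ↘ SpecC) ⁻¹ᵁ ⊤ := le_top
  rw [algebraMap_constants e, algebraMap_constants (h.trans e), ← Scheme.Hom.appLE_map _ e
    (homOfLE h).op]
  rfl

theorem appLE_algebraMap_constants {Y : Scheme.{0}} [Y.Over SpecC] (f : Y ⟶ X)
    (hf : f ≫ (X ↘ SpecC) = Y ↘ SpecC) {U : X.Opens} {V : Y.Opens} (e : V ≤ f ⁻¹ᵁ U) (c : ℂ) :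
    f.appLE U V e (algebraMap ℂ Γ(X, U) c) = algebraMap ℂ Γ(Y, V) c := by
  have e₁ : U ≤ (X ↘ SpecC) ⁻¹ᵁ ⊤ := le_top
  have e₂ : V ≤ (Y ↘ SpecC) ⁻¹ᵁ ⊤ := le_top
  rw [algebraMap_constants e₁, algebraMap_constants e₂]
  have h1 : (X ↘ SpecC).appLE ⊤ U e₁ ≫ f.appLE U V e = (Y ↘ SpecC).appLE ⊤ V e₂ := by
    rw [Scheme.Hom.appLE_comp_appLE]
    simp only [hf]
  rw [← h1]
  rfl

theorem exists_isRestriction {U W : X.affineOpens} (h : W.1 ≤ U.1) (f : Γ(X, U.1))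
    (hW : W.1 = X.basicOpen f) (D : VectorField X U) :
    ∃ D' : VectorField X W, IsRestriction h D D' := by
  let _ : Algebra Γ(X, U.1) Γ(X, W.1) := (X.presheaf.map (homOfLE h).op).hom.toAlgebra
  have : IsLocalization.Away f Γ(X, W.1) := U.2.isLocalization_of_eq_basicOpen f (homOfLE h) hW
  have : IsScalarTower ℂ Γ(X, U.1) Γ(X, W.1) :=
    .of_algebraMap_eq fun c => (map_algebraMap_constants h c).symm
  obtain ⟨D', hD'⟩ := exists_derivation_extending (.powers f) (S := Γ(X, W.1))
    ((Algebra.linearMap Γ(X, U.1) Γ(X, W.1)).compDer D)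
  exact ⟨D', hD'⟩

/-- Two sections of a foliation are proportional as rational vector fields. -/
theorem Foliation.mul_eq_mul [IsIntegral X] (F : Foliation X) {U : X.affineOpens}
    (hU : (U.1 : Set X).Nonempty) {D E : VectorField X U} (hD : D ∈ F.fields U)
    (hE : E ∈ F.fields U) (a b : Γ(X, U.1)) : D a * E b = D b * E a := by
  have : Nonempty U.1 := hU.to_subtype
  exact derivation_mul_eq_of_rank_eq_one _ (F.rank_eq_one U hU) hD hE a b

end Sections

/-! ### Relative charts of the family -/

section Charts

variable {X T : Scheme.{0}} (π : X ⟶ T)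

/-- `x, y` are relative coordinates of `π` on the affine open set `U` over `V`. -/
def IsChart {V : T.Opens} {U : X.Opens} (e : U ≤ π ⁻¹ᵁ V) (x y : Γ(X, U)) : Prop :=
  letI := (π.appLE V U e).hom.toAlgebra
  ∃ P Q : Derivation Γ(T, V) Γ(X, U) Γ(X, U), IsCoordinates x y P Q

variable {π}

theorem IsChart.symm {V : T.Opens} {U : X.Opens} {e : U ≤ π ⁻¹ᵁ V} {x y : Γ(X, U)}
    (h : IsChart π e x y) : IsChart π e y x := by
  let _ := (π.appLE V U e).hom.toAlgebra
  obtain ⟨P, Q, h⟩ := h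
  exact ⟨Q, P, h.symm⟩

theorem IsChart.restrict {V : T.Opens} {U W : X.Opens} {e : U ≤ π ⁻¹ᵁ V} {x y : Γ(X, U)}
    (h : IsChart π e x y) (hU : IsAffineOpen U) (hWU : W ≤ U) (f : Γ(X, U))
    (hW : W = X.basicOpen f) : IsChart π (hWU.trans e) (X.presheaf.map (homOfLE hWU).op x)
      (X.presheaf.map (homOfLE hWU).op y) := by
  let _ := (π.appLE V U e).hom.toAlgebra
  let _ := (π.appLE V W (hWU.trans e)).hom.toAlgebra
  let _ : Algebra Γ(X, U) Γ(X, W) := (X.presheaf.map (homOfLE hWU).op).hom.toAlgebra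
  have : IsLocalization.Away f Γ(X, W) := hU.isLocalization_of_eq_basicOpen f (homOfLE hWU) hW
  have : IsScalarTower Γ(T, V) Γ(X, U) Γ(X, W) := .of_algebraMap_eq' (by
    change (π.appLE V W _).hom = (π.appLE V U e ≫ X.presheaf.map (homOfLE hWU).op).hom
    rw [Scheme.Hom.appLE_map])
  obtain ⟨P, Q, h⟩ := h
  exact h.exists_localization (.powers f)

theorem exists_isChart [SmoothOfRelativeDimension 2 π] (z : X) :
    ∃ (V : T.affineOpens) (U : X.affineOpens) (_ : z ∈ U.1) (e : U.1 ≤ π ⁻¹ᵁ V.1)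
      (x y : Γ(X, U.1)), IsChart π e x y := by
  obtain ⟨V, hV, U, hU, hz, e, h⟩ :=
    SmoothOfRelativeDimension.exists_isStandardSmoothOfRelativeDimension (n := 2) (f := π) z
  have : Nonempty U := ⟨⟨z, hz⟩⟩
  let _ := (π.appLE V U e).hom.toAlgebra
  have : Algebra.IsStandardSmoothOfRelativeDimension 2 Γ(T, V) Γ(X, U) := h
  obtain ⟨x, y, P, Q, hc⟩ := exists_isCoordinates (B := Γ(T, V)) (A := Γ(X, U))
  exact ⟨⟨V, hV⟩, ⟨U, hU⟩, hz, e, x, y, P, Q, hc⟩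

end Charts

/-! ### Functions on a closed fibre -/

section FibreRing

variable {X T : Scheme.{0}} (π : X ⟶ T)

/-- A closed point of an affine open set is the kernel of the evaluation there, and the ring of the
fibre is the quotient by the ideal it generates. -/
theorem exists_ker_fiberι_app_eq {V : T.Opens} (hV : IsAffineOpen V) {U : X.Opens}
    (hU : IsAffineOpen U) (e : U ≤ π ⁻¹ᵁ V) (t : closedPoints T) (ht : t.1 ∈ V) :
    ∃ m : Ideal Γ(T, V), m.IsMaximal ∧ (∀ b, b ∈ m ↔ t.1 ∉ T.basicOpen b) ∧
      RingHom.ker ((π.fiberι t.1).app U).hom = m.map (π.appLE V U e).hom := by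
  have hcl : IsClosedImmersion (T.fromSpecResidueField t.1) :=
    isClosed_singleton_iff_isClosedImmersion.1 t.2
  have hle : (⊤ : (Spec (T.residueField t.1)).Opens) ≤ T.fromSpecResidueField t.1 ⁻¹ᵁ V := by
    intro p _
    have : T.fromSpecResidueField t.1 p ∈ ({t.1} : Set T) := by
      rw [← Scheme.range_fromSpecResidueField]; exact ⟨p, rfl⟩
    change T.fromSpecResidueField t.1 p ∈ V
    rw [this]; exact ht
  let g := (T.fromSpecResidueField t.1).appLE V ⊤ hle
  have hg : Function.Surjective g.hom := by
    have key : ∀ (W : (Spec (T.residueField t.1)).Opens)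
        (hW : W ≤ T.fromSpecResidueField t.1 ⁻¹ᵁ V), W = T.fromSpecResidueField t.1 ⁻¹ᵁ V →
        Function.Surjective ((T.fromSpecResidueField t.1).appLE V W hW).hom := by
      rintro _ hW rfl
      rw [← Scheme.Hom.app_eq_appLE]
      exact Scheme.Hom.app_surjective (T.fromSpecResidueField t.1) V hV
    exact key _ hle (top_le_iff.1 hle).symm
  have hfield : IsField Γ(Spec (T.residueField t.1), ⊤) :=
    MulEquiv.isField (Field.toIsField (T.residueField t.1))
      (Scheme.ΓSpecIso (T.residueField t.1)).commRingCatIsoToRingEquiv.toMulEquiv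
  have H : IsPullback (π.fiberι t.1) (π.fiberToSpecResidueField t.1) π
      (T.fromSpecResidueField t.1) := IsPullback.of_hasPullback _ _
  -- On affine opens, the sections of a fibre product form the pushout of the sections.
  have hpush := (isIso_pushoutSection_iff H hle e
    (UY := π.fiberι t.1 ⁻¹ᵁ U) (by rw [Scheme.Hom.preimage_top, inf_top_eq])).1
      (isIso_pushoutSection_of_isAffineOpen H hle e _ hV (isAffineOpen_top _) hU)
  refine ⟨RingHom.ker g.hom, ?_, fun b => ?_, ?_⟩
  · let _ := hfield.toField
    exact RingHom.ker_isMaximal_of_surjective g.hom hg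
  · have h1 : (Spec (T.residueField t.1)).basicOpen (g b) =
        ⊤ ⊓ T.fromSpecResidueField t.1 ⁻¹ᵁ T.basicOpen b :=
      Scheme.basicOpen_appLE (T.fromSpecResidueField t.1) ⊤ V hle b
    obtain ⟨p, hp⟩ : t.1 ∈ Set.range (T.fromSpecResidueField t.1) := by
      rw [Scheme.range_fromSpecResidueField]; rfl
    have h2 : p ∈ (Spec (T.residueField t.1)).basicOpen (g b) ↔ t.1 ∈ T.basicOpen b := by
      rw [h1, top_inf_eq]
      change T.fromSpecResidueField t.1 p ∈ T.basicOpen b ↔ _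
      rw [hp]
    rw [← h2, RingHom.mem_ker]
    constructor
    · intro h0
      change g b = 0 at h0
      rw [h0, Scheme.basicOpen_zero]
      exact id
    · intro hp'
      by_contra h0
      obtain ⟨c, hc⟩ := hfield.mul_inv_cancel h0
      apply hp'
      rw [Scheme.basicOpen_of_isUnit _ (.of_mul_eq_one c hc)]
      trivial
  · have := ker_of_isPushout hpush hg
    rwa [Scheme.Hom.app_eq_appLE]

end FibreRing

/-! ### The member over a closed point, read in a chart -/

section Member

variable {X T : Scheme.{0}} [X.Over SpecC] [T.Over SpecC] (π : X ⟶ T) [IsSurfaceFamily π]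

omit [T.Over SpecC] [IsSurfaceFamily π] in
theorem fiberι_comp_over (t : T) :
    π.fiberι t ≫ (X ↘ SpecC) = (π.fiber t) ↘ SpecC :=
  rfl

/-- The pullback of functions to the function field of a fibre. -/
def toFiberField (t : closedPoints T) (U : X.Opens) [Nonempty (π.fiberι t.1 ⁻¹ᵁ U)] :
    Γ(X, U) →+* (π.fiber t.1).functionField :=
  ((π.fiber t.1).germToFunctionField (π.fiberι t.1 ⁻¹ᵁ U)).hom.comp ((π.fiberι t.1).app U).hom

/-- The pullback factors through the stalk of `X` at the generic point of the fibre, which does not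
depend on `U`. -/
theorem toFiberField_eq (t : closedPoints T) (U : X.Opens) [Nonempty (π.fiberι t.1 ⁻¹ᵁ U)]
    (hU : π.fiberι t.1 (genericPoint (π.fiber t.1)) ∈ U) (a : Γ(X, U)) :
    toFiberField π t U a =
      ((π.fiberι t.1).stalkMap (genericPoint (π.fiber t.1))).hom (X.presheaf.germ U _ hU a) := by
  have := Scheme.Hom.germ_stalkMap (π.fiberι t.1) U (genericPoint (π.fiber t.1)) hU
  exact (congrArg (fun φ => φ.hom a) this).symm

theorem fiberι_genericPoint_mem (t : closedPoints T) (U : X.Opens)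
    [h : Nonempty (π.fiberι t.1 ⁻¹ᵁ U)] : π.fiberι t.1 (genericPoint (π.fiber t.1)) ∈ U := by
  obtain ⟨p⟩ := h
  have := ((genericPoint_spec (π.fiber t.1)).mem_open_set_iff (π.fiberι t.1 ⁻¹ᵁ U).isOpen).2
    ⟨p.1, trivial, p.2⟩
  exact this

theorem toFiberField_map (t : closedPoints T) {U W : X.Opens} (h : W ≤ U)
    [Nonempty (π.fiberι t.1 ⁻¹ᵁ U)] [Nonempty (π.fiberι t.1 ⁻¹ᵁ W)] (a : Γ(X, U)) :
    toFiberField π t W (X.presheaf.map (homOfLE h).op a) = toFiberField π t U a := by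
  rw [toFiberField_eq π t W (fiberι_genericPoint_mem π t W),
    toFiberField_eq π t U (h (fiberι_genericPoint_mem π t W))]
  congr 1
  exact TopCat.Presheaf.germ_res_apply X.presheaf (homOfLE h) _ _ a

theorem toFiberField_constants (t : closedPoints T) (U : X.Opens)
    [Nonempty (π.fiberι t.1 ⁻¹ᵁ U)] (c : ℂ) :
    toFiberField π t U (algebraMap ℂ Γ(X, U) c) = algebraMap ℂ _ c := by
  have h1 : (π.fiberι t.1).app U (algebraMap ℂ Γ(X, U) c) =
      algebraMap ℂ Γ(π.fiber t.1, π.fiberι t.1 ⁻¹ᵁ U) c := by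
    rw [Scheme.Hom.app_eq_appLE]
    exact appLE_algebraMap_constants _ (fiberι_comp_over π t.1) le_rfl c
  change (π.fiber t.1).germToFunctionField (π.fiberι t.1 ⁻¹ᵁ U)
    ((π.fiberι t.1).app U (algebraMap ℂ Γ(X, U) c)) = _
  rw [h1, ← map_algebraMap_constants (le_top : π.fiberι t.1 ⁻¹ᵁ U ≤ ⊤)]
  exact TopCat.Presheaf.germ_res_apply (π.fiber t.1).presheaf (homOfLE le_top) _ _ _

theorem ker_toFiberField (t : closedPoints T) (U : X.Opens)
    [Nonempty (π.fiberι t.1 ⁻¹ᵁ U)] :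
    RingHom.ker (toFiberField π t U) = RingHom.ker ((π.fiberι t.1).app U).hom := by
  ext a
  rw [RingHom.mem_ker, RingHom.mem_ker]
  exact map_eq_zero_iff _ (Scheme.germToFunctionField_injective _ _)

/-- The fibre is closed in `X`, so functions on `U` surject onto those of an affine open of the
fibre, whose fraction field is the function field. -/
theorem toFiberField_frac (t : closedPoints T) {U : X.Opens} (hU : IsAffineOpen U)
    [Nonempty (π.fiberι t.1 ⁻¹ᵁ U)] (z : (π.fiber t.1).functionField) :
    ∃ a s, toFiberField π t U s ≠ 0 ∧ z * toFiberField π t U s = toFiberField π t U a := by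
  have hcl : IsClosedImmersion (T.fromSpecResidueField t.1) :=
    isClosed_singleton_iff_isClosedImmersion.1 t.2
  have : IsClosedImmersion (π.fiberι t.1) :=
    MorphismProperty.of_isPullback (P := @IsClosedImmersion)
      (IsPullback.of_hasPullback π (T.fromSpecResidueField t.1)).flip hcl
  have hfr := functionField_isFractionRing_of_isAffineOpen (π.fiber t.1) (π.fiberι t.1 ⁻¹ᵁ U)
    (hU.preimage (π.fiberι t.1))
  have hsurj := Scheme.Hom.app_surjective (π.fiberι t.1) U hU
  obtain ⟨⟨a, s⟩, hz⟩ := IsLocalization.surj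
    (nonZeroDivisors Γ(π.fiber t.1, π.fiberι t.1 ⁻¹ᵁ U)) z
  obtain ⟨a', ha'⟩ := hsurj a
  obtain ⟨s', hs'⟩ := hsurj s.1
  have key : ∀ (a : Γ(X, U)) b, (π.fiberι t.1).app U a = b → toFiberField π t U a =
      algebraMap Γ(π.fiber t.1, π.fiberι t.1 ⁻¹ᵁ U) _ b := by
    rintro a _ rfl; rfl
  refine ⟨a', s', ?_, ?_⟩
  · rw [key s' _ hs']
    exact IsLocalization.to_map_ne_zero_of_mem_nonZeroDivisors _ le_rfl s.2
  · rw [key s' _ hs', key a' _ ha']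
    exact hz

variable {π}

theorem induced_apply_of_isRestriction {U W : X.affineOpens} (h : W.1 ≤ U.1) (f : Γ(X, U.1))
    (hW : W.1 = X.basicOpen f) {D : VectorField X U} {D' : VectorField X W}
    (hD : IsRestriction h D D') (t : closedPoints T) [Nonempty (π.fiberι t.1 ⁻¹ᵁ U.1)]
    [Nonempty (π.fiberι t.1 ⁻¹ᵁ W.1)]
    {v : Derivation ℂ (π.fiber t.1).functionField (π.fiber t.1).functionField}
    (hv : ∀ a, v (toFiberField π t U.1 a) = toFiberField π t U.1 (D a)) (w : Γ(X, W.1)) :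
    v (toFiberField π t W.1 w) = toFiberField π t W.1 (D' w) := by
  let _ : Algebra Γ(X, U.1) Γ(X, W.1) := (X.presheaf.map (homOfLE h).op).hom.toAlgebra
  have : IsLocalization.Away f Γ(X, W.1) := U.2.isLocalization_of_eq_basicOpen f (homOfLE h) hW
  have hD' : ∀ a, D' (algebraMap Γ(X, U.1) Γ(X, W.1) a) = algebraMap Γ(X, U.1) Γ(X, W.1) (D a) := hD
  have hmap : ∀ a, toFiberField π t W.1 (algebraMap Γ(X, U.1) Γ(X, W.1) a) =
      toFiberField π t U.1 a := toFiberField_map π t h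
  obtain ⟨⟨a, s⟩, hw⟩ := IsLocalization.surj (Submonoid.powers f) w
  have hs : toFiberField π t U.1 s ≠ 0 := by
    rw [← hmap]
    exact ((IsLocalization.map_units _ s).map (toFiberField π t W.1)).ne_zero
  have e1 := congrArg (toFiberField π t W.1) hw
  have e2 := congrArg v e1
  have e3 := congrArg (fun w => toFiberField π t W.1 (D' w)) hw
  simp only [map_mul, hmap, hv, Derivation.leibniz, smul_eq_mul, map_add, hD'] at e1 e2 e3
  apply mul_left_cancel₀ hs
  linear_combination e2 - e3

/-- The foliation on a fibre is determined by a vector field on any chart which meets the fibre. -/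
theorem exists_isMember (F : Foliation X) {V : T.affineOpens} {U : X.affineOpens}
    (e : U.1 ≤ π ⁻¹ᵁ V.1) [Algebra.FiniteType ℂ Γ(T, V.1)] [Algebra Γ(T, V.1) Γ(X, U.1)]
    (halg : ∀ b, algebraMap Γ(T, V.1) Γ(X, U.1) b = π.appLE V.1 U.1 e b)
    (D : Derivation Γ(T, V.1) Γ(X, U.1) Γ(X, U.1)) (D₀ : VectorField X U) (hD₀ : D₀ ∈ F.fields U)
    (hD : ∀ a, D a = D₀ a) {x : Γ(X, U.1)} (hx : IsUnit (D x)) (t : closedPoints T)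
    (ht : t.1 ∈ V.1) [Nonempty (π.fiberι t.1 ⁻¹ᵁ U.1)] :
    ∃ χ : Γ(T, V.1) →ₐ[ℂ] ℂ, (∀ b, χ b = 0 ↔ t.1 ∉ T.basicOpen b) ∧
      IsMember χ (toFiberField π t U.1) D (F.member π t) := by
  have : IsIntegral X := IsSurfaceFamily.integral_total π
  obtain ⟨m, hm, hmb, hker⟩ := exists_ker_fiberι_app_eq π V.2 U.2 e t ht
  obtain ⟨χ, hχ⟩ := exists_algHom_ker_eq m
  have halg' : algebraMap Γ(T, V.1) Γ(X, U.1) = (π.appLE V.1 U.1 e).hom := RingHom.ext halg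
  have hk : RingHom.ker (toFiberField π t U.1) =
      (RingHom.ker χ).map (algebraMap Γ(T, V.1) Γ(X, U.1)) := by
    rw [ker_toFiberField, hker, hχ, halg']
  have hconst : ∀ c, algebraMap Γ(T, V.1) Γ(X, U.1) (algebraMap ℂ _ c) = algebraMap ℂ _ c :=
    fun c => by
      rw [halg]
      exact appLE_algebraMap_constants π (IsSurfaceFamily.isOver (π := π)).comp_over e c
  refine ⟨χ, fun b => ?_, ?_, hk, toFiberField_frac π t U.2, fun δ hδ => ?_, fun v hv => ?_⟩
  · rw [← hmb, ← hχ, RingHom.mem_ker]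
  · intro β
    have h1 : algebraMap Γ(T, V.1) Γ(X, U.1) (β - algebraMap ℂ _ (χ β)) ∈
        RingHom.ker (toFiberField π t U.1) := by
      rw [hk]
      refine Ideal.mem_map_of_mem _ ?_
      rw [RingHom.mem_ker, map_sub, AlgHom.commutes]
      simp
    rw [RingHom.mem_ker, map_sub, map_sub, sub_eq_zero, hconst, toFiberField_constants] at h1
    exact h1
  · refine Submodule.subset_span ⟨U, inferInstance, D₀, hD₀, fun a => ?_⟩
    have := hδ a
    rw [hD] at this
    exact this
  · refine Submodule.span_induction ?_ ⟨0, fun a => by simp⟩ ?_ ?_ hv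
    · rintro v ⟨U', hne, D', hD', hv⟩
      -- Compare the given section with `D₀` on a common basic open around the generic point of the
      -- fibre. In rank one they are proportional, and the factor is read off at `x`, where `D₀ x`
      -- is a unit.
      obtain ⟨f, g, hfg, hz⟩ := exists_basicOpen_le_affine_inter U.2 U'.2
        (π.fiberι t.1 (genericPoint (π.fiber t.1)))
        ⟨fiberι_genericPoint_mem π t U.1, fiberι_genericPoint_mem π t U'.1⟩
      let W : X.affineOpens := ⟨X.basicOpen f, U.2.basicOpen f⟩
      have hWU : W.1 ≤ U.1 := X.basicOpen_le f
      have hWU' : W.1 ≤ U'.1 := hfg.le.trans (X.basicOpen_le g)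
      have hW : Nonempty (π.fiberι t.1 ⁻¹ᵁ W.1) := ⟨⟨_, hz⟩⟩
      obtain ⟨E, hE⟩ := exists_isRestriction hWU f rfl D₀
      obtain ⟨E', hE'⟩ := exists_isRestriction hWU' g hfg D'
      have hprop := F.mul_eq_mul ⟨_, hz⟩ (F.restrict hWU _ _ hE hD₀) (F.restrict hWU' _ _ hE' hD')
      have hx' : toFiberField π t U.1 (D₀ x) ≠ 0 := by
        rw [← hD]
        exact (hx.map (toFiberField π t U.1)).ne_zero
      have hva : ∀ a, toFiberField π t W.1 (E' (X.presheaf.map (homOfLE hWU).op a)) =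
          v (toFiberField π t U.1 a) := fun a => by
        rw [← induced_apply_of_isRestriction hWU' g hfg hE' t hv, toFiberField_map]
      refine ⟨v (toFiberField π t U.1 x) / toFiberField π t U.1 (D₀ x), fun a => ?_⟩
      have h1 := congrArg (toFiberField π t W.1) (hprop (X.presheaf.map (homOfLE hWU).op a)
        (X.presheaf.map (homOfLE hWU).op x))
      rw [hE a, hE x, map_mul, map_mul, toFiberField_map, toFiberField_map, hva, hva]
        at h1
      rw [hD]
      field_simp
      linear_combination -h1
    · rintro v w _ _ ⟨c, hc⟩ ⟨c', hc'⟩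
      exact ⟨c + c', fun a => by rw [Derivation.add_apply, hc, hc', add_mul]⟩
    · rintro r v _ ⟨c, hc⟩
      exact ⟨r * c, fun a => by rw [Derivation.smul_apply, hc, smul_eq_mul, mul_assoc]⟩

end Member

/-! ### Charts at regular points of the foliation -/

section GoodChart

variable {X T : Scheme.{0}} [X.Over SpecC] {π : X ⟶ T}

theorem exists_derivation_of_tangentTo {F : Foliation X} (hF : F.TangentTo π)
    {V : T.Opens} {U : X.affineOpens} (e : U.1 ≤ π ⁻¹ᵁ V) [Algebra Γ(T, V) Γ(X, U.1)]
    (halg : ∀ b, algebraMap Γ(T, V) Γ(X, U.1) b = π.appLE V U.1 e b) {D₀ : VectorField X U}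
    (hD₀ : D₀ ∈ F.fields U) :
    ∃ D : Derivation Γ(T, V) Γ(X, U.1) Γ(X, U.1), ∀ a, D a = D₀ a := by
  have h0 : ∀ b, D₀ (algebraMap Γ(T, V) Γ(X, U.1) b) = 0 := fun b => by
    rw [halg]; exact hF U V e D₀ hD₀ b
  exact ⟨{ toFun := D₀
           map_add' := fun a b => map_add D₀ a b
           map_smul' := fun b a => by
            rw [Algebra.smul_def, Derivation.leibniz, h0, smul_zero, add_zero, smul_eq_mul,
              RingHom.id_apply, Algebra.smul_def]
           map_one_eq_zero' := D₀.map_one_eq_zero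
           leibniz' := D₀.leibniz }, fun _ => rfl⟩

/-- By tangency `D₀ a = P a * D₀ x + Q a * D₀ y`, so some term is nonzero at `z`. -/
theorem mem_basicOpen_of_isChart {F : Foliation X} (hF : F.TangentTo π)
    {V : T.Opens} {U : X.affineOpens} {e : U.1 ≤ π ⁻¹ᵁ V} {x y : Γ(X, U.1)}
    (h : IsChart π e x y) {D₀ : VectorField X U} (hD₀ : D₀ ∈ F.fields U) {a : Γ(X, U.1)} {z : X}
    (hz : z ∈ X.basicOpen (D₀ a)) : z ∈ X.basicOpen (D₀ x) ∨ z ∈ X.basicOpen (D₀ y) := by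
  let _ := (π.appLE V U.1 e).hom.toAlgebra
  obtain ⟨D, hD⟩ := exists_derivation_of_tangentTo hF e (fun _ => rfl) hD₀
  obtain ⟨P, Q, h⟩ := h
  rw [← hD, h.derivation_apply D a, hD, hD] at hz
  refine (Scheme.basicOpen_add_le _ _ _ hz).imp (fun h1 => ?_) fun h1 => ?_
  · rw [Scheme.basicOpen_mul] at h1; exact h1.2
  · rw [Scheme.basicOpen_mul] at h1; exact h1.2

/-- Around a point where the foliation is regular there is a chart with a coordinate `x` whose
derivative along the foliation is a unit. -/
theorem exists_chart_of_notMem_singularSet [SmoothOfRelativeDimension 2 π] {F : Foliation X}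
    (hF : F.TangentTo π) {z : X} (hz : z ∉ F.singularSet) :
    ∃ (V : T.affineOpens) (U : X.affineOpens) (_ : z ∈ U.1) (e : U.1 ≤ π ⁻¹ᵁ V.1)
      (x y : Γ(X, U.1)) (D₀ : VectorField X U), IsChart π e x y ∧ D₀ ∈ F.fields U ∧
        IsUnit (D₀ x) := by
  have hz' : ∃ (U : X.affineOpens) (_ : z ∈ U.1), ∃ D ∈ F.fields U, ∃ a : Γ(X, U.1),
      z ∈ X.basicOpen (D a) := by
    by_contra hcon
    push Not at hcon
    exact hz fun U hU D hD a => hcon U hU D hD a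
  obtain ⟨U₁, hzU₁, D₁, hD₁, a, ha⟩ := hz'
  obtain ⟨V, U₂, hzU₂, e, x, y, hxy⟩ := exists_isChart (π := π) z
  obtain ⟨f, g, hfg, hzf⟩ := exists_basicOpen_le_affine_inter U₂.2 U₁.2 z ⟨hzU₂, hzU₁⟩
  let W : X.affineOpens := ⟨X.basicOpen f, U₂.2.basicOpen f⟩
  have hW₂ : W.1 ≤ U₂.1 := X.basicOpen_le f
  have hW₁ : W.1 ≤ U₁.1 := hfg.le.trans (X.basicOpen_le g)
  obtain ⟨E, hE⟩ := exists_isRestriction hW₁ g hfg D₁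
  have hEF := F.restrict hW₁ _ _ hE hD₁
  have hzE : z ∈ X.basicOpen (E (X.presheaf.map (homOfLE hW₁).op a)) := by
    rw [hE, Scheme.basicOpen_res]
    exact ⟨hzf, ha⟩
  have hxyW := hxy.restrict U₂.2 hW₂ f rfl
  -- Shrink to the locus where the derivative of the first coordinate is invertible; the two
  -- coordinates may be exchanged.
  have key : ∀ x y : Γ(X, W.1), IsChart π (hW₂.trans e) x y → z ∈ X.basicOpen (E x) →
      ∃ (V : T.affineOpens) (U : X.affineOpens) (_ : z ∈ U.1) (e : U.1 ≤ π ⁻¹ᵁ V.1)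
        (x y : Γ(X, U.1)) (D₀ : VectorField X U), IsChart π e x y ∧ D₀ ∈ F.fields U ∧
          IsUnit (D₀ x) := by
    intro x y h hx
    let W' : X.affineOpens := ⟨X.basicOpen (E x), W.2.basicOpen (E x)⟩
    have hW' : W'.1 ≤ W.1 := X.basicOpen_le _
    obtain ⟨E', hE'⟩ := exists_isRestriction hW' (E x) rfl E
    refine ⟨V, W', hx, _, _, _, E', h.restrict W.2 hW' (E x) rfl, F.restrict hW' _ _ hE' hEF, ?_⟩
    rw [hE']
    exact RingedSpace.isUnit_res_basicOpen _ _
  rcases mem_basicOpen_of_isChart hF hxyW hEF hzE with h | h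
  · exact key _ _ hxyW h
  · exact key _ _ hxyW.symm h

end GoodChart

/-! ### Closed points of the base -/

section Base

variable {T : Scheme.{0}} [T.Over SpecC]

theorem smooth_sections [Smooth (T ↘ SpecC)] {V : T.Opens} (hV : IsAffineOpen V) :
    Algebra.Smooth ℂ Γ(T, V) := by
  have h1 : ((T ↘ SpecC).appLE ⊤ V le_top).hom.Smooth :=
    Scheme.Hom.smooth_appLE _ (isAffineOpen_top _) hV _
  have h2 : (Scheme.ΓSpecIso (.of ℂ)).inv.hom.Smooth :=
    RingHom.Smooth.of_bijective (ConcreteCategory.bijective_of_isIso (Scheme.ΓSpecIso (.of ℂ)).inv)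
  exact h2.comp h1

/-- A complex valued character of the functions on an affine open set is a closed point. -/
theorem exists_closedPoint [LocallyOfFiniteType (T ↘ SpecC)] {V : T.Opens} (hV : IsAffineOpen V)
    (χ : Γ(T, V) →ₐ[ℂ] ℂ) :
    ∃ t : closedPoints T, t.1 ∈ V ∧ ∀ b, t.1 ∈ T.basicOpen b ↔ χ b ≠ 0 := by
  have : JacobsonSpace SpecC := inferInstanceAs (JacobsonSpace (PrimeSpectrum ℂ))
  have : JacobsonSpace T := LocallyOfFiniteType.jacobsonSpace (T ↘ SpecC)
  have hmax : (RingHom.ker χ).IsMaximal :=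
    RingHom.ker_isMaximal_of_surjective χ fun c => ⟨algebraMap ℂ _ c, χ.commutes c⟩
  let p : Spec Γ(T, V) := ⟨RingHom.ker χ, hmax.isPrime⟩
  have hp : p ∈ closedPoints (Spec Γ(T, V)) :=
    (PrimeSpectrum.isClosed_singleton_iff_isMaximal p).2 hmax
  have hemb : Topology.IsOpenEmbedding hV.fromSpec := hV.fromSpec.isOpenEmbedding
  rw [← hemb.preimage_closedPoints] at hp
  refine ⟨⟨hV.fromSpec p, hp⟩, ?_, fun b => ?_⟩
  · have : hV.fromSpec p ∈ Set.range hV.fromSpec := ⟨p, rfl⟩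
    rwa [hV.range_fromSpec] at this
  · have h1 : p ∈ hV.fromSpec ⁻¹ᵁ T.basicOpen b ↔ p ∈ PrimeSpectrum.basicOpen b := by
      rw [hV.fromSpec_preimage_basicOpen]
      exact Iff.rfl
    exact h1

/-- By irreducibility `V` meets the complement of `Z`, which then contains a nonempty basic open. -/
theorem exists_basicOpen_disjoint {T : Scheme.{0}} [IsIntegral T] {V : T.Opens}
    (hV : IsAffineOpen V) (hne : (V : Set T).Nonempty) {Z : Set T} (hZ : IsClosed Z)
    (hZ' : Z ≠ Set.univ) :
    ∃ f : Γ(T, V), f ≠ 0 ∧ ∀ t ∈ T.basicOpen f, t ∉ Z := by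
  let O : T.Opens := ⟨Zᶜ, hZ.isOpen_compl⟩
  obtain ⟨t, htV, htO⟩ := nonempty_preirreducible_inter V.isOpen O.isOpen hne
    (Set.nonempty_compl.2 hZ')
  obtain ⟨f, hf, htf⟩ := hV.exists_basicOpen_le (V := O) ⟨t, htO⟩ htV
  refine ⟨f, ?_, fun s hs => hf hs⟩
  rintro rfl
  rw [Scheme.basicOpen_zero] at htf
  exact htf

end Base

/-! ### From a very general member to all members -/

section Main

variable {X T : Scheme.{0}} [X.Over SpecC] [T.Over SpecC] (π : X ⟶ T) [IsSurfaceFamily π]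

omit [X.Over SpecC] [T.Over SpecC] [IsSurfaceFamily π] in
theorem nonempty_fiberι_preimage (t : closedPoints T) {U : X.Opens} {z : X} (hz : z ∈ U)
    (hzt : π z = t.1) : Nonempty (π.fiberι t.1 ⁻¹ᵁ U) := by
  have : z ∈ Set.range (π.fiberι t.1) := by
    rw [Scheme.Hom.range_fiberι]; exact hzt
  obtain ⟨p, rfl⟩ := this
  exact ⟨⟨p, hz⟩⟩

/-- A transverse structure on a sufficiently general member of the family gives one on the member
over `t`. -/
theorem exists_functions_forall_transverse (F : Foliation X) (hF : F.TangentTo π)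
    (t : closedPoints T) (ht : F.HasMember π t) :
    ∃ (V : T.affineOpens) (S : Set Γ(T, V.1)), (V.1 : Set T).Nonempty ∧ S.Countable ∧ 0 ∉ S ∧
      ∀ s : closedPoints T, s.1 ∈ V.1 → (∀ f ∈ S, s.1 ∈ T.basicOpen f) → F.HasMember π s ∧
        (TransverselyAffine (F.member π s) → TransverselyAffine (F.member π t)) ∧
        (TransverselyProjective (F.member π s) → TransverselyProjective (F.member π t)) := by
  have := IsSurfaceFamily.integral_total π
  have := IsSurfaceFamily.integral_base π
  have := IsSurfaceFamily.smooth_base π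
  have := IsSurfaceFamily.submersion (π := π)
  have hsm : Smooth π := SmoothOfRelativeDimension.smooth 2 π
  obtain ⟨z, hzt, hz⟩ := Set.not_subset.1 ht
  obtain ⟨V, U, hzU, e, x, y, D₀, hxy, hD₀, hx⟩ := exists_chart_of_notMem_singularSet hF hz
  have hVne : (V.1 : Set T).Nonempty := ⟨π z, e hzU⟩
  have : Nonempty V.1 := hVne.to_subtype
  have : Nonempty U.1 := ⟨⟨z, hzU⟩⟩
  let _ := (π.appLE V.1 U.1 e).hom.toAlgebra
  obtain ⟨D, hD⟩ := exists_derivation_of_tangentTo hF e (fun _ => rfl) hD₀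
  obtain ⟨P, Q, hPQ⟩ := hxy
  have : Algebra.Smooth ℂ Γ(T, V.1) := smooth_sections V.2
  have hAB : (π.appLE V.1 U.1 e).hom.Smooth := π.smooth_appLE V.2 U.2 e
  have : Algebra.Smooth Γ(T, V.1) Γ(X, U.1) := hAB
  have : Module.Flat Γ(T, V.1) Γ(X, U.1) := hAB.flat
  have hinj : Function.Injective (algebraMap Γ(T, V.1) Γ(X, U.1)) := by
    exact FaithfulSMul.algebraMap_injective _ _
  have hDx : IsUnit (D x) := by rwa [hD]
  obtain ⟨S, hSc, hS0, hS⟩ := exists_countable_forall_transverse hinj hPQ D hDx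
  have hopen : IsOpen (π '' (U.1 : Set X)) := π.isOpenMap _ U.1.isOpen
  -- The smooth map `π` is open, so where `f` is nonzero the fibre meets `U`. The chart chosen for
  -- `t` then also describes the member over `s`.
  obtain ⟨f, hf0, hf⟩ := exists_basicOpen_disjoint V.2 hVne (Z := (π '' (U.1 : Set X))ᶜ)
    hopen.isClosed_compl (fun h => (h ▸ Set.mem_univ (π z) : π z ∈ (π '' (U.1 : Set X))ᶜ)
      ⟨z, hzU, rfl⟩)
  have htV : t.1 ∈ V.1 := by
    have : π z ∈ V.1 := e hzU
    rwa [show π z = t.1 from hzt] at this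
  have htne := nonempty_fiberι_preimage π t hzU hzt
  refine ⟨V, insert f S, hVne, hSc.insert f, ?_, fun s hsV hs => ?_⟩
  · rintro (h | h)
    · exact hf0 h.symm
    · exact hS0 h
  obtain ⟨w, hwU, hws⟩ := not_not.1 (hf s.1 (hs f (Set.mem_insert f S)))
  have hsne := nonempty_fiberι_preimage π s hwU hws
  obtain ⟨χ₁, hχ₁, hm₁⟩ := exists_isMember F e (fun _ => rfl) D D₀ hD₀ hD hDx s hsV
  obtain ⟨χ₂, hχ₂, hm₂⟩ := exists_isMember F e (fun _ => rfl) D D₀ hD₀ hD hDx t htV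
  refine ⟨fun hsing => hsing hws U hwU D₀ hD₀ x ?_, hS hm₁ hm₂ fun b hb h0 => ?_⟩
  · rw [Scheme.basicOpen_of_isUnit _ hx]
    exact hwU
  · exact (hχ₁ b).1 h0 (hs b (Set.mem_insert_of_mem f hb))

/-- Each exceptional set is avoided where a suitable nonzero function does not vanish. Together with
`S` these are countably many nonzero functions, and some closed point of `V` is a zero of none. -/
theorem exists_general_member (F : Foliation X) (hF : F.TangentTo π) (t : closedPoints T)
    (ht : F.HasMember π t) (Z : ℕ → Set T) (hZ : ∀ n, IsClosed (Z n) ∧ Z n ≠ Set.univ) :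
    ∃ s : closedPoints T, (∀ n, s.1 ∉ Z n) ∧ F.HasMember π s ∧
      (TransverselyAffine (F.member π s) → TransverselyAffine (F.member π t)) ∧
      (TransverselyProjective (F.member π s) → TransverselyProjective (F.member π t)) := by
  have := IsSurfaceFamily.integral_base π
  have := IsSurfaceFamily.smooth_base π
  obtain ⟨V, S, hVne, hSc, hS0, hS⟩ := exists_functions_forall_transverse π F hF t ht
  have : Nonempty V.1 := hVne.to_subtype
  choose f hf0 hf using fun n => exists_basicOpen_disjoint V.2 hVne (hZ n).1 (hZ n).2
  have : Algebra.Smooth ℂ Γ(T, V.1) := smooth_sections V.2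
  obtain ⟨χ, hχ⟩ := exists_algHom_forall_ne_zero (S ∪ Set.range f)
    (hSc.union (Set.countable_range f)) (by
      rintro (h | ⟨n, h⟩)
      · exact hS0 h
      · exact hf0 n h)
  obtain ⟨s, hsV, hs⟩ := exists_closedPoint V.2 χ
  exact ⟨s, fun n => hf n s.1 ((hs _).2 (hχ _ (Or.inr ⟨n, rfl⟩))),
    hS s hsV fun g hg => (hs g).2 (hχ g (Or.inl hg))⟩

end Main

end FoliatedFamily

end

theorem mainTheorem12 {X T : Scheme.{0}} [X.Over FoliatedFamily.SpecC]
    [T.Over FoliatedFamily.SpecC] (π : X ⟶ T) [FoliatedFamily.IsSurfaceFamily π]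
    (F : FoliatedFamily.Foliation X) (hF : F.TangentTo π) :
    (FoliatedFamily.ForVeryGeneral T (fun t => F.HasMember π t →
        FoliatedFamily.TransverselyProjective (F.member π t)) →
      ∀ t : closedPoints T, F.HasMember π t →
        FoliatedFamily.TransverselyProjective (F.member π t)) ∧
    (FoliatedFamily.ForVeryGeneral T (fun t => F.HasMember π t →
        FoliatedFamily.TransverselyAffine (F.member π t)) →
      ∀ t : closedPoints T, F.HasMember π t →
        FoliatedFamily.TransverselyAffine (F.member π t)) := by
  constructor
  · rintro ⟨Z, hZ, hP⟩ t ht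
    obtain ⟨s, hs, hsm, -, h⟩ := FoliatedFamily.exists_general_member π F hF t ht Z hZ
    exact h (hP s hs hsm)
  · rintro ⟨Z, hZ, hP⟩ t ht
    obtain ⟨s, hs, hsm, h, -⟩ := FoliatedFamily.exists_general_member π F hF t ht Z hZ
    exact h (hP s hs hsm)
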